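/- Let $m\ge 1$, let $\mu\in\mathbb C$ be a primitive $m$-th root of unity, $I=\mathbb Z/m\mathbb Z$ (all indices $i,j,\ell$ are taken modulo $m$), and let $\tau\in\mathbb C$, $k=(k_i)_{i\in I}\in\mathbb C^m$ be regular: $\tau\neq 0$ and $(k_i-k_j)/\tau\notin \frac{j-i}{m}+\mathbb Z$ for $0\le i\ne j\le m-1$. Put $\lambda_i=m(k_{i-1}-k_i)-\tau$. **The ring $\mathcal P$.** Let $\Gamma=\langle s\rangle\cong\mathbb Z_m$ act on $\mathbb C(x)$ by $(sf)(x)=f(\mu^{-1}x)$, let $\mathbb C(x)*\Gamma$ be the crossed product, and let $\epsilon_i=\frac1m\sum_{r=0}^{m-1}\mu^{-ir}s^r$. Define $\theta(\sum_r a_r s^r)=\sum_r\mu^r a_r s^r$, $\partial(\sum_r a_rs^r)=\sum_r a_r's^r$ and $D(f)=\tau\,\partial(f)-x^{-1}\big[\sum_i mk_i\epsilon_i,\,f\big]$. Then $\mathcal P$ is the ring of formal series $\sum_{j\ge0}f_jy^{N-j}$ ($N\in\mathbb Z$, $f_j\in\mathbb C(x)*\Gamma$), with multiplication determined by $yf=\theta^{-1}(f)y+D(f)$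 (so $y$ is the Dunkl operator $\tau\frac{d}{dx}-\frac1x\sum_i mk_i\epsilon_i$, and $xy-yx=\sum_i\lambda_i\epsilon_i$). For $S\in\mathcal P$, $S_+$ denotes the sum of its terms with nonnegative powers of $y$; $\mathcal P_N$ is the set of series involving only powers $y^n$ with $n\le N$, and $\mathcal P_-=\mathcal P_{-1}$. Derivatives of curves in $\mathcal P$ with respect to a complex parameter are taken coefficientwise. **The Calogero–Moser space.** Let $\alpha\in\mathbb Z_{\ge0}^m$, $V_i=\mathbb C^{\alpha_i}$, $V=\bigoplus_iV_i$, with projections $e_i\colon V\to V_i$. Consider $X=\sum_i X_i$, $Y=\sum_i Y_i$, $v=\sum_i v_i$, $w=\sum_i w_i$ with $X_i\colon V_i\to V_{i+1}$, $Y_i\colon V_{i+1}\to V_i$, $v_i\colon\mathbb C\to V_i$, $w_i\colon V_i\to\mathbb C$. The space $\mathcal C_{\alpha,\lambda}$ (for the cyclic quiver framed by one arrow from each vertex) is the set of orbits of $\mathrm{GL}(\alpha)=\prod_i\mathrm{GL}(V_i)$, acting by $(gXg^{-1},gYg^{-1},gv,wg^{-1})$, on the data satisfying $$YX-XY-\sum_i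 v_iw_i=\sum_i\lambda_ie_i .$$ It carries the reduced Poisson structure: the regular functions are restrictions of $\mathrm{GL}(\alpha)$-invariant polynomials in the entries of $(X,Y,v,w)$, with bracket induced from $\{(X_i)_{ab},(Y_j)_{cd}\}=\delta_{ij}\delta_{ad}\delta_{bc}$, $\{(v_i)_a,(w_j)_b\}=\delta_{ij}\delta_{ab}$, all other brackets of coordinates being zero. A curve $\gamma$ in $\mathcal C_{\alpha,\lambda}$, parametrised by $\mathbb C$, is an integral curve of the Hamiltonian flow of $H$ at time $t$ if $\frac{d}{dt}F(\gamma(t))=\{F,H\}(\gamma(t))$ for all regular $F$. For $k\ge1$ let $H_k=-wY^kv$. **The map to $\mathcal P$.** For $(X,Y,v,w)$ as above put $$M=1-\sum_{i,j}\epsilon_iw_i(X-x)^{-1}(Y-y)^{-1}v_j\epsilon_j,\qquad L=MyM^{-1},$$ where $x,y$ commute with $\mathrm{End}(V)$ and $(Y-y)^{-1}=-\sum_{n\ge0}Y^ny^{-n-1}$. **Theorem.** 1. $M$ is invertible in $\mathcal P$, with two-sided inverse $M^{-1}=1+\sum_{i,j}\epsilon_iw_i(Y-y)^{-1}(X-x)^{-1}v_j\epsilon_j$.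 2. The $H_k$ are $\mathrm{GL}(\alpha)$-invariant, and $\{H_j,H_k\}=0$ for all $j,k$. 3. $M$ and $L$ depend only on the point of $\mathcal C_{\alpha,\lambda}$; $M\in1+\mathcal P_-$, $L\in y+\mathcal P_0$, and the coefficient $f_0$ of $L$ at $y^0$ has zero component at the identity of $\Gamma$. 4. The map $\mathcal C_{\alpha,\lambda}\to\mathcal P$, $(X,Y,v,w)\mapsto L$, carries the flow of $H_k$ to the $k$-th flow of the generalised KP hierarchy: for every $k\ge 1$, whenever a curve $\gamma$ in $\mathcal C_{\alpha,\lambda}$ is at time $t$ an integral curve of the flow of $H_k$, the curve $L(t)=L(\gamma(t))$ satisfies at $t$ $$\frac{dL}{dt}=[(L^k)_+,L].$$ 5. The Hamiltonian flows of $H_1,H_2,\dots$ exist for all complex times and commute: there is an action $\Phi$ on $\mathcal C_{\alpha,\lambda}$ of the additive group of finitely supported sequences $(t_1,t_2,\dots)$ of complex numbers such that, for each $k$, moving $t_k$ is the flow of $H_k$. For every point $c$, $L(t)=L(\Phi_t(c))$ solves the whole hierarchy $\partial L/\partial t_k=[(L^k)_+,L]$, $k=1,2,\dots$. -/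

import Mathlib

noncomputable section
namespace CMKP

/-- An automorphism `σ` and a `σ`-derivation `δ` of a ring `A`, that is, the data in the commutation
rule `y a = σ(a) y + δ(a)`. -/
structure SkewDer (A : Type*) [Ring A] where
  σ : A ≃+* A
  δ : A →+ A
  leibniz : ∀ a b, δ (a * b) = δ a * b + σ a * δ b

namespace SkewDer
variable {A : Type*} [Ring A] (S : SkewDer A)

/-- `S.up n p` is the operator `c` for which `y ^ n a = ∑ p, c(a) y ^ (n - p)`. -/
def up : ℕ → ℕ → A → A
  | 0, 0, a => a
  | 0, _ + 1, _ => 0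
  | n + 1, 0, a => S.σ (up n 0 a)
  | n + 1, p + 1, a => S.σ (up n (p + 1) a) + S.δ (up n p a)

/-- `S.down n p` is the operator `c` for which `y ^ (-n) a = ∑ p, c(a) y ^ (-n - p)`. For `n = 1`
these are the operators `(-1) ^ p (σ⁻¹ δ) ^ p σ⁻¹`. -/
def down : ℕ → ℕ → A → A
  | 0, 0, a => a
  | 0, _ + 1, _ => 0
  | n + 1, 0, a => S.σ.symm (down n 0 a)
  | n + 1, p + 1, a => S.σ.symm (down n (p + 1) a - S.δ (down (n + 1) p a))

/-- `S.comm i p` is the operator `c` for which `y ^ i a = ∑ p, c(a) y ^ (i - p)`, `i ∈ ℤ`. -/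
def comm : ℤ → ℕ → A → A
  | Int.ofNat n => S.up n
  | Int.negSucc n => S.down (n + 1)

lemma up_add (n p : ℕ) (a b : A) : S.up n p (a + b) = S.up n p a + S.up n p b := by
  induction n generalizing p with
  | zero => cases p <;> simp [up]
  | succ n ih => cases p <;> simp [up, ih]; abel

lemma down_add (n p : ℕ) (a b : A) : S.down n p (a + b) = S.down n p a + S.down n p b := by
  induction n generalizing p with
  | zero => cases p <;> simp [down]
  | succ n ih =>
    induction p with
    | zero => simp [down, ih]
    | succ p ih2 => simp only [down, ih, ih2, map_add, map_sub]; abel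

lemma comm_add (i : ℤ) (p : ℕ) (a b : A) : S.comm i p (a + b) = S.comm i p a + S.comm i p b := by
  cases i
  · exact S.up_add _ _ _ _
  · exact S.down_add _ _ _ _

lemma comm_zero_arg (i : ℤ) (p : ℕ) : S.comm i p 0 = 0 := by
  have := S.comm_add i p 0 0
  simpa using this

lemma comm_zero (p : ℕ) (a : A) : S.comm 0 p a = if p = 0 then a else 0 := by
  cases p <;> simp [comm, up]

lemma comm_succ_zero (i : ℤ) (a : A) : S.comm (i + 1) 0 a = S.σ (S.comm i 0 a) := by
  rcases i with n | n
  · rfl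
  · cases n with
    | zero => simp [comm, up, down, Int.negSucc_eq]
    | succ n =>
      have : Int.negSucc (n + 1) + 1 = Int.negSucc n := by omega
      rw [this]; simp [comm, down]

lemma comm_succ_succ (i : ℤ) (p : ℕ) (a : A) :
    S.comm (i + 1) (p + 1) a = S.σ (S.comm i (p + 1) a) + S.δ (S.comm i p a) := by
  rcases i with n | n
  · rfl
  · cases n with
    | zero => simp [comm, down, Int.negSucc_eq]; rfl
    | succ n =>
      have : Int.negSucc (n + 1) + 1 = Int.negSucc n := by omega
      rw [this]; simp [comm, down]

end SkewDer

/-- The set `A((y⁻¹))` of formal series `∑ n, aₙ y ^ n` with coefficients on the left and with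
`aₙ = 0` for all large `n`. -/
@[ext] structure PDO {A : Type*} [Ring A] (S : SkewDer A) where
  coeff : ℤ → A
  bdd : ∃ N : ℤ, ∀ n, N < n → coeff n = 0

namespace PDO
variable {A : Type*} [Ring A] {S : SkewDer A}

/-- `E u i n` is the coefficient at `y ^ n` of `y ^ i * u`. -/
def E (u : PDO S) (i n : ℤ) : A := ∑ᶠ p : ℕ, S.comm i p (u.coeff (n - i + p))

/-- Infinite matrices that act as left multiplication does. -/
def Good (S : SkewDer A) (T : ℤ → ℤ → A) : Prop :=
  (∃ N, ∀ i n, i + N < n → T i n = 0) ∧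
    ∀ i n, T (i + 1) n = S.σ (T i (n - 1)) + S.δ (T i n)

lemma Good.sub {T T' : ℤ → ℤ → A} (h : Good S T) (h' : Good S T') :
    Good S (fun i n => T i n - T' i n) := by
  obtain ⟨⟨N, hN⟩, h⟩ := h
  obtain ⟨⟨N', hN'⟩, h'⟩ := h'
  refine ⟨⟨max N N', fun i n hi => ?_⟩, fun i n => ?_⟩
  · simp only [hN i n (by omega), hN' i n (by omega), sub_zero]
  · simp only [h, h', map_sub]; abel

lemma Good.add {T T' : ℤ → ℤ → A} (h : Good S T) (h' : Good S T') :
    Good S (fun i n => T i n + T' i n) := by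
  obtain ⟨⟨N, hN⟩, h⟩ := h
  obtain ⟨⟨N', hN'⟩, h'⟩ := h'
  refine ⟨⟨max N N', fun i n hi => ?_⟩, fun i n => ?_⟩
  · simp only [hN i n (by omega), hN' i n (by omega), add_zero]
  · simp only [h, h', map_add]; abel

lemma Good.eq_zero {T : ℤ → ℤ → A} (h : Good S T) (h0 : ∀ n, T 0 n = 0) (i n : ℤ) :
    T i n = 0 := by
  obtain ⟨⟨N, hN⟩, h⟩ := h
  induction i using Int.induction_on generalizing n with
  | zero => exact h0 n
  | succ i ih => rw [h, ih, ih]; simp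
  | pred i ih =>
    have step : ∀ k : ℕ, ∀ n, -(i : ℤ) - 1 + N + 1 - k ≤ n → T (-(i : ℤ) - 1) n = 0 := by
      intro k
      induction k with
      | zero => intro n hn; exact hN _ _ (by push_cast at hn; omega)
      | succ k ihk =>
        intro n hn
        have e := h (-(i : ℤ) - 1) (n + 1)
        rw [show -(i : ℤ) - 1 + 1 = -(i : ℤ) by ring, ih, ihk (n + 1) (by push_cast at hn; omega),
          map_zero, add_zero, show n + 1 - 1 = n by ring] at e
        exact (map_eq_zero_iff S.σ S.σ.injective).1 e.symm
    exact step (-(i : ℤ) - 1 + N + 1 - n).toNat n (by omega)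

lemma Good.ext {T T' : ℤ → ℤ → A} (h : Good S T) (h' : Good S T')
    (h0 : ∀ n, T 0 n = T' 0 n) (i n : ℤ) : T i n = T' i n :=
  sub_eq_zero.1 ((h.sub h').eq_zero (fun n => sub_eq_zero.2 (h0 n)) i n)

lemma E_eq_sum (u : PDO S) {N : ℤ} (hN : ∀ n, N < n → u.coeff n = 0) (i n : ℤ) (K : ℕ)
    (hK : N < n - i + K) :
    E u i n = ∑ p ∈ Finset.range K, S.comm i p (u.coeff (n - i + p)) := by
  refine finsum_eq_sum_of_support_subset _ fun p hp => ?_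
  by_contra hc
  simp only [Finset.coe_range, Set.mem_Iio, not_lt] at hc
  exact hp (by beta_reduce; rw [hN _ (by omega), S.comm_zero_arg])

lemma E_zero (u : PDO S) (n : ℤ) : E u 0 n = u.coeff n := by
  obtain ⟨N, hN⟩ := u.bdd
  rw [E_eq_sum u hN 0 n ((N - n).toNat + 1) (by omega)]
  rw [Finset.sum_range_succ']
  simp [S.comm_zero]

lemma E_good (u : PDO S) : Good S (E u) := by
  obtain ⟨N, hN⟩ := u.bdd
  refine ⟨⟨N, fun i n hi => ?_⟩, fun i n => ?_⟩
  · rw [E_eq_sum u hN i n 0 (by push_cast; omega)]; simp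
  · obtain ⟨K, hK⟩ : ∃ K : ℕ, N < n - 1 - i + K := ⟨(N - (n - 1 - i)).toNat + 1, by omega⟩
    rw [E_eq_sum u hN (i + 1) n (K + 1) (by push_cast; omega),
      E_eq_sum u hN i (n - 1) (K + 1) (by push_cast; omega),
      E_eq_sum u hN i n K (by omega), Finset.sum_range_succ', Finset.sum_range_succ']
    simp only [S.comm_succ_succ, S.comm_succ_zero, map_add, map_sum, Finset.sum_add_distrib]
    rw [show n - (i + 1) + ((0 : ℕ) : ℤ) = n - 1 - i + ((0 : ℕ) : ℤ) by ring]
    have e1 : ∀ p : ℕ, n - (i + 1) + ((p + 1 : ℕ) : ℤ) = n - 1 - i + ((p + 1 : ℕ) : ℤ) :=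
      fun p => by ring
    have e2 : ∀ p : ℕ, n - 1 - i + ((p + 1 : ℕ) : ℤ) = n - i + (p : ℤ) :=
      fun p => by push_cast; ring
    simp only [e1]
    simp only [e2]
    abel

/-- Product of two infinite matrices. -/
def mm (T T' : ℤ → ℤ → A) (i n : ℤ) : A := ∑ᶠ j : ℤ, T i j * T' j n

lemma mm_eq_sum {T T' : ℤ → ℤ → A} {N N' : ℤ} (hN : ∀ i n, i + N < n → T i n = 0)
    (hN' : ∀ i n, i + N' < n → T' i n = 0) (i n a b : ℤ) (ha : a ≤ n - N') (hb : i + N ≤ b) :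
    mm T T' i n = ∑ j ∈ Finset.Icc a b, T i j * T' j n := by
  refine finsum_eq_sum_of_support_subset _ fun j hj => ?_
  by_contra hc
  simp only [Finset.coe_Icc, Set.mem_Icc, not_and_or, not_le] at hc
  rcases hc with hc | hc
  · exact hj (by beta_reduce; rw [hN' _ _ (by omega), mul_zero])
  · exact hj (by beta_reduce; rw [hN _ _ (by omega), zero_mul])

lemma mm_bdd {T T' : ℤ → ℤ → A} {N N' : ℤ} (hN : ∀ i n, i + N < n → T i n = 0)
    (hN' : ∀ i n, i + N' < n → T' i n = 0) (i n : ℤ) (hi : i + (N + N') < n) : mm T T' i n = 0 := by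
  rw [mm_eq_sum hN hN' i n _ _ le_rfl le_rfl, Finset.Icc_eq_empty (by omega), Finset.sum_empty]

lemma mm_good {T T' : ℤ → ℤ → A} (h : Good S T) (h' : Good S T') : Good S (mm T T') := by
  obtain ⟨⟨N, hN⟩, h⟩ := h
  obtain ⟨⟨N', hN'⟩, h'⟩ := h'
  refine ⟨⟨N + N', mm_bdd hN hN'⟩, fun i n => ?_⟩
  · rw [mm_eq_sum hN hN' (i + 1) n (n - N') (i + 1 + N) le_rfl le_rfl,
      mm_eq_sum hN hN' i (n - 1) (n - 1 - N') (i + N) le_rfl le_rfl,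
      mm_eq_sum hN hN' i n (n - N') (i + N + 1) le_rfl (by omega)]
    have e : ∑ j ∈ Finset.Icc (n - N') (i + 1 + N), S.σ (T i (j - 1)) * T' j n
        = ∑ j ∈ Finset.Icc (n - 1 - N') (i + N), S.σ (T i j) * T' (j + 1) n := by
      refine Finset.sum_bij' (fun j _ => j - 1) (fun j _ => j + 1) ?_ ?_ ?_ ?_ ?_ <;>
        simp <;> omega
    have e' : ∑ j ∈ Finset.Icc (n - 1 - N') (i + N), S.σ (T i j) * S.δ (T' j n)
        = ∑ j ∈ Finset.Icc (n - N') (i + N + 1), S.σ (T i j) * S.δ (T' j n) := by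
      rw [← finsum_eq_sum_of_support_subset, ← finsum_eq_sum_of_support_subset] <;>
      · intro j hj
        by_contra hc
        simp only [Finset.coe_Icc, Set.mem_Icc, not_and_or, not_le] at hc
        apply hj
        beta_reduce
        by_cases hj1 : j < n - N'
        · rw [hN' j n (by omega), map_zero, mul_zero]
        · rw [hN i j (by omega), map_zero, zero_mul]
    simp only [h, add_mul, Finset.sum_add_distrib, e, h', mul_add, map_sum, map_mul, S.leibniz, e']
    rw [show i + 1 + N = i + N + 1 by ring]
    abel

instance : Zero (PDO S) := ⟨⟨fun _ => 0, 0, fun _ _ => rfl⟩⟩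

instance : Add (PDO S) := ⟨fun u v => ⟨fun n => u.coeff n + v.coeff n, by
  obtain ⟨N, hN⟩ := u.bdd
  obtain ⟨N', hN'⟩ := v.bdd
  exact ⟨max N N', fun n hn => by rw [hN _ (by omega), hN' _ (by omega), add_zero]⟩⟩⟩

instance : Neg (PDO S) := ⟨fun u => ⟨fun n => -u.coeff n, by
  obtain ⟨N, hN⟩ := u.bdd
  exact ⟨N, fun n hn => by rw [hN _ hn, neg_zero]⟩⟩⟩

/-- The monomial `a y ^ k`. -/
def monomial (S : SkewDer A) (k : ℤ) (a : A) : PDO S :=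
  ⟨fun n => if n = k then a else 0, k, fun n hn => by rw [if_neg (by omega)]⟩

instance : One (PDO S) := ⟨monomial S 0 1⟩

lemma mul_bdd (u v : PDO S) :
    ∃ N : ℤ, ∀ n, N < n → (∑ᶠ i : ℤ, u.coeff i * E v i n) = 0 := by
  obtain ⟨N, hN⟩ := (mm_good (E_good u) (E_good v)).1
  refine ⟨N, fun n hn => ?_⟩
  have := hN 0 n (by omega)
  simpa only [mm, E_zero] using this

/-- Multiplication in `A((y⁻¹))`: the product of `∑ᵢ uᵢ y ^ i` and `∑ⱼ vⱼ y ^ j` is obtained by moving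
every `y ^ i` to the right of every `vⱼ`. -/
instance : Mul (PDO S) := ⟨fun u v => ⟨fun n => ∑ᶠ i : ℤ, u.coeff i * E v i n, mul_bdd u v⟩⟩

@[simp] lemma zero_coeff (n : ℤ) : (0 : PDO S).coeff n = 0 := rfl
@[simp] lemma add_coeff (u v : PDO S) (n : ℤ) : (u + v).coeff n = u.coeff n + v.coeff n := rfl
@[simp] lemma neg_coeff (u : PDO S) (n : ℤ) : (-u).coeff n = -u.coeff n := rfl
lemma one_coeff (n : ℤ) : (1 : PDO S).coeff n = if n = 0 then 1 else 0 := rfl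
lemma mul_coeff (u v : PDO S) (n : ℤ) : (u * v).coeff n = mm (E u) (E v) 0 n := by
  simp only [mm, E_zero]; rfl

lemma E_mul (u v : PDO S) : E (u * v) = mm (E u) (E v) := by
  funext i n
  exact (E_good _).ext (mm_good (E_good u) (E_good v))
    (fun n => by rw [E_zero, mul_coeff]) i n

lemma E_one (i n : ℤ) : E (1 : PDO S) i n = if n = i then 1 else 0 := by
  have hd : S.δ 1 = 0 := by simpa using S.leibniz 1 1
  refine (E_good (1 : PDO S)).ext (T' := fun i n => if n = i then 1 else 0)
    ⟨⟨0, fun i n hi => if_neg (by omega)⟩, fun i n => ?_⟩ (fun n => by rw [E_zero]; rfl) i n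
  have : (n - 1 = i) ↔ (n = i + 1) := by omega
  simp only [this, apply_ite S.σ, apply_ite S.δ, map_one, map_zero, hd, ite_self, add_zero]

lemma E_add (u v : PDO S) (i n : ℤ) : E (u + v) i n = E u i n + E v i n :=
  (E_good _).ext ((E_good u).add (E_good v)) (fun n => by simp [E_zero]) i n

lemma mm_assoc {T₁ T₂ T₃ : ℤ → ℤ → A} (h₁ : Good S T₁) (h₂ : Good S T₂) (h₃ : Good S T₃)
    (i n : ℤ) : mm (mm T₁ T₂) T₃ i n = mm T₁ (mm T₂ T₃) i n := by
  obtain ⟨N1, h1⟩ := h₁.1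
  obtain ⟨N2, h2⟩ := h₂.1
  obtain ⟨N3, h3⟩ := h₃.1
  rw [mm_eq_sum (mm_bdd h1 h2) h3 i n (n - N3) (i + (N1 + N2)) le_rfl le_rfl,
    mm_eq_sum h1 (mm_bdd h2 h3) i n (n - (N2 + N3)) (i + N1) le_rfl le_rfl]
  have e1 : ∀ j ∈ Finset.Icc (n - N3) (i + (N1 + N2)), mm T₁ T₂ i j * T₃ j n =
      ∑ l ∈ Finset.Icc (n - (N2 + N3)) (i + N1), T₁ i l * T₂ l j * T₃ j n := fun j hj => by
    rw [Finset.mem_Icc] at hj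
    rw [mm_eq_sum h1 h2 i j (n - (N2 + N3)) (i + N1) (by omega) le_rfl, Finset.sum_mul]
  have e2 : ∀ l ∈ Finset.Icc (n - (N2 + N3)) (i + N1), T₁ i l * mm T₂ T₃ l n =
      ∑ j ∈ Finset.Icc (n - N3) (i + (N1 + N2)), T₁ i l * T₂ l j * T₃ j n := fun l hl => by
    rw [Finset.mem_Icc] at hl
    rw [mm_eq_sum h2 h3 l n (n - N3) (i + (N1 + N2)) le_rfl (by omega), Finset.mul_sum]
    simp only [mul_assoc]
  rw [Finset.sum_congr rfl e1, Finset.sum_congr rfl e2, Finset.sum_comm]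

lemma mm_add {T T₁ T₂ : ℤ → ℤ → A} (h : Good S T) (h₁ : Good S T₁) (h₂ : Good S T₂) (i n : ℤ) :
    mm T (fun i n => T₁ i n + T₂ i n) i n = mm T T₁ i n + mm T T₂ i n := by
  obtain ⟨N, hN⟩ := h.1
  obtain ⟨N1, h1⟩ := h₁.1
  obtain ⟨N2, h2⟩ := h₂.1
  obtain ⟨N3, h3⟩ := (h₁.add h₂).1
  rw [mm_eq_sum hN h3 i n (n - |N1| - |N2| - |N3|) _ (by have := abs_nonneg N1; have := abs_nonneg N2; have := le_abs_self N3; omega) le_rfl,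
    mm_eq_sum hN h1 i n (n - |N1| - |N2| - |N3|) _ (by have := le_abs_self N1; have := abs_nonneg N2; have := abs_nonneg N3; omega) le_rfl,
    mm_eq_sum hN h2 i n (n - |N1| - |N2| - |N3|) _ (by have := abs_nonneg N1; have := le_abs_self N2; have := abs_nonneg N3; omega) le_rfl]
  simp only [mul_add, Finset.sum_add_distrib]

lemma add_mm {T T₁ T₂ : ℤ → ℤ → A} (h : Good S T) (h₁ : Good S T₁) (h₂ : Good S T₂) (i n : ℤ) :
    mm (fun i n => T₁ i n + T₂ i n) T i n = mm T₁ T i n + mm T₂ T i n := by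
  obtain ⟨N, hN⟩ := h.1
  obtain ⟨N1, h1⟩ := h₁.1
  obtain ⟨N2, h2⟩ := h₂.1
  obtain ⟨N3, h3⟩ := (h₁.add h₂).1
  rw [mm_eq_sum h3 hN i n _ (i + |N1| + |N2| + |N3|) le_rfl (by have := abs_nonneg N1; have := abs_nonneg N2; have := le_abs_self N3; omega),
    mm_eq_sum h1 hN i n _ (i + |N1| + |N2| + |N3|) le_rfl (by have := le_abs_self N1; have := abs_nonneg N2; have := abs_nonneg N3; omega),
    mm_eq_sum h2 hN i n _ (i + |N1| + |N2| + |N3|) le_rfl (by have := abs_nonneg N1; have := le_abs_self N2; have := abs_nonneg N3; omega)]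
  simp only [add_mul, Finset.sum_add_distrib]

instance : Ring (PDO S) where
  add_assoc _ _ _ := PDO.ext (funext fun _ => add_assoc _ _ _)
  zero_add _ := PDO.ext (funext fun _ => zero_add _)
  add_zero _ := PDO.ext (funext fun _ => add_zero _)
  add_comm _ _ := PDO.ext (funext fun _ => add_comm _ _)
  neg_add_cancel _ := PDO.ext (funext fun _ => neg_add_cancel _)
  mul_assoc u v w := PDO.ext (funext fun n => by
    rw [mul_coeff, mul_coeff, E_mul, E_mul, mm_assoc (E_good u) (E_good v) (E_good w)])
  zero_mul u := PDO.ext (funext fun n => by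
    rw [mul_coeff]; simp only [mm, E_zero]; simp)
  mul_zero u := PDO.ext (funext fun n => by
    have h0 : ∀ i n, E (0 : PDO S) i n = 0 :=
      fun i n => (E_good (0 : PDO S)).eq_zero (fun n => by simp [E_zero]) i n
    rw [mul_coeff]; simp [mm, h0])
  one_mul u := PDO.ext (funext fun n => by
    rw [mul_coeff, mm, finsum_eq_single _ 0]
    · rw [E_one, if_pos rfl, one_mul, E_zero]
    · intro j hj; rw [E_one, if_neg hj, zero_mul])
  mul_one u := PDO.ext (funext fun n => by
    rw [mul_coeff, mm, finsum_eq_single _ n]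
    · simp [E_one, E_zero]
    · intro j hj; rw [E_one, if_neg (Ne.symm hj), mul_zero])
  left_distrib u v w := PDO.ext (funext fun n => by
    have := mm_add (E_good u) (E_good v) (E_good w) 0 n
    simp only [← E_add] at this
    simpa only [mul_coeff, add_coeff] using this)
  right_distrib u v w := PDO.ext (funext fun n => by
    have := add_mm (E_good w) (E_good u) (E_good v) 0 n
    simp only [← E_add] at this
    simpa only [mul_coeff, add_coeff] using this)
  nsmul := nsmulRec
  zsmul := zsmulRec

end PDO

open Polynomial

/-! ### Rational functions, the cyclic group and the crossed product -/

/-- The derivative `d/dx` of a rational function. -/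
def dRat (f : RatFunc ℂ) : RatFunc ℂ :=
  algebraMap ℂ[X] (RatFunc ℂ) (derivative f.num * f.denom - f.num * derivative f.denom) /
    algebraMap ℂ[X] (RatFunc ℂ) (f.denom ^ 2)

lemma quotient_rule_aux {R : Type*} [CommRing R] {n d p q n' d' p' q' : R} (h1 : n * q = p * d)
    (h2 : n' * q + n * q' = p' * d + p * d') :
    (n' * d - n * d') * q ^ 2 = (p' * q - p * q') * d ^ 2 := by
  linear_combination (d * q) * h2 - (d' * q + d * q') * h1

lemma dRat_div_aux {K : Type*} [Field K] {φ : ℂ[X] →+* K} (hφ : Function.Injective φ)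
    {p q n d : ℂ[X]} (hq : q ≠ 0) (hd : d ≠ 0) (h : φ n / φ d = φ p / φ q) :
    φ (derivative n * d - n * derivative d) / φ (d ^ 2) =
      φ (derivative p * q - p * derivative q) / φ (q ^ 2) := by
  have key : ∀ {q : ℂ[X]}, q ≠ 0 → φ q ≠ 0 := fun h => (map_ne_zero_iff φ hφ).2 h
  have h1 : n * q = p * d := by
    rw [div_eq_div_iff (key hd) (key hq), ← map_mul, ← map_mul] at h
    exact hφ h
  have h2 := congrArg derivative h1
  simp only [derivative_mul] at h2
  rw [div_eq_div_iff (key (pow_ne_zero 2 hd)) (key (pow_ne_zero 2 hq)), ← map_mul, ← map_mul]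
  exact congrArg φ (quotient_rule_aux h1 h2)

lemma dRat_div (p q : ℂ[X]) (hq : q ≠ 0) :
    dRat (algebraMap ℂ[X] (RatFunc ℂ) p / algebraMap ℂ[X] (RatFunc ℂ) q) =
      algebraMap ℂ[X] (RatFunc ℂ) (derivative p * q - p * derivative q) /
        algebraMap ℂ[X] (RatFunc ℂ) (q ^ 2) :=
  dRat_div_aux (RatFunc.algebraMap_injective ℂ) hq (RatFunc.denom_ne_zero _)
    (RatFunc.num_div_denom _)

lemma exists_div (f : RatFunc ℂ) : ∃ p q : ℂ[X], q ≠ 0 ∧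
    f = algebraMap ℂ[X] (RatFunc ℂ) p / algebraMap ℂ[X] (RatFunc ℂ) q :=
  ⟨f.num, f.denom, f.denom_ne_zero, (RatFunc.num_div_denom f).symm⟩

lemma algebraMap_poly_ne_zero {q : ℂ[X]} (hq : q ≠ 0) : algebraMap ℂ[X] (RatFunc ℂ) q ≠ 0 :=
  (map_ne_zero_iff _ (RatFunc.algebraMap_injective ℂ)).2 hq

lemma dRat_add (f g : RatFunc ℂ) : dRat (f + g) = dRat f + dRat g := by
  obtain ⟨p, q, hq, rfl⟩ := exists_div f
  obtain ⟨r, s, hs, rfl⟩ := exists_div g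
  have hq' := algebraMap_poly_ne_zero hq
  have hs' := algebraMap_poly_ne_zero hs
  rw [div_add_div _ _ hq' hs', ← map_mul, ← map_mul, ← map_mul, ← map_add,
    dRat_div _ _ (mul_ne_zero hq hs), dRat_div _ _ hq, dRat_div _ _ hs]
  simp only [derivative_mul, map_mul, map_add, map_sub, map_pow]
  field_simp
  ring

lemma dRat_mul (f g : RatFunc ℂ) : dRat (f * g) = dRat f * g + f * dRat g := by
  obtain ⟨p, q, hq, rfl⟩ := exists_div f
  obtain ⟨r, s, hs, rfl⟩ := exists_div g
  have hq' := algebraMap_poly_ne_zero hq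
  have hs' := algebraMap_poly_ne_zero hs
  rw [div_mul_div_comm, ← map_mul, ← map_mul,
    dRat_div _ _ (mul_ne_zero hq hs), dRat_div _ _ hq, dRat_div _ _ hs]
  simp only [derivative_mul, map_mul, map_add, map_sub, map_pow]
  field_simp
  ring

/-- The substitution `f(x) ↦ f(a x)`. -/
def dilate (a : ℂˣ) : RatFunc ℂ →+* RatFunc ℂ :=
  RatFunc.mapRingHom (compRingHom (C (a : ℂ) * X)) fun q hq => by
    rw [Submonoid.mem_comap, mem_nonZeroDivisors_iff_ne_zero]
    intro h
    exact nonZeroDivisors.ne_zero hq ((comp_C_mul_X_eq_zero_iff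
      (mem_nonZeroDivisors_iff_ne_zero.2 a.ne_zero)).1 h)

lemma dilate_div (a : ℂˣ) (p q : ℂ[X]) :
    dilate a (algebraMap ℂ[X] (RatFunc ℂ) p / algebraMap ℂ[X] (RatFunc ℂ) q) =
      algebraMap ℂ[X] (RatFunc ℂ) (p.comp (C (a : ℂ) * X)) /
        algebraMap ℂ[X] (RatFunc ℂ) (q.comp (C (a : ℂ) * X)) := by
  rw [dilate, RatFunc.coe_mapRingHom_eq_coe_map, RatFunc.map_apply_div]
  rfl

lemma dilate_one (f : RatFunc ℂ) : dilate 1 f = f := by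
  obtain ⟨p, q, hq, rfl⟩ := exists_div f
  rw [dilate_div]
  simp

lemma dilate_mul (a b : ℂˣ) (f : RatFunc ℂ) : dilate (a * b) f = dilate a (dilate b f) := by
  obtain ⟨p, q, hq, rfl⟩ := exists_div f
  rw [dilate_div, dilate_div, dilate_div, comp_assoc, comp_assoc]
  have : (C (b : ℂ) * X).comp (C (a : ℂ) * X) = C ((a * b : ℂˣ) : ℂ) * X := by
    rw [mul_comp, C_comp, X_comp, ← mul_assoc, ← C_mul, Units.val_mul, mul_comm (b : ℂ)]
  rw [this]

/-- The cyclic group `Γ` of `m`-th roots of unity in `ℂ`. -/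
def Gam (m : ℕ) : Type := rootsOfUnity m ℂ

instance (m : ℕ) : CommGroup (Gam m) := inferInstanceAs (CommGroup (rootsOfUnity m ℂ))

/-- An element of `Γ` as a complex number. -/
def Gam.val {m : ℕ} : Gam m →* ℂˣ := (rootsOfUnity m ℂ).subtype

/-- `Γ` acts on rational functions by `(g f)(x) = f(g⁻¹ x)`. -/
instance (m : ℕ) : MulSemiringAction (Gam m) (RatFunc ℂ) where
  smul g f := dilate (g.val)⁻¹ f
  one_smul f := by
    change dilate _ f = f
    rw [map_one, inv_one, dilate_one]
  mul_smul g h f := by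
    change dilate _ f = dilate _ (dilate _ f)
    rw [← dilate_mul, map_mul, mul_inv]
  smul_zero g := map_zero (dilate _)
  smul_add g := map_add (dilate _)
  smul_one g := map_one (dilate _)
  smul_mul g := map_mul (dilate _)

lemma Gam.smul_def {m : ℕ} (g : Gam m) (f : RatFunc ℂ) : g • f = dilate (g.val)⁻¹ f := rfl

/-- The crossed product `ℂ(x) * Γ`; `SkewMonoidAlgebra.single g f` is the element `f g`. -/
abbrev Cross (m : ℕ) : Type := SkewMonoidAlgebra (RatFunc ℂ) (Gam m)

/-- A rational function as an element of `ℂ(x) * Γ`. -/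
def ofRat (m : ℕ) (f : RatFunc ℂ) : Cross m := SkewMonoidAlgebra.single 1 f

/-- Apply an additive map to `g`-coefficients, for every `g ∈ Γ`. -/
def mapCoeff {m : ℕ} (φ : Gam m → RatFunc ℂ →+ RatFunc ℂ) : Cross m →+ Cross m where
  toFun f := f.sum fun g a => SkewMonoidAlgebra.single g (φ g a)
  map_zero' := by simp
  map_add' f f' := by
    classical
    rw [SkewMonoidAlgebra.sum_add_index] <;> intros <;> simp [SkewMonoidAlgebra.single_add]

lemma mapCoeff_single {m : ℕ} (φ : Gam m → RatFunc ℂ →+ RatFunc ℂ) (g : Gam m) (a : RatFunc ℂ) :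
    mapCoeff φ (SkewMonoidAlgebra.single g a) = SkewMonoidAlgebra.single g (φ g a) :=
  SkewMonoidAlgebra.sum_single_index (h := fun g a => SkewMonoidAlgebra.single g (φ g a))
    (by simp)

/-- `∂ (∑ a_g g) = ∑ (d a_g / dx) g` on `ℂ(x) * Γ`. -/
def dCross (m : ℕ) : Cross m →+ Cross m := mapCoeff fun _ => AddMonoidHom.mk' dRat dRat_add

/-- `∑ a_g g ↦ ∑ χ(g) a_g g`. -/
def twistHom {m : ℕ} (χ : Gam m →* ℂˣ) : Cross m →+ Cross m :=
  mapCoeff fun g => AddMonoidHom.mulLeft (RatFunc.C (χ g : ℂ))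

lemma twistHom_single {m : ℕ} (χ : Gam m →* ℂˣ) (g : Gam m) (a : RatFunc ℂ) :
    twistHom χ (SkewMonoidAlgebra.single g a) =
      SkewMonoidAlgebra.single g (RatFunc.C (χ g : ℂ) * a) := by
  rw [twistHom, mapCoeff_single]; rfl

@[elab_as_elim]
lemma Cross.induction {m : ℕ} {p : Cross m → Prop} (f : Cross m) (h0 : p 0)
    (h1 : ∀ g a, p (SkewMonoidAlgebra.single g a)) (h2 : ∀ f f', p f → p f' → p (f + f')) : p f :=
  SkewMonoidAlgebra.induction_on f h0 h1 h2

lemma dilate_C (a : ℂˣ) (c : ℂ) : dilate a (RatFunc.C c) = RatFunc.C c := by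
  have := dilate_div a (C c) 1
  simpa using this

lemma smul_C {m : ℕ} (g : Gam m) (c : ℂ) : g • RatFunc.C c = RatFunc.C c := dilate_C _ _

/-- The automorphism `∑ a_g g ↦ ∑ χ(g) a_g g` of `ℂ(x) * Γ`. -/
def twist {m : ℕ} (χ : Gam m →* ℂˣ) : Cross m ≃+* Cross m where
  toFun := twistHom χ
  invFun := twistHom χ⁻¹
  left_inv f := by
    induction f using Cross.induction with
    | h0 => simp
    | h2 f f' h h' => rw [map_add, map_add, h, h']
    | h1 g a => ?_
    rw [twistHom_single, twistHom_single, ← mul_assoc, ← map_mul]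
    simp
  right_inv f := by
    induction f using Cross.induction with
    | h0 => simp
    | h2 f f' h h' => rw [map_add, map_add, h, h']
    | h1 g a => ?_
    rw [twistHom_single, twistHom_single, ← mul_assoc, ← map_mul]
    simp
  map_add' := map_add _
  map_mul' f f' := by
    induction f using Cross.induction with
    | h0 => simp
    | h2 f₁ f₂ h h' => rw [add_mul, map_add, h, h', map_add, add_mul]
    | h1 g a => ?_
    induction f' using Cross.induction with
    | h0 => simp
    | h2 f₁ f₂ h h' => rw [mul_add, map_add, h, h', map_add, mul_add]
    | h1 g' a' => ?_
    rw [SkewMonoidAlgebra.single_mul_single, twistHom_single, twistHom_single, twistHom_single,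
      SkewMonoidAlgebra.single_mul_single, smul_mul', smul_C, map_mul, Units.val_mul, map_mul]
    congr 1
    ring

/-! ### The Cherednik algebra parameters and the ring `𝒫` -/

/-- The parameters: a primitive `m`-th root of unity `μ`, `τ ∈ ℂ` and `k₀, …, k_{m-1} ∈ ℂ`,
with indices modulo `m`. -/
structure Param (m : ℕ) where
  μ : ℂ
  prim : IsPrimitiveRoot μ m
  τ : ℂ
  k : ZMod m → ℂ

namespace Param
variable {m : ℕ} [NeZero m] (P : Param m)

/-- The generator `s` of `Γ`. -/
def s : Gam m := P.prim.toRootsOfUnity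

/-- The idempotents `ε_i = (1 / m) ∑ μ ^ (-i r) s ^ r`. -/
def ε (i : ZMod m) : Cross m :=
  ∑ r ∈ Finset.range m,
    SkewMonoidAlgebra.single (P.s ^ r) (RatFunc.C ((1 / m) * P.μ⁻¹ ^ (i.val * r)))

/-- `λ_i = m (k_{i-1} - k_i) - τ`. -/
def lam (i : ZMod m) : ℂ := m * (P.k (i - 1) - P.k i) - P.τ

/-- Regularity: `τ ≠ 0` and `(k_i - k_j) / τ ∉ (j - i) / m + ℤ` for `i ≠ j`. -/
def Regular : Prop :=
  P.τ ≠ 0 ∧ ∀ i j : ZMod m, i ≠ j → ∀ n : ℤ,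
    (P.k i - P.k j) / P.τ ≠ ((j.val : ℂ) - (i.val : ℂ)) / m + n

/-- The element `∑ m k_i ε_i = ∑ c_γ γ` of `ℂΓ`. -/
def kSum : Cross m := ∑ i : ZMod m, ofRat m (RatFunc.C (m * P.k i)) * P.ε i

/-- The map `D(f) = τ ∂(f) - ∑ c_γ x⁻¹ [γ, f]` on `ℂ(x) * Γ` (the summand with `γ = e` is zero). -/
def D : Cross m →+ Cross m where
  toFun f := ofRat m (RatFunc.C P.τ) * dCross m f
    - ofRat m (RatFunc.X)⁻¹ * (P.kSum * f - f * P.kSum)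
  map_zero' := by simp
  map_add' f f' := by simp only [map_add, mul_add, add_mul, mul_sub]; abel

end Param

lemma dilate_X (a : ℂˣ) : dilate a RatFunc.X = RatFunc.C (a : ℂ) * RatFunc.X := by
  have := dilate_div a X 1
  simpa using this

lemma dRat_dilate (a : ℂˣ) (f : RatFunc ℂ) :
    dRat (dilate a f) = RatFunc.C (a : ℂ) * dilate a (dRat f) := by
  obtain ⟨p, q, hq, rfl⟩ := exists_div f
  have hq' : q.comp (C (a : ℂ) * X) ≠ 0 := fun h => hq ((comp_C_mul_X_eq_zero_iff
      (mem_nonZeroDivisors_iff_ne_zero.2 a.ne_zero)).1 h)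
  rw [dilate_div, dRat_div _ _ hq', dRat_div _ _ hq, dilate_div, ← RatFunc.algebraMap_C,
    ← mul_div_assoc, ← map_mul]
  congr 2
  · simp [derivative_comp]; ring
  · simp

/-- `f ↦ f` scaled by `g⁻¹` on the summand `ℂ(x) g`: the inverse of `θ(∑ a_g g) = ∑ g a_g g`. -/
abbrev thetaInv (m : ℕ) : Cross m ≃+* Cross m := twist (Gam.val (m := m))⁻¹

lemma thetaInv_single {m : ℕ} (g : Gam m) (a : RatFunc ℂ) :
    thetaInv m (SkewMonoidAlgebra.single g a) =
      SkewMonoidAlgebra.single g (RatFunc.C (((g.val)⁻¹ : ℂˣ) : ℂ) * a) :=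
  twistHom_single _ g a

lemma dCross_single {m : ℕ} (g : Gam m) (a : RatFunc ℂ) :
    dCross m (SkewMonoidAlgebra.single g a) = SkewMonoidAlgebra.single g (dRat a) :=
  mapCoeff_single _ g a

lemma dCross_mul {m : ℕ} (f f' : Cross m) :
    dCross m (f * f') = dCross m f * f' + thetaInv m f * dCross m f' := by
  induction f using Cross.induction with
    | h0 => simp
    | h2 f₁ f₂ h h' => simp only [add_mul, map_add, h, h']; abel
    | h1 g a => ?_
  induction f' using Cross.induction with
    | h0 => simp
    | h2 f₁ f₂ h h' => simp only [mul_add, map_add, h, h']; abel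
    | h1 g' a' => ?_
  rw [SkewMonoidAlgebra.single_mul_single, dCross_single, dCross_single, dCross_single,
    thetaInv_single, SkewMonoidAlgebra.single_mul_single, SkewMonoidAlgebra.single_mul_single,
    ← SkewMonoidAlgebra.single_add, dRat_mul, Gam.smul_def, Gam.smul_def, dRat_dilate]
  congr 1
  ring

lemma ofRat_mul_single {m : ℕ} (f a : RatFunc ℂ) (g : Gam m) :
    ofRat m f * SkewMonoidAlgebra.single g a = SkewMonoidAlgebra.single g (f * a) := by
  rw [ofRat, SkewMonoidAlgebra.single_mul_single, one_mul, one_smul]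

lemma ofRat_C_comm {m : ℕ} (c : ℂ) (f : Cross m) :
    ofRat m (RatFunc.C c) * f = f * ofRat m (RatFunc.C c) := by
  induction f using Cross.induction with
    | h0 => simp
    | h2 f₁ f₂ h h' => simp only [add_mul, mul_add, h, h']
    | h1 g a => ?_
  rw [ofRat_mul_single, ofRat, SkewMonoidAlgebra.single_mul_single, mul_one, smul_C, mul_comm]

lemma mul_ofRat_invX {m : ℕ} (f : Cross m) :
    thetaInv m f * ofRat m (RatFunc.X)⁻¹ = ofRat m (RatFunc.X)⁻¹ * f := by
  induction f using Cross.induction with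
    | h0 => simp
    | h2 f₁ f₂ h h' => simp only [add_mul, mul_add, map_add, h, h']
    | h1 g a => ?_
  rw [thetaInv_single, ofRat_mul_single, ofRat, SkewMonoidAlgebra.single_mul_single, mul_one,
    Gam.smul_def, map_inv₀, dilate_X]
  congr 1
  have h : RatFunc.C (((g.val)⁻¹ : ℂˣ) : ℂ) ≠ 0 := by simp
  field_simp

namespace Param
variable {m : ℕ} [NeZero m] (P : Param m)

lemma D_apply (f : Cross m) : P.D f = ofRat m (RatFunc.C P.τ) * dCross m f
    - ofRat m (RatFunc.X)⁻¹ * (P.kSum * f - f * P.kSum) := rfl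

lemma D_mul (f f' : Cross m) : P.D (f * f') = P.D f * f' + thetaInv m f * P.D f' := by
  simp only [D_apply, dCross_mul, mul_sub, sub_mul, mul_add]
  have e1 := mul_ofRat_invX f
  have e2 : thetaInv m f * (ofRat m (RatFunc.C P.τ) * dCross m f') =
      ofRat m (RatFunc.C P.τ) * (thetaInv m f * dCross m f') := by
    rw [← mul_assoc, ← ofRat_C_comm, mul_assoc]
  simp only [e2, ← mul_assoc, e1]
  abel

/-- The rule `y f = θ⁻¹(f) y + D(f)` for the Dunkl operator `y = τ ∂ - x⁻¹ ∑ m k_i ε_i`. -/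
def skew : SkewDer (Cross m) where
  σ := thetaInv m
  δ := P.D
  leibniz := P.D_mul

/-- The ring `𝒫 = (ℂ(x) * Γ)((y⁻¹))`. -/
abbrev Psd : Type := PDO P.skew

/-- An element of `ℂ(x) * Γ` as an element of `𝒫`. -/
def ι (f : Cross m) : P.Psd := PDO.monomial P.skew 0 f

/-- The power `y ^ n` in `𝒫`, `n ∈ ℤ`. -/
def yPow (n : ℤ) : P.Psd := PDO.monomial P.skew n 1

end Param

namespace PDO
variable {A : Type*} [Ring A] {S : SkewDer A}

/-- The positive part `∑_{n ≥ 0} aₙ y ^ n` of `∑ aₙ y ^ n`. -/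
def pos (u : PDO S) : PDO S where
  coeff n := if 0 ≤ n then u.coeff n else 0
  bdd := by
    obtain ⟨N, hN⟩ := u.bdd
    exact ⟨N, fun n hn => by rw [hN n hn, ite_self]⟩

end PDO

/-! ### Representations of the framed cyclic quiver and Calogero–Moser spaces -/

section Quiver
variable {m : ℕ} [NeZero m] (α : ZMod m → ℕ)

/-- Indices of the standard basis of `V = ⨁ V_i`, `V_i = ℂ ^ (α i)`; the first component is `i`. -/
abbrev Idx : Type := Σ i : ZMod m, Fin (α i)

/-- The coordinates on the space of representations: the entries (row, column) of
`X_i : V_i → V_{i+1}` and of `Y_i : V_{i+1} → V_i`, and the entries of `v_i ∈ V_i`, `w_i ∈ V_i^*`. -/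
inductive Coord : Type
  | X (r c : Idx α) (h : r.1 = c.1 + 1) : Coord
  | Y (r c : Idx α) (h : c.1 = r.1 + 1) : Coord
  | v (r : Idx α) : Coord
  | w (r : Idx α) : Coord

variable {α}

section
variable {R : Type*} [CommRing R] (p : Coord α → R)

/-- `X = ∑ X_i` as an endomorphism of `V`. -/
def Xmat : Matrix (Idx α) (Idx α) R := fun r c => if h : r.1 = c.1 + 1 then p (.X r c h) else 0

/-- `Y = ∑ Y_i` as an endomorphism of `V`. -/
def Ymat : Matrix (Idx α) (Idx α) R := fun r c => if h : c.1 = r.1 + 1 then p (.Y r c h) else 0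

/-- `v = ∑ v_i`. -/
def vTot : Idx α → R := fun r => p (.v r)

/-- `w = ∑ w_i`. -/
def wTot : Idx α → R := fun r => p (.w r)

/-- `v_i`, extended by zero to a vector in `V`. -/
def vPart (i : ZMod m) : Idx α → R := fun r => if r.1 = i then p (.v r) else 0

/-- `w_i`, extended by zero to a covector on `V`. -/
def wPart (i : ZMod m) : Idx α → R := fun r => if r.1 = i then p (.w r) else 0

end

/-- The matrix of an element of `GL(α) = ∏ GL(V_i)` on `V`. -/
def block (g : ∀ i : ZMod m, GL (Fin (α i)) ℂ) : Matrix (Idx α) (Idx α) ℂ :=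
  Matrix.blockDiagonal' fun i => (g i : Matrix (Fin (α i)) (Fin (α i)) ℂ)

lemma block_one : block (1 : ∀ i : ZMod m, GL (Fin (α i)) ℂ) = 1 := by
  simp only [block, Pi.one_apply, Units.val_one]
  exact Matrix.blockDiagonal'_one

lemma block_mul (g h : ∀ i : ZMod m, GL (Fin (α i)) ℂ) : block (g * h) = block g * block h := by
  simp only [block, Pi.mul_apply, Units.val_mul]
  exact Matrix.blockDiagonal'_mul _ _

/-- `q` is the image `(g X g⁻¹, g Y g⁻¹, g v, w g⁻¹)` of `p` under some `g ∈ GL(α)`. -/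
def SameOrbit (p q : Coord α → ℂ) : Prop :=
  ∃ g : ∀ i : ZMod m, GL (Fin (α i)) ℂ,
    Xmat q = block g * Xmat p * block g⁻¹ ∧ Ymat q = block g * Ymat p * block g⁻¹ ∧
    vTot q = (block g).mulVec (vTot p) ∧ wTot q = Matrix.vecMul (wTot p) (block g⁻¹)

lemma SameOrbit.refl (p : Coord α → ℂ) : SameOrbit p p :=
  ⟨1, by simp [block_one]⟩

lemma SameOrbit.symm {p q : Coord α → ℂ} (h : SameOrbit p q) : SameOrbit q p := by
  obtain ⟨g, hX, hY, hv, hw⟩ := h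
  have e : block g⁻¹ * block g = 1 := by rw [← block_mul, inv_mul_cancel, block_one]
  refine ⟨g⁻¹, ?_, ?_, ?_, ?_⟩
  · rw [hX, inv_inv, ← mul_assoc, ← mul_assoc, e, one_mul, mul_assoc, e, mul_one]
  · rw [hY, inv_inv, ← mul_assoc, ← mul_assoc, e, one_mul, mul_assoc, e, mul_one]
  · rw [hv, Matrix.mulVec_mulVec, e, Matrix.one_mulVec]
  · rw [hw, inv_inv, Matrix.vecMul_vecMul, e, Matrix.vecMul_one]

lemma SameOrbit.trans {p q r : Coord α → ℂ} (h : SameOrbit p q) (h' : SameOrbit q r) :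
    SameOrbit p r := by
  obtain ⟨g, hX, hY, hv, hw⟩ := h
  obtain ⟨g', hX', hY', hv', hw'⟩ := h'
  refine ⟨g' * g, ?_, ?_, ?_, ?_⟩
  · rw [hX', hX, mul_inv_rev, block_mul, block_mul]; simp only [mul_assoc]
  · rw [hY', hY, mul_inv_rev, block_mul, block_mul]; simp only [mul_assoc]
  · rw [hv', hv, Matrix.mulVec_mulVec, block_mul]
  · rw [hw', hw, Matrix.vecMul_vecMul, mul_inv_rev, block_mul]

/-- The relation `Y X - X Y - ∑ v_i w_i = ∑ λ_i e_i`. -/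
def Moment (P : Param m) (p : Coord α → ℂ) : Prop :=
  Ymat p * Xmat p - Xmat p * Ymat p - ∑ i : ZMod m, Matrix.vecMulVec (vPart p i) (wPart p i) =
    Matrix.diagonal fun r => P.lam r.1

variable (α) in
/-- The representations satisfying the relation. -/
def Fibre (P : Param m) : Type := {p : Coord α → ℂ // Moment P p}

variable (α) in
/-- Equivalence under the action of `GL(α)`. -/
def fibreSetoid (P : Param m) : Setoid (Fibre α P) where
  r p q := SameOrbit p.1 q.1
  iseqv := ⟨fun p => SameOrbit.refl p.1, SameOrbit.symm, SameOrbit.trans⟩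

variable (α) in
/-- The Calogero–Moser space `𝒞_{α,λ}`: the set of `GL(α)`-orbits. -/
def CMSpace (P : Param m) : Type := Quotient (fibreSetoid α P)

/-- The point of the Calogero–Moser space represented by `p`. -/
def Fibre.toCM {P : Param m} (p : Fibre α P) : CMSpace α P := Quotient.mk (fibreSetoid α P) p

/-! ### Poisson structure and Hamiltonian flows -/

open MvPolynomial in
/-- The Poisson bracket on polynomial functions on the space of representations, with
`{(X_i)_{ab}, (Y_i)_{ba}} = 1`, `{(v_i)_a, (w_i)_a} = 1` and all other brackets of coordinates zero. -/
def poisson (F G : MvPolynomial (Coord α) ℂ) : MvPolynomial (Coord α) ℂ :=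
  (∑ a : Idx α, ∑ b : Idx α, if h : a.1 = b.1 + 1 then
      pderiv (.X a b h) F * pderiv (.Y b a h) G - pderiv (.Y b a h) F * pderiv (.X a b h) G
    else 0) +
  ∑ a : Idx α, (pderiv (.v a) F * pderiv (.w a) G - pderiv (.w a) F * pderiv (.v a) G)

variable (α) in
/-- The Hamiltonian `H_k = -w Y ^ k v` as a polynomial in the coordinates. -/
def Ham (k : ℕ) : MvPolynomial (Coord α) ℂ :=
  -(wTot (MvPolynomial.X (R := ℂ) (σ := Coord α)) ⬝ᵥ
    ((Ymat (MvPolynomial.X (R := ℂ) (σ := Coord α)) ^ k).mulVec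
      (vTot (MvPolynomial.X (R := ℂ) (σ := Coord α)))))

/-- `GL(α)`-invariance of a polynomial function. -/
def Invariant (F : MvPolynomial (Coord α) ℂ) : Prop :=
  ∀ p q : Coord α → ℂ, SameOrbit p q → MvPolynomial.eval p F = MvPolynomial.eval q F

/-- The function on the Calogero–Moser space given by an invariant polynomial. -/
def CMSpace.value {P : Param m} (F : MvPolynomial (Coord α) ℂ) (hF : Invariant F) :
    CMSpace α P → ℂ :=
  Quotient.lift (fun p : Fibre α P => MvPolynomial.eval p.1 F) fun p q h => hF p.1 q.1 h

/-- The curve `γ` on the Calogero–Moser space is, at time `t`, an integral curve of the Hamiltonian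
vector field of `H` for the reduced Poisson structure: `d/dt F(γ(t)) = {F, H}(γ(t))` for every regular
function `F`. -/
def CMSpace.IsFlowAt {P : Param m} (H : MvPolynomial (Coord α) ℂ) (γ : ℂ → CMSpace α P) (t : ℂ) :
    Prop :=
  ∀ (F : MvPolynomial (Coord α) ℂ) (hF : Invariant F) (p : Fibre α P), p.toCM = γ t →
    HasDerivAt (fun z => CMSpace.value F hF (γ z)) (MvPolynomial.eval p.1 (poisson F H)) t

/-! ### The elements `M` and `L` -/

/-- `(X - x)⁻¹` as a matrix over `𝒫`. -/
def Xhat (P : Param m) (p : Coord α → ℂ) : Matrix (Idx α) (Idx α) P.Psd :=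
  ((Xmat p).map RatFunc.C - Matrix.scalar (Idx α) (RatFunc.X (K := ℂ)))⁻¹.map
    fun f => P.ι (ofRat m f)

/-- `(Y - y)⁻¹ = -∑_{k ≥ 0} Y ^ k y ^ (-k-1)` as a matrix over `𝒫`. -/
def Yhat (P : Param m) (p : Coord α → ℂ) : Matrix (Idx α) (Idx α) P.Psd := fun r c =>
  { coeff := fun n => if n < 0 then
      -ofRat m (RatFunc.C ((Ymat p ^ (-n - 1).toNat) r c)) else 0
    bdd := ⟨0, fun n hn => if_neg (by omega)⟩ }

/-- A complex number as an element of `𝒫`. -/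
def const (P : Param m) (z : ℂ) : P.Psd := P.ι (ofRat m (RatFunc.C z))

/-- `∑ ε_i w_i T v_j ε_j` for a matrix `T` over `𝒫`. -/
def sandwich (P : Param m) (p : Coord α → ℂ) (T : Matrix (Idx α) (Idx α) P.Psd) : P.Psd :=
  ∑ i : ZMod m, ∑ j : ZMod m, P.ι (P.ε i) *
    ((fun r => const P (wPart p i r)) ⬝ᵥ T.mulVec fun r => const P (vPart p j r)) * P.ι (P.ε j)

/-- `M = 1 - ∑ ε_i w_i (X - x)⁻¹ (Y - y)⁻¹ v_j ε_j`. -/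
def Mop (P : Param m) (p : Coord α → ℂ) : P.Psd := 1 - sandwich P p (Xhat P p * Yhat P p)

/-- `1 + ∑ ε_i w_i (Y - y)⁻¹ (X - x)⁻¹ v_j ε_j`. -/
def MopInv (P : Param m) (p : Coord α → ℂ) : P.Psd := 1 + sandwich P p (Yhat P p * Xhat P p)

/-- `L = M y M⁻¹`. -/
def Lop (P : Param m) (p : Coord α → ℂ) : P.Psd := Mop P p * P.yPow 1 * MopInv P p

end Quiver

/-! ### Derivatives of curves in `ℂ(x)` and in `𝒫` -/

/-- `f'` is the derivative at `t` of the curve `f` in `ℂ(x)`: near `t` one has `f = p / q`, where `p` and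
`q` are curves of polynomials of bounded degree with coefficients differentiable at `t` and `q(t) ≠ 0`,
and `f'` is given by the quotient rule. -/
def RatHasDerivAt (f : ℂ → RatFunc ℂ) (f' : RatFunc ℂ) (t : ℂ) : Prop :=
  ∃ (d : ℕ) (p q : ℂ → ℂ[X]) (p' q' : ℂ[X]),
    (∀ z, (p z).natDegree ≤ d ∧ (q z).natDegree ≤ d) ∧
    (∀ n, HasDerivAt (fun z => (p z).coeff n) (p'.coeff n) t) ∧
    (∀ n, HasDerivAt (fun z => (q z).coeff n) (q'.coeff n) t) ∧
    q t ≠ 0 ∧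
    (∀ᶠ z in nhds t, f z = algebraMap ℂ[X] (RatFunc ℂ) (p z) / algebraMap ℂ[X] (RatFunc ℂ) (q z)) ∧
    f' = algebraMap ℂ[X] (RatFunc ℂ) (p' * q t - p t * q') / algebraMap ℂ[X] (RatFunc ℂ) (q t ^ 2)

/-- Coefficientwise derivative of a curve in `𝒫`. -/
def PsdHasDerivAt {m : ℕ} [NeZero m] {P : Param m} (u : ℂ → P.Psd) (u' : P.Psd) (t : ℂ) : Prop :=
  ∀ (n : ℤ) (g : Gam m), RatHasDerivAt (fun z => ((u z).coeff n).coeff g) ((u'.coeff n).coeff g) t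

/-- The right-hand side `[(L ^ k)_+, L]` of the `k`-th equation of the hierarchy. -/
def kpField {m : ℕ} [NeZero m] {P : Param m} (k : ℕ) (L : P.Psd) : P.Psd :=
  (L ^ k).pos * L - L * (L ^ k).pos

end CMKP

end

/-!
The inversion formula is a statement about two invertible matrices over `𝒫`, `A = X - x` and
`B = Y - y`. The moment relation and the relation `x y - y x = ∑ λ_i ε_i` (`Param.y_mul_x_sub`)
combine so that the scalar parts of `[B, A]` cancel on the range of the idempotent matrix
`E = ∑ e_i ⊗ ε_i`, leaving the rank one matrix `V W` with `V = ∑ v_i ε_i`, `W = ∑ ε_i w_i`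
(`commutator_mul_idemMat`). The sums over `i` and `j` in the definition of `M` amount to
`M = 1 - W A⁻¹ B⁻¹ V`, and `A⁻¹ B⁻¹ [B, A] B⁻¹ A⁻¹ = B⁻¹ A⁻¹ - A⁻¹ B⁻¹` gives
`M⁻¹ = 1 + W B⁻¹ A⁻¹ V` (`Dressing.mul_inv`, `Dressing.inv_mul`).

The vector field of `H_k` fixes `Y` and moves `v`, `w` and `X` by `-Y ^ k v`, `w Y ^ k` and the
projection to `⨁ Hom(V_i, V_{i+1})` of `-∑ Y ^ i v w Y ^ (k-1-i)`. In particular `H_j`, which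
involves only `v`, `w` and `Y`, is constant along it. If `M'` denotes the corresponding variation of
`M`, then `(M' + M y ^ k) M⁻¹` contains no negative powers of `y` (`nonnegMat_dressed`), because
`(Y ^ k - y ^ k) (Y - y)⁻¹` is a polynomial in `Y` and `y`. As `M' M⁻¹` lies in `𝒫_-` and
`M y ^ k M⁻¹ = L ^ k`, it follows that `M' M⁻¹ = (L ^ k)_+ - L ^ k` (`Mdot_mul_MopInv`), and
conjugating `y` turns this into the equation of the hierarchy.

For a curve in the quotient there need not be a differentiable lift, so that derivatives have to be
taken of invariant functions. The coefficients of `M` are assembled from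
`w_i (X - x)⁻¹ Y ^ n v_j`, quotients of two polynomials in `x` whose coefficients are invariant
polynomials (`genNum_invariant`, `genDen_invariant`); this makes `M` differentiable along an
integral curve (`Mop_hasDerivAt`), and the recursion for the coefficients of `M⁻¹` carries
differentiability over to `M⁻¹` and `L` (`PsdHasDerivAt.inv`).

The flows are explicit. Let `𝒴` be the endomorphism of `V ⊕ V` with diagonal blocks `Y` and upper
right block `v w`. Then `exp (∑ t_k 𝒴 ^ k)` has equal diagonal blocks `A` and an upper right block
`B`, and the flow sends `v`, `w`, `X` to `A⁻¹ v`, `w A` and `X` minus the projection of `A⁻¹ B`.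
Since running it conjugates `𝒴` by `A`, the flow law is the multiplicativity of the exponential
(`flowRep_add`), and the moment relation is preserved because `exp (∑ t_k 𝒴 ^ k)` commutes with `𝒴`
(`moment_flowRep`).
-/

set_option linter.unusedSectionVars false

noncomputable section
namespace CMKP
open Polynomial Filter Topology

/-! ### Series in `y` -/

namespace PDO
variable {A : Type*} [Ring A] {S : SkewDer A}

@[simp] lemma sub_coeff (u v : PDO S) (n : ℤ) : (u - v).coeff n = u.coeff n - v.coeff n := by
  rw [sub_eq_add_neg, add_coeff, neg_coeff, sub_eq_add_neg]

/-- Taking the coefficient at `y ^ n`, as an additive map. -/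
def coeffHom (S : SkewDer A) (n : ℤ) : PDO S →+ A where
  toFun u := u.coeff n
  map_zero' := rfl
  map_add' _ _ := rfl

lemma sum_coeff {ι : Type*} (s : Finset ι) (f : ι → PDO S) (n : ℤ) :
    (∑ i ∈ s, f i).coeff n = ∑ i ∈ s, (f i).coeff n :=
  map_sum (coeffHom S n) f s

lemma monomial_coeff (k n : ℤ) (a : A) :
    (monomial S k a).coeff n = if n = k then a else 0 := rfl

lemma mul_coeff_eq_finsum (u v : PDO S) (n : ℤ) :
    (u * v).coeff n = ∑ᶠ i : ℤ, u.coeff i * E v i n := rfl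

/-- Left multiplication by `a y ^ k` only involves one row of the matrix of the right factor. -/
lemma monomial_mul_coeff (k n : ℤ) (a : A) (u : PDO S) :
    (monomial S k a * u).coeff n = a * E u k n := by
  rw [mul_coeff_eq_finsum, finsum_eq_single _ k fun i hi => by
    rw [monomial_coeff, if_neg hi, zero_mul], monomial_coeff, if_pos rfl]

lemma E_succ (u : PDO S) (i n : ℤ) : E u (i + 1) n = S.σ (E u i (n - 1)) + S.δ (E u i n) :=
  (E_good u).2 i n

/-- A coefficient fixed by `σ` and killed by `δ` commutes with every power of `y`. -/
lemma E_monomial {a : A} (hσ : S.σ a = a) (hδ : S.δ a = 0) (k i n : ℤ) :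
    E (monomial S k a) i n = if n = i + k then a else 0 := by
  refine (E_good _).ext (T' := fun i n => if n = i + k then a else 0)
    ⟨⟨k, fun i n hi => if_neg (by omega)⟩, fun i n => ?_⟩ (fun n => ?_) i n
  · have : (n - 1 = i + k) ↔ (n = i + 1 + k) := by omega
    simp only [this, apply_ite S.σ, apply_ite S.δ, map_zero, hσ, hδ, ite_self, add_zero]
  · simp [E_zero, monomial_coeff]

lemma mul_monomial_coeff {a : A} (hσ : S.σ a = a) (hδ : S.δ a = 0) (k n : ℤ) (u : PDO S) :
    (u * monomial S k a).coeff n = u.coeff (n - k) * a := by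
  rw [mul_coeff_eq_finsum, finsum_eq_single _ (n - k) fun i hi => by
    rw [E_monomial hσ hδ, if_neg (by omega), mul_zero], E_monomial hσ hδ, if_pos (by omega)]

lemma delta_one (S : SkewDer A) : S.δ 1 = 0 := by simpa using S.leibniz 1 1

lemma mul_yPow_coeff (k n : ℤ) (u : PDO S) :
    (u * monomial S k 1).coeff n = u.coeff (n - k) := by
  rw [mul_monomial_coeff (map_one _) (delta_one S), mul_one]

lemma y_mul_coeff (n : ℤ) (u : PDO S) :
    (monomial S 1 1 * u).coeff n = S.σ (u.coeff (n - 1)) + S.δ (u.coeff n) := by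
  have := E_succ u 0 n
  rw [zero_add, E_zero, E_zero] at this
  rw [monomial_mul_coeff, one_mul, this]

lemma monomial_zero_mul_coeff (n : ℤ) (a : A) (u : PDO S) :
    (monomial S 0 a * u).coeff n = a * u.coeff n := by
  rw [monomial_mul_coeff, E_zero]

/-- The embedding of the coefficient ring as the series concentrated in degree `0`. -/
def constHom (S : SkewDer A) : A →+* PDO S where
  toFun := monomial S 0
  map_one' := rfl
  map_zero' := PDO.ext (funext fun n => by simp [monomial_coeff])
  map_add' a b := PDO.ext (funext fun n => by
    simp only [monomial_coeff, add_coeff]; split_ifs <;> simp)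
  map_mul' a b := PDO.ext (funext fun n => by
    rw [monomial_zero_mul_coeff, monomial_coeff, monomial_coeff, mul_ite, mul_zero])

/-- The series with no powers of `y` above `y ^ N`. -/
def DegLE (N : ℤ) (u : PDO S) : Prop := ∀ n, N < n → u.coeff n = 0

/-- The series with no negative powers of `y`. -/
def Nonneg (u : PDO S) : Prop := ∀ n, n < 0 → u.coeff n = 0

lemma DegLE.mono {N N' : ℤ} {u : PDO S} (h : DegLE N u) (hN : N ≤ N') : DegLE N' u :=
  fun n hn => h n (by omega)

lemma DegLE.E {N : ℤ} {u : PDO S} (h : DegLE N u) (i n : ℤ) (hi : i + N < n) : E u i n = 0 := by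
  rw [E_eq_sum u h i n 0 (by push_cast; omega)]; simp

lemma DegLE.mul {N N' : ℤ} {u v : PDO S} (h : DegLE N u) (h' : DegLE N' v) :
    DegLE (N + N') (u * v) := fun n hn => by
  rw [mul_coeff]; exact mm_bdd h.E h'.E 0 n (by omega)

lemma DegLE.add {N : ℤ} {u v : PDO S} (h : DegLE N u) (h' : DegLE N v) : DegLE N (u + v) :=
  fun n hn => by rw [add_coeff, h n hn, h' n hn, add_zero]

lemma DegLE.neg {N : ℤ} {u : PDO S} (h : DegLE N u) : DegLE N (-u) :=
  fun n hn => by rw [neg_coeff, h n hn, neg_zero]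

lemma DegLE.sub {N : ℤ} {u v : PDO S} (h : DegLE N u) (h' : DegLE N v) : DegLE N (u - v) := by
  rw [sub_eq_add_neg]; exact h.add h'.neg

lemma DegLE.sum {ι : Type*} {N : ℤ} {s : Finset ι} {f : ι → PDO S} (h : ∀ i ∈ s, DegLE N (f i)) :
    DegLE N (∑ i ∈ s, f i) := fun n hn => by
  rw [sum_coeff]; exact Finset.sum_eq_zero fun i hi => h i hi n hn

lemma degLE_monomial (k : ℤ) (a : A) : DegLE k (monomial S k a) :=
  fun n hn => if_neg (by omega)

lemma Nonneg.E {u : PDO S} (h : Nonneg u) (i : ℕ) (n : ℤ) (hn : n < 0) : E u i n = 0 := by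
  induction i generalizing n with
  | zero => rw [Nat.cast_zero, E_zero, h n hn]
  | succ i ih => rw [Nat.cast_succ, E_succ, ih _ (by omega), ih _ hn, map_zero, map_zero, add_zero]

lemma Nonneg.mul {u v : PDO S} (h : Nonneg u) (h' : Nonneg v) : Nonneg (u * v) := fun n hn => by
  rw [mul_coeff_eq_finsum]
  refine finsum_eq_zero_of_forall_eq_zero fun i => ?_
  rcases lt_or_ge i 0 with hi | hi
  · rw [h i hi, zero_mul]
  · lift i to ℕ using hi
    rw [h'.E i n hn, mul_zero]

lemma Nonneg.add {u v : PDO S} (h : Nonneg u) (h' : Nonneg v) : Nonneg (u + v) :=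
  fun n hn => by rw [add_coeff, h n hn, h' n hn, add_zero]

lemma Nonneg.neg {u : PDO S} (h : Nonneg u) : Nonneg (-u) :=
  fun n hn => by rw [neg_coeff, h n hn, neg_zero]

lemma Nonneg.sum {ι : Type*} {s : Finset ι} {f : ι → PDO S} (h : ∀ i ∈ s, Nonneg (f i)) :
    Nonneg (∑ i ∈ s, f i) := fun n hn => by
  rw [sum_coeff]; exact Finset.sum_eq_zero fun i hi => h i hi n hn

lemma nonneg_monomial {k : ℤ} (hk : 0 ≤ k) (a : A) : Nonneg (monomial S k a) :=
  fun n hn => if_neg (by omega)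

/-- The positive part is the only series without negative powers that differs from the given one
by a series with only negative powers. -/
lemma pos_eq_of_nonneg {u v : PDO S} (hv : Nonneg v) (h : DegLE (-1) (v - u)) : u.pos = v :=
  PDO.ext (funext fun n => by
    change (if 0 ≤ n then u.coeff n else 0) = _
    split_ifs with hn
    · have := h n (by omega)
      rw [sub_coeff, sub_eq_zero] at this
      exact this.symm
    · exact (hv n (by omega)).symm)

end PDO

/-! ### The idempotents `ε_i` and the relations between them, `x` and `y` -/

lemma dRat_C (z : ℂ) : dRat (RatFunc.C z) = 0 := by
  have := dRat_div (C z) 1 one_ne_zero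
  simpa using this

lemma dRat_X : dRat RatFunc.X = 1 := by
  have := dRat_div X 1 one_ne_zero
  simpa using this

/-- Rational functions as a subring of the crossed product. -/
def ratHom (m : ℕ) : RatFunc ℂ →+* Cross m where
  toFun := ofRat m
  map_one' := rfl
  map_zero' := SkewMonoidAlgebra.single_zero _
  map_add' a b := SkewMonoidAlgebra.single_add _ a b
  map_mul' a b := by
    rw [ofRat, ofRat, ofRat, SkewMonoidAlgebra.single_mul_single, one_mul, one_smul]

lemma ratHom_apply (m : ℕ) (f : RatFunc ℂ) : ratHom m f = ofRat m f := rfl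

lemma sum_zmod_val {M : Type*} [AddCommMonoid M] {m : ℕ} [NeZero m] (f : ℕ → M) :
    ∑ i : ZMod m, f i.val = ∑ i ∈ Finset.range m, f i := by
  obtain ⟨n, rfl⟩ := Nat.exists_eq_succ_of_ne_zero (NeZero.ne m)
  exact Fin.sum_univ_eq_sum_range f (n + 1)

namespace Param
variable {m : ℕ} [NeZero m] (P : Param m)

/-- The character `i ↦ μ ^ i` of `ℤ / m`. -/
def χ (i : ZMod m) : ℂ := P.μ ^ i.val

lemma μ_ne_zero : P.μ ≠ 0 := P.prim.ne_zero (NeZero.ne m)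

lemma χ_ne_zero (i : ZMod m) : P.χ i ≠ 0 := pow_ne_zero _ P.μ_ne_zero

lemma μ_pow_mod (r : ℕ) : P.μ ^ (r % m) = P.μ ^ r := by
  have := pow_mod_orderOf P.μ r
  rwa [← P.prim.eq_orderOf] at this

lemma χ_add (i j : ZMod m) : P.χ (i + j) = P.χ i * P.χ j := by
  rw [χ, χ, χ, ZMod.val_add, ← pow_add]
  exact P.μ_pow_mod _

lemma χ_natCast (r : ℕ) : P.χ (r : ZMod m) = P.μ ^ r := by
  rw [χ, ZMod.val_natCast]
  exact P.μ_pow_mod _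

lemma χ_one : P.χ 1 = P.μ := by simpa using P.χ_natCast 1

lemma χ_pow_card (i : ZMod m) : P.χ i ^ m = 1 := by
  rw [χ, ← pow_mul, mul_comm, pow_mul, P.prim.pow_eq_one, one_pow]

lemma χ_injective : Function.Injective P.χ := fun i j h =>
  ZMod.val_injective m (P.prim.pow_inj (ZMod.val_lt i) (ZMod.val_lt j) h)

lemma s_val : ((P.s).val : ℂ) = P.μ := rfl

lemma s_pow_card : P.s ^ m = 1 := by
  refine (Subgroup.subtype_injective (rootsOfUnity m ℂ)) (Units.ext ?_)
  have : ((Gam.val (P.s ^ m) : ℂˣ) : ℂ) = ((Gam.val (1 : Gam m) : ℂˣ) : ℂ) := by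
    rw [map_pow, Units.val_pow_eq_pow_val, s_val, P.prim.pow_eq_one, map_one, Units.val_one]
  exact this

/-- The generator `s` as an element of the crossed product. -/
def sCross : Cross m := SkewMonoidAlgebra.single P.s 1

lemma sCross_pow (r : ℕ) : P.sCross ^ r = SkewMonoidAlgebra.single (P.s ^ r) 1 := by
  induction r with
  | zero => rfl
  | succ r ih =>
    rw [pow_succ, ih, sCross, SkewMonoidAlgebra.single_mul_single, ← pow_succ, smul_one, one_mul]

lemma ε_eq (i : ZMod m) :
    P.ε i = ∑ r ∈ Finset.range m, ofRat m (RatFunc.C ((1 / m) * (P.χ i)⁻¹ ^ r)) * P.sCross ^ r := by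
  refine Finset.sum_congr rfl fun r _ => ?_
  rw [sCross_pow, ofRat_mul_single, mul_one, χ, pow_mul, inv_pow]

lemma sCross_mul_ε (i : ZMod m) : P.sCross * P.ε i = ofRat m (RatFunc.C (P.χ i)) * P.ε i := by
  set f : ℕ → Cross m := fun r =>
    ofRat m (RatFunc.C ((1 / m) * P.χ i * (P.χ i)⁻¹ ^ r)) * P.sCross ^ r with hf
  -- multiplication by `s` shifts the summands of `ε_i` cyclically
  have h0 : f m = f 0 := by
    simp only [hf]
    rw [inv_pow, P.χ_pow_card, sCross_pow, s_pow_card, SkewMonoidAlgebra.single_one_one]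
    simp
  have e1 : P.sCross * P.ε i = ∑ r ∈ Finset.range m, f (r + 1) := by
    rw [ε_eq, Finset.mul_sum]
    refine Finset.sum_congr rfl fun r _ => ?_
    rw [← mul_assoc, ← ofRat_C_comm, mul_assoc, ← pow_succ', hf]
    congr 3
    rw [pow_succ]
    field_simp [P.χ_ne_zero i]
  have e2 : ofRat m (RatFunc.C (P.χ i)) * P.ε i = ∑ r ∈ Finset.range m, f r := by
    rw [ε_eq, Finset.mul_sum]
    refine Finset.sum_congr rfl fun r _ => ?_
    rw [← mul_assoc, ← ratHom_apply, ← ratHom_apply, ← map_mul, ← map_mul, hf, ratHom_apply]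
    congr 3
    ring
  have := Finset.sum_range_succ' f m
  rw [Finset.sum_range_succ, h0] at this
  rw [e1, e2, add_right_cancel this]

lemma sCross_pow_mul_ε (i : ZMod m) (r : ℕ) :
    P.sCross ^ r * P.ε i = ofRat m (RatFunc.C (P.χ i ^ r)) * P.ε i := by
  induction r with
  | zero => rw [pow_zero, pow_zero, map_one]; rfl
  | succ r ih =>
    rw [pow_succ, mul_assoc, sCross_mul_ε, ← mul_assoc, ← ofRat_C_comm, mul_assoc, ih, ← mul_assoc,
      ← ratHom_apply, ← ratHom_apply, ← map_mul, ← map_mul, pow_succ', ratHom_apply]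

lemma sum_pow_χ {i : ZMod m} (hi : i ≠ 0) : ∑ r ∈ Finset.range m, P.χ i ^ r = 0 := by
  have h : P.χ i ≠ 1 := fun h => hi (P.χ_injective (by simpa [χ] using h))
  rw [geom_sum_eq h, P.χ_pow_card, sub_self, zero_div]

lemma ε_mul_ε (i j : ZMod m) : P.ε i * P.ε j = if i = j then P.ε j else 0 := by
  have hm : (m : ℂ) ≠ 0 := Nat.cast_ne_zero.2 (NeZero.ne m)
  have e : P.ε i * P.ε j =
      ofRat m (RatFunc.C ((1 / m) * ∑ r ∈ Finset.range m, P.χ (j - i) ^ r)) * P.ε j := by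
    conv_lhs => rw [ε_eq P i]
    rw [Finset.sum_mul, Finset.mul_sum, map_sum, ← ratHom_apply, map_sum, Finset.sum_mul]
    refine Finset.sum_congr rfl fun r _ => ?_
    rw [mul_assoc, sCross_pow_mul_ε, ← mul_assoc, ← ratHom_apply, ← ratHom_apply, ← map_mul,
      ← map_mul]
    congr 3
    have h := P.χ_add (j - i) i
    rw [sub_add_cancel] at h
    rw [h, mul_pow, inv_pow]
    have := P.χ_ne_zero i
    field_simp
  rw [e]
  split_ifs with h
  · subst h
    have : P.χ 0 = 1 := by simp [χ]
    rw [sub_self, this]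
    simp only [one_pow, Finset.sum_const, Finset.card_range, nsmul_eq_mul, mul_one]
    rw [one_div, inv_mul_cancel₀ hm, map_one]
    exact one_mul _
  · rw [P.sum_pow_χ (sub_ne_zero.2 (Ne.symm h)), mul_zero, map_zero, ← ratHom_apply, map_zero,
      zero_mul]

lemma sum_ε : ∑ i : ZMod m, P.ε i = 1 := by
  have hm : (m : ℂ) ≠ 0 := Nat.cast_ne_zero.2 (NeZero.ne m)
  simp only [ε_eq]
  rw [Finset.sum_comm]
  simp only [← Finset.sum_mul, ← ratHom_apply, ← map_sum, ← Finset.mul_sum]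
  rw [Finset.sum_eq_single 0]
  · simp [hm]
  · intro r hr hr0
    have : ∑ i : ZMod m, (P.χ i)⁻¹ ^ r = 0 := by
      have e : ∀ i : ZMod m, (P.χ i)⁻¹ ^ r = ((P.χ (-(r : ZMod m))) ^ i.val) := fun i => by
        have h := P.χ_add (-(r : ZMod m)) r
        rw [neg_add_cancel, χ_natCast, show P.χ 0 = 1 by simp [χ]] at h
        rw [eq_inv_of_mul_eq_one_left h.symm, χ, inv_pow, inv_pow, ← pow_mul, ← pow_mul, mul_comm]
      simp only [e]
      rw [sum_zmod_val fun i => (P.χ (-(r : ZMod m))) ^ i, P.sum_pow_χ]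
      rw [neg_ne_zero, Ne, ZMod.natCast_eq_zero_iff]
      exact Nat.not_dvd_of_pos_of_lt (Nat.pos_of_ne_zero hr0) (Finset.mem_range.1 hr)
    rw [this, mul_zero, map_zero, map_zero, zero_mul]
  · intro h; exact absurd (Finset.mem_range.2 (NeZero.pos m)) h

lemma thetaInv_ε (i : ZMod m) : thetaInv m (P.ε i) = P.ε (i + 1) := by
  simp only [ε, map_sum]
  refine Finset.sum_congr rfl fun r _ => ?_
  rw [thetaInv_single, ← map_mul]
  congr 2
  rw [pow_mul, pow_mul, inv_pow, inv_pow P.μ, ← χ, ← χ, χ_add, χ_one, map_pow,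
    ← inv_pow (Gam.val P.s), Units.val_pow_eq_pow_val, Units.val_inv_eq_inv_val, s_val, mul_inv,
    mul_pow]
  ring

lemma ε_mul_X (i : ZMod m) :
    P.ε i * ofRat m RatFunc.X = ofRat m RatFunc.X * P.ε (i + 1) := by
  simp only [ε, Finset.sum_mul, Finset.mul_sum]
  refine Finset.sum_congr rfl fun r _ => ?_
  rw [ofRat_mul_single, ofRat, SkewMonoidAlgebra.single_mul_single, mul_one, Gam.smul_def, dilate_X,
    ← mul_assoc, ← map_mul, mul_comm]
  congr 3
  rw [pow_mul, pow_mul, inv_pow, inv_pow P.μ, ← χ, ← χ, χ_add, χ_one, map_pow,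
    ← inv_pow (Gam.val P.s), Units.val_pow_eq_pow_val, Units.val_inv_eq_inv_val, s_val, mul_inv,
    mul_pow]
  ring

lemma dCross_ε (i : ZMod m) : dCross m (P.ε i) = 0 := by
  simp only [ε, map_sum]
  refine Finset.sum_eq_zero fun r _ => ?_
  rw [dCross_single, dRat_C, SkewMonoidAlgebra.single_zero]

lemma kSum_mul_ε (i : ZMod m) : P.kSum * P.ε i = ofRat m (RatFunc.C (m * P.k i)) * P.ε i := by
  simp only [kSum, Finset.sum_mul, mul_assoc, ε_mul_ε]
  simp

lemma ε_mul_kSum (i : ZMod m) : P.ε i * P.kSum = ofRat m (RatFunc.C (m * P.k i)) * P.ε i := by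
  simp only [kSum, Finset.mul_sum, ← mul_assoc, ← ofRat_C_comm]
  simp only [mul_assoc, ε_mul_ε]
  simp

lemma D_ε (i : ZMod m) : P.D (P.ε i) = 0 := by
  rw [D_apply, dCross_ε, kSum_mul_ε, ε_mul_kSum, sub_self, mul_zero, mul_zero, sub_zero]

lemma D_C (z : ℂ) : P.D (ofRat m (RatFunc.C z)) = 0 := by
  rw [D_apply, ofRat_C_comm z P.kSum, sub_self]
  simp [ofRat, dCross_single, dRat_C]

lemma thetaInv_ofRat (f : RatFunc ℂ) : thetaInv m (ofRat m f) = ofRat m f := by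
  rw [ofRat, thetaInv_single]; simp

lemma X_mul_invX : ofRat m (RatFunc.X)⁻¹ * ofRat m RatFunc.X = 1 := by
  rw [← ratHom_apply, ← ratHom_apply, ← map_mul, inv_mul_cancel₀ RatFunc.X_ne_zero, map_one]

lemma D_X : P.D (ofRat m RatFunc.X) = -∑ i : ZMod m, ofRat m (RatFunc.C (P.lam i)) * P.ε i := by
  have e1 : dCross m (ofRat m RatFunc.X) = 1 := by
    rw [ofRat, dCross_single, dRat_X]; rfl
  have e2 : P.kSum * ofRat m RatFunc.X = ofRat m RatFunc.X *
      ∑ i : ZMod m, ofRat m (RatFunc.C (m * P.k (i - 1))) * P.ε i := by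
    rw [kSum, Finset.sum_mul, Finset.mul_sum]
    refine Eq.trans ?_ (Equiv.sum_comp (Equiv.addRight (1 : ZMod m)) _)
    refine Finset.sum_congr rfl fun i _ => ?_
    rw [Equiv.coe_addRight]
    beta_reduce
    rw [add_sub_cancel_right, mul_assoc, ε_mul_X, ← mul_assoc, ← mul_assoc, ofRat_C_comm]
  rw [D_apply, e1, e2, mul_one, ← mul_sub, ← mul_assoc, X_mul_invX, one_mul, kSum,
    ← Finset.sum_sub_distrib]
  have e3 : ofRat m (RatFunc.C P.τ) = ∑ i : ZMod m, ofRat m (RatFunc.C P.τ) * P.ε i := by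
    rw [← Finset.mul_sum, sum_ε, mul_one]
  rw [e3, ← Finset.sum_sub_distrib, ← Finset.sum_neg_distrib]
  refine Finset.sum_congr rfl fun i _ => ?_
  rw [← sub_mul, ← sub_mul, eq_neg_iff_add_eq_zero, ← add_mul]
  simp only [← ratHom_apply, ← map_sub, ← map_add]
  rw [lam, show P.τ - (m * P.k (i - 1) - m * P.k i) + (m * (P.k (i - 1) - P.k i) - P.τ) = 0 by ring,
    map_zero, map_zero, zero_mul]

/-- Rational functions as elements of `𝒫`. -/
def ratι : RatFunc ℂ →+* P.Psd := (PDO.constHom P.skew).comp (ratHom m)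

lemma ratι_C (z : ℂ) : P.ratι (RatFunc.C z) = const P z := rfl

/-- The idempotents `ε_i` as elements of `𝒫`. -/
def idem (i : ZMod m) : P.Psd := P.ι (P.ε i)

/-- The Dunkl operator `y`. -/
def y : P.Psd := P.yPow 1

/-- The variable `x` as an element of `𝒫`. -/
def x : P.Psd := P.ratι RatFunc.X

lemma const_commute (z : ℂ) (u : P.Psd) : Commute (const P z) u := by
  refine PDO.ext (funext fun n => ?_)
  rw [const, ι, PDO.monomial_zero_mul_coeff,
    PDO.mul_monomial_coeff (thetaInv_ofRat _) (P.D_C z), sub_zero, ofRat_C_comm]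

lemma idem_mul_idem (i j : ZMod m) : P.idem i * P.idem j = if i = j then P.idem j else 0 := by
  have := map_mul (PDO.constHom P.skew) (P.ε i) (P.ε j)
  rw [ε_mul_ε, apply_ite (PDO.constHom P.skew), map_zero] at this
  exact this.symm

lemma y_mul_ι (f : Cross m) : P.y * P.ι f = P.ι (thetaInv m f) * P.y + P.ι (P.D f) := by
  refine PDO.ext (funext fun n => ?_)
  rw [PDO.add_coeff, y, yPow, PDO.y_mul_coeff, PDO.mul_yPow_coeff]
  have h : P.skew.σ = thetaInv m := rfl
  have h' : P.skew.δ = P.D := rfl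
  rw [h, h', ι, ι, ι, PDO.monomial_coeff, PDO.monomial_coeff, PDO.monomial_coeff,
    PDO.monomial_coeff, apply_ite (thetaInv m), apply_ite P.D, map_zero, map_zero]

lemma y_mul_idem (i : ZMod m) : P.y * P.idem i = P.idem (i + 1) * P.y := by
  rw [idem, y_mul_ι, thetaInv_ε, D_ε, show P.ι 0 = 0 from map_zero (PDO.constHom P.skew), add_zero]
  rfl

lemma x_mul_idem (i : ZMod m) : P.x * P.idem (i + 1) = P.idem i * P.x := by
  have := map_mul (PDO.constHom P.skew) (P.ε i) (ofRat m RatFunc.X)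
  rw [ε_mul_X, map_mul] at this
  exact this

/-- The relation `x y - y x = ∑ λ_i ε_i` of the rational Cherednik algebra. -/
lemma y_mul_x_sub : P.y * P.x - P.x * P.y = -∑ i : ZMod m, const P (P.lam i) * P.idem i := by
  have h : P.x = P.ι (ofRat m RatFunc.X) := rfl
  rw [h, y_mul_ι, thetaInv_ofRat, add_sub_cancel_left, D_X]
  have := map_neg (PDO.constHom P.skew) (∑ i : ZMod m, ofRat m (RatFunc.C (P.lam i)) * P.ε i)
  rw [map_sum] at this
  simp only [map_mul] at this
  exact this

end Param

/-! ### Matrices over `𝒫` -/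

section DressingAlgebra
variable {R I : Type*} [Ring R] [Fintype I] [DecidableEq I]

/-- The data behind the formula for `M⁻¹`: two invertible matrices whose commutator has, on the
range of an idempotent commuting with the products of their inverses, the rank one form `V W`. -/
structure Dressing (A B A' B' E : Matrix I I R) (V : Matrix I Unit R) (W : Matrix Unit I R) :
    Prop where
  AA' : A * A' = 1
  A'A : A' * A = 1
  BB' : B * B' = 1
  B'B : B' * B = 1
  comm : (B * A - A * B) * E = V * W
  E_A'B' : E * (A' * B') = A' * B' * E
  E_B'A' : E * (B' * A') = B' * A' * E
  EV : E * V = V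

variable {A B A' B' E : Matrix I I R} {V : Matrix I Unit R} {W : Matrix Unit I R}

/-- The identity `A⁻¹B⁻¹V (1 + W B⁻¹A⁻¹V) = B⁻¹A⁻¹V`. It follows from
`A⁻¹B⁻¹ [B, A] B⁻¹A⁻¹ = B⁻¹A⁻¹ - A⁻¹B⁻¹`, where `[B, A]` may be replaced by `V W` next to `E`. -/
lemma Dressing.resolvent_mul (h : Dressing A B A' B' E V W) :
    A' * B' * V * (1 + W * (B' * A') * V) = B' * A' * V := by
  have e : A' * B' * (B * A - A * B) * (B' * A') = B' * A' - A' * B' := by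
    calc A' * B' * (B * A - A * B) * (B' * A')
        = A' * (B' * B) * A * B' * A' - A' * B' * A * (B * B') * A' := by noncomm_ring
      _ = (A' * A) * B' * A' - A' * B' * (A * A') := by
        rw [h.B'B, h.BB']; noncomm_ring
      _ = _ := by rw [h.A'A, h.AA']; noncomm_ring
  have e2 : A' * B' * V * (W * (B' * A') * V) = (B' * A' - A' * B') * V := by
    calc A' * B' * V * (W * (B' * A') * V) = A' * B' * ((V * W) * (B' * A')) * V := by
          simp only [Matrix.mul_assoc]
      _ = A' * B' * (B * A - A * B) * (E * (B' * A')) * V := by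
          rw [← h.comm]; simp only [Matrix.mul_assoc]
      _ = (A' * B' * (B * A - A * B) * (B' * A')) * (E * V) := by
          rw [h.E_B'A']; simp only [Matrix.mul_assoc]
      _ = _ := by rw [e, h.EV]
  rw [Matrix.mul_add, Matrix.mul_one, e2, Matrix.sub_mul]
  abel

lemma Dressing.mul_inv (h : Dressing A B A' B' E V W) :
    (1 - W * (A' * B') * V) * (1 + W * (B' * A') * V) = 1 := by
  have := congrArg (W * ·) h.resolvent_mul
  simp only [← Matrix.mul_assoc] at this ⊢
  rw [Matrix.sub_mul, this, Matrix.one_mul]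
  abel

lemma Dressing.inv_mul (h : Dressing A B A' B' E V W) :
    (1 + W * (B' * A') * V) * (1 - W * (A' * B') * V) = 1 := by
  have e : B' * A' * (B * A - A * B) * (A' * B') = B' * A' - A' * B' := by
    calc B' * A' * (B * A - A * B) * (A' * B')
        = B' * A' * B * (A * A') * B' - B' * (A' * A) * B * A' * B' := by noncomm_ring
      _ = B' * A' * (B * B') - (B' * B) * A' * B' := by
        rw [h.A'A, h.AA']; noncomm_ring
      _ = _ := by rw [h.B'B, h.BB']; noncomm_ring
  have e2 : B' * A' * V * (W * (A' * B') * V) = (B' * A' - A' * B') * V := by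
    calc B' * A' * V * (W * (A' * B') * V) = B' * A' * ((V * W) * (A' * B')) * V := by
          simp only [Matrix.mul_assoc]
      _ = B' * A' * (B * A - A * B) * (E * (A' * B')) * V := by
          rw [← h.comm]; simp only [Matrix.mul_assoc]
      _ = (B' * A' * (B * A - A * B) * (A' * B')) * (E * V) := by
          rw [h.E_A'B']; simp only [Matrix.mul_assoc]
      _ = _ := by rw [e, h.EV]
  have e3 : W * (B' * A') * V * (W * (A' * B') * V) = W * (B' * A') * V - W * (A' * B') * V := by
    have := congrArg (W * ·) e2
    simpa only [← Matrix.mul_assoc, Matrix.sub_mul, Matrix.mul_sub] using this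
  rw [Matrix.mul_sub, Matrix.mul_one, Matrix.add_mul, Matrix.one_mul, e3]
  abel

end DressingAlgebra

section Quiver
variable {m : ℕ} [NeZero m] {α : ZMod m → ℕ} (P : Param m)
variable {I J : Type*} [Fintype I] [Fintype J] [DecidableEq I] [DecidableEq J]

/-- Complex numbers as elements of `𝒫`. -/
def constι : ℂ →+* P.Psd := P.ratι.comp RatFunc.C

lemma constι_apply (z : ℂ) : constι P z = const P z := rfl

lemma constι_comm (z : ℂ) (u : P.Psd) : constι P z * u = u * constι P z := P.const_commute z u

/-- A complex matrix as a matrix over `𝒫`. -/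
def cMat (T : Matrix I J ℂ) : Matrix I J P.Psd := T.map (constι P)

/-- A scalar matrix over `𝒫`. -/
def scal (I : Type*) [DecidableEq I] (u : P.Psd) : Matrix I I P.Psd := Matrix.diagonal fun _ => u

lemma cMat_mul {K : Type*} (T : Matrix I J ℂ) (T' : Matrix J K ℂ) :
    cMat P (T * T') = cMat P T * cMat P T' := Matrix.map_mul

lemma cMat_pow (T : Matrix I I ℂ) (k : ℕ) : cMat P (T ^ k) = cMat P T ^ k :=
  map_pow (constι P).mapMatrix T k

lemma cMat_sub (T T' : Matrix I J ℂ) : cMat P (T - T') = cMat P T - cMat P T' := by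
  ext1 r c; exact map_sub (constι P) _ _

lemma cMat_neg (T : Matrix I J ℂ) : cMat P (-T) = -cMat P T := by
  ext1 r c; exact map_neg (constι P) _

lemma cMat_sum {κ : Type*} (s : Finset κ) (T : κ → Matrix I J ℂ) :
    cMat P (∑ i ∈ s, T i) = ∑ i ∈ s, cMat P (T i) := by
  ext r c
  simp only [cMat, Matrix.map_apply, Matrix.sum_apply, map_sum]

lemma cMat_mul_scal (T : Matrix I J ℂ) (u : P.Psd) :
    cMat P T * scal P J u = scal P I u * cMat P T := by
  ext1 r c
  rw [scal, scal, Matrix.mul_diagonal, Matrix.diagonal_mul]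
  exact P.const_commute _ _

lemma scal_pow (u : P.Psd) (k : ℕ) : scal P I u ^ k = scal P I (u ^ k) :=
  Matrix.diagonal_pow _ _

variable (α) in
/-- The diagonal matrix of idempotents `∑ e_i ⊗ ε_{i+a}`. -/
def idemMat (a : ZMod m) : Matrix (Idx α) (Idx α) P.Psd := Matrix.diagonal fun r => P.idem (r.1 + a)

lemma idemMat_mul_self (a : ZMod m) : idemMat α P a * idemMat α P a = idemMat α P a := by
  rw [idemMat, Matrix.diagonal_mul_diagonal]
  simp only [P.idem_mul_idem, if_true]

lemma Ymat_mul_idemMat (p : Coord α → ℂ) (a : ZMod m) :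
    cMat P (Ymat p) * idemMat α P a = idemMat α P (a + 1) * cMat P (Ymat p) := by
  ext1 r c
  rw [idemMat, idemMat, Matrix.mul_diagonal, Matrix.diagonal_mul, cMat, Matrix.map_apply, Ymat]
  split_ifs with h
  · rw [h, constι_comm, add_assoc, add_comm 1 a]
  · rw [map_zero, zero_mul, mul_zero]

lemma Xmat_mul_idemMat (p : Coord α → ℂ) (a : ZMod m) :
    cMat P (Xmat p) * idemMat α P a = idemMat α P (a - 1) * cMat P (Xmat p) := by
  ext1 r c
  rw [idemMat, idemMat, Matrix.mul_diagonal, Matrix.diagonal_mul, cMat, Matrix.map_apply, Xmat]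
  split_ifs with h
  · rw [h, constι_comm, show c.1 + 1 + (a - 1) = c.1 + a by ring]
  · rw [map_zero, zero_mul, mul_zero]

lemma y_mul_idemMat (a : ZMod m) :
    scal P (Idx α) P.y * idemMat α P a = idemMat α P (a + 1) * scal P _ P.y := by
  rw [scal, idemMat, idemMat, Matrix.diagonal_mul_diagonal, Matrix.diagonal_mul_diagonal]
  simp only [P.y_mul_idem, add_assoc]

lemma x_mul_idemMat (a : ZMod m) :
    scal P (Idx α) P.x * idemMat α P a = idemMat α P (a - 1) * scal P _ P.x := by
  rw [scal, idemMat, idemMat, Matrix.diagonal_mul_diagonal, Matrix.diagonal_mul_diagonal]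
  congr 1
  funext r
  rw [← P.x_mul_idem, show r.1 + (a - 1) + 1 = r.1 + a by ring]

/-- The matrix `X - x`. -/
def Xsub (p : Coord α → ℂ) : Matrix (Idx α) (Idx α) P.Psd := cMat P (Xmat p) - scal P _ P.x

/-- The matrix `Y - y`. -/
def Ysub (p : Coord α → ℂ) : Matrix (Idx α) (Idx α) P.Psd := cMat P (Ymat p) - scal P _ P.y

lemma det_sub_scalar_ne_zero {I : Type*} [Fintype I] [DecidableEq I] (T : Matrix I I ℂ) :
    (T.map RatFunc.C - Matrix.scalar I (RatFunc.X (K := ℂ))).det ≠ 0 := by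
  have h : T.map RatFunc.C - Matrix.scalar I (RatFunc.X (K := ℂ)) =
      -((algebraMap ℂ[X] (RatFunc ℂ)).mapMatrix T.charmatrix) := by
    ext i j
    by_cases hij : i = j
    · subst hij; simp [Matrix.charmatrix_apply_eq]
    · simp [hij]
  rw [h, Matrix.det_neg, ← RingHom.map_det]
  refine mul_ne_zero (pow_ne_zero _ (by norm_num)) ?_
  exact algebraMap_poly_ne_zero (Matrix.charpoly_monic T).ne_zero

/-- The resolvent `(X - x)⁻¹` over the field of rational functions. -/
def resolvent {R I : Type*} [Field R] [Fintype I] [DecidableEq I] (T : Matrix I I R) :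
    Matrix I I (RatFunc R) :=
  (T.map RatFunc.C - Matrix.scalar I (RatFunc.X (K := R)))⁻¹

lemma Xhat_eq (p : Coord α → ℂ) : Xhat P p = P.ratι.mapMatrix (resolvent (Xmat p)) := rfl

lemma Xsub_eq (p : Coord α → ℂ) : Xsub P p =
    P.ratι.mapMatrix ((Xmat p).map RatFunc.C - Matrix.scalar _ (RatFunc.X (K := ℂ))) := by
  rw [map_sub]
  refine congrArg₂ (· - ·) rfl ?_
  ext1 r c
  by_cases h : r = c
  · subst h; simp [scal, Param.x]
  · simp [scal, h]

lemma Xhat_mul_Xsub (p : Coord α → ℂ) : Xhat P p * Xsub P p = 1 := by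
  rw [Xhat_eq, Xsub_eq, ← map_mul, resolvent,
    Matrix.nonsing_inv_mul _ (det_sub_scalar_ne_zero _).isUnit, map_one]

lemma Xsub_mul_Xhat (p : Coord α → ℂ) : Xsub P p * Xhat P p = 1 := by
  rw [Xhat_eq, Xsub_eq, ← map_mul, resolvent,
    Matrix.mul_nonsing_inv _ (det_sub_scalar_ne_zero _).isUnit, map_one]

lemma const_mul_coeff (z : ℂ) (u : P.Psd) (n : ℤ) :
    (constι P z * u).coeff n = ofRat m (RatFunc.C z) * u.coeff n :=
  PDO.monomial_zero_mul_coeff _ _ _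

/-- The embedding of `ℂ` in the crossed product. -/
def crossC (m : ℕ) : ℂ →+* Cross m := (ratHom m).comp RatFunc.C

lemma crossC_apply (m : ℕ) (z : ℂ) : crossC m z = ofRat m (RatFunc.C z) := rfl

lemma Yhat_coeff (p : Coord α → ℂ) (r c : Idx α) (n : ℤ) : (Yhat P p r c).coeff n =
    if n < 0 then crossC m (-(Ymat p ^ (-n - 1).toNat) r c) else 0 := by
  rw [crossC_apply, map_neg, ofRat, SkewMonoidAlgebra.single_neg]
  rfl

lemma one_matrix_coeff (r c : I) (n : ℤ) :
    ((1 : Matrix I I P.Psd) r c).coeff n =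
      if n = 0 then crossC m ((1 : Matrix I I ℂ) r c) else 0 := by
  rw [Matrix.one_apply, Matrix.one_apply]
  split_ifs with h h'
  · rw [map_one, h', PDO.one_coeff, if_pos rfl]
  · rw [PDO.one_coeff, if_neg h']
  · rw [map_zero, PDO.zero_coeff]
  · rw [PDO.zero_coeff]

lemma Y_mul_Yhat_coeff (p : Coord α → ℂ) (r c : Idx α) (n : ℤ) :
    ((cMat P (Ymat p) * Yhat P p) r c).coeff n =
      if n < 0 then crossC m (-(Ymat p ^ (-n).toNat) r c) else 0 := by
  rw [Matrix.mul_apply, PDO.sum_coeff]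
  simp only [cMat, Matrix.map_apply, const_mul_coeff, Yhat_coeff, mul_ite, mul_zero, ← crossC_apply]
  split_ifs with h
  · obtain ⟨k, hk⟩ : ∃ k : ℕ, n = -(k + 1 : ℕ) := ⟨(-n - 1).toNat, by omega⟩
    subst hk
    rw [show (-(-((k + 1 : ℕ) : ℤ))).toNat = k + 1 by omega,
      show (-(-((k + 1 : ℕ) : ℤ)) - 1).toNat = k by omega, pow_succ', Matrix.mul_apply]
    rw [← Finset.sum_neg_distrib, map_sum]
    simp only [← map_mul, mul_neg]
  · exact Finset.sum_const_zero

lemma y_mul_Yhat_coeff (p : Coord α → ℂ) (r c : Idx α) (n : ℤ) :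
    ((scal P (Idx α) P.y * Yhat P p) r c).coeff n =
      if n < 1 then crossC m (-(Ymat p ^ (-n).toNat) r c) else 0 := by
  have hσ : ∀ f, P.skew.σ f = thetaInv m f := fun _ => rfl
  have hδ : ∀ f, P.skew.δ f = P.D f := fun _ => rfl
  rw [scal, Matrix.diagonal_mul, Param.y, Param.yPow, PDO.y_mul_coeff, Yhat_coeff, Yhat_coeff,
    apply_ite P.skew.σ, apply_ite P.skew.δ]
  simp only [map_zero, hσ, hδ, crossC_apply, Param.thetaInv_ofRat, Param.D_C, ite_self, add_zero]
  rw [show (-(n - 1) - 1).toNat = (-n).toNat by congr 1; ring]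
  have : n - 1 < 0 ↔ n < 1 := by omega
  simp only [this]

lemma Yhat_comm_Y (p : Coord α → ℂ) : Yhat P p * cMat P (Ymat p) = cMat P (Ymat p) * Yhat P p := by
  ext1 r c
  refine PDO.ext (funext fun n => ?_)
  rw [Y_mul_Yhat_coeff, Matrix.mul_apply, PDO.sum_coeff]
  simp only [cMat, Matrix.map_apply]
  have e : ∀ s, (Yhat P p r s * constι P (Ymat p s c)).coeff n =
      if n < 0 then crossC m (-((Ymat p ^ (-n - 1).toNat) r s * Ymat p s c)) else 0 := fun s => by
    rw [← constι_comm, const_mul_coeff, Yhat_coeff, mul_ite, mul_zero, ← crossC_apply, ← map_mul,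
      mul_neg, mul_comm (Ymat p s c)]
  simp only [e]
  split_ifs with h
  · obtain ⟨k, hk⟩ : ∃ k : ℕ, n = -(k + 1 : ℕ) := ⟨(-n - 1).toNat, by omega⟩
    subst hk
    rw [show (-(-((k + 1 : ℕ) : ℤ))).toNat = k + 1 by omega,
      show (-(-((k + 1 : ℕ) : ℤ)) - 1).toNat = k by omega, pow_succ, Matrix.mul_apply,
      ← Finset.sum_neg_distrib, map_sum]
  · exact Finset.sum_const_zero

lemma Yhat_comm_y (p : Coord α → ℂ) :
    Yhat P p * scal P (Idx α) P.y = scal P (Idx α) P.y * Yhat P p := by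
  ext1 r c
  refine PDO.ext (funext fun n => ?_)
  rw [y_mul_Yhat_coeff, scal, Matrix.mul_diagonal, Param.y, Param.yPow, PDO.mul_yPow_coeff,
    Yhat_coeff, show (-(n - 1) - 1).toNat = (-n).toNat by congr 1; ring]
  have : n - 1 < 0 ↔ n < 1 := by omega
  simp only [this]

lemma Ysub_mul_Yhat (p : Coord α → ℂ) : Ysub P p * Yhat P p = 1 := by
  ext1 r c
  refine PDO.ext (funext fun n => ?_)
  rw [Ysub, Matrix.sub_mul, Matrix.sub_apply, PDO.sub_coeff, Y_mul_Yhat_coeff, y_mul_Yhat_coeff,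
    one_matrix_coeff]
  rcases lt_trichotomy n 0 with h | h | h
  · rw [if_pos h, if_pos (by omega), if_neg h.ne, sub_self]
  · subst h; simp
  · rw [if_neg (by omega), if_neg (by omega), if_neg h.ne', sub_self]

lemma Yhat_mul_Ysub (p : Coord α → ℂ) : Yhat P p * Ysub P p = 1 := by
  rw [← Ysub_mul_Yhat P p, Ysub, Matrix.mul_sub, Matrix.sub_mul, Yhat_comm_Y, Yhat_comm_y]

lemma Xsub_mul_idemMat (p : Coord α → ℂ) (a : ZMod m) :
    Xsub P p * idemMat α P a = idemMat α P (a - 1) * Xsub P p := by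
  rw [Xsub, Matrix.sub_mul, Matrix.mul_sub, Xmat_mul_idemMat, x_mul_idemMat]

lemma Ysub_mul_idemMat (p : Coord α → ℂ) (a : ZMod m) :
    Ysub P p * idemMat α P a = idemMat α P (a + 1) * Ysub P p := by
  rw [Ysub, Matrix.sub_mul, Matrix.mul_sub, Ymat_mul_idemMat, y_mul_idemMat]

lemma idemMat_mul_Xhat (p : Coord α → ℂ) (a : ZMod m) :
    idemMat α P a * Xhat P p = Xhat P p * idemMat α P (a - 1) := by
  have := congrArg (fun T => Xhat P p * T * Xhat P p) (Xsub_mul_idemMat P p a)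
  beta_reduce at this
  rw [← Matrix.mul_assoc, Xhat_mul_Xsub, Matrix.one_mul, ← Matrix.mul_assoc,
    Matrix.mul_assoc _ _ (Xhat P p), Xsub_mul_Xhat, Matrix.mul_one] at this
  exact this

lemma idemMat_mul_Yhat (p : Coord α → ℂ) (a : ZMod m) :
    idemMat α P a * Yhat P p = Yhat P p * idemMat α P (a + 1) := by
  have := congrArg (fun T => Yhat P p * T * Yhat P p) (Ysub_mul_idemMat P p a)
  beta_reduce at this
  rw [← Matrix.mul_assoc, Yhat_mul_Ysub, Matrix.one_mul, ← Matrix.mul_assoc,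
    Matrix.mul_assoc _ _ (Yhat P p), Ysub_mul_Yhat, Matrix.mul_one] at this
  exact this

/-- The column `∑ b_i ε_i` for a vector `b` in `V`. -/
def colE (b : Idx α → ℂ) : Matrix (Idx α) Unit P.Psd :=
  idemMat α P 0 * cMat P (Matrix.replicateCol Unit b)

/-- The row `∑ ε_i a_i` for a covector `a` on `V`. -/
def rowE (a : Idx α → ℂ) : Matrix Unit (Idx α) P.Psd :=
  cMat P (Matrix.replicateRow Unit a) * idemMat α P 0

/-- The component of a vector in `V_i`, extended by zero. -/
def part (b : Idx α → ℂ) (i : ZMod m) : Idx α → ℂ := fun r => if r.1 = i then b r else 0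

lemma sum_part_sandwich (a b : Idx α → ℂ) (T : Matrix (Idx α) (Idx α) P.Psd) :
    ∑ i : ZMod m, ∑ j : ZMod m, P.ι (P.ε i) *
      ((fun r => const P (part a i r)) ⬝ᵥ T.mulVec fun r => const P (part b j r)) * P.ι (P.ε j) =
    (rowE P a * T * colE P b) () () := by
  have hr : ∀ r, rowE P a () r = P.idem r.1 * const P (a r) := fun r => by
    rw [rowE, idemMat, Matrix.mul_diagonal, add_zero]; exact P.const_commute _ _
  have hc : ∀ c, colE P b c () = const P (b c) * P.idem c.1 := fun c => by
    rw [colE, idemMat, Matrix.diagonal_mul, add_zero]; exact (P.const_commute _ _).symm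
  have hz : const P 0 = 0 := map_zero (constι P)
  have hp : ∀ (d : Idx α → ℂ) i r, const P (part d i r) = if r.1 = i then const P (d r) else 0 :=
    fun d i r => by rw [part, apply_ite (const P), hz]
  simp only [Matrix.mul_apply, hr, hc, dotProduct, Matrix.mulVec, hp, Finset.mul_sum,
    Finset.sum_mul, mul_ite, ite_mul, mul_zero, zero_mul]
  have e : ∀ i j : ZMod m, (∑ r : Idx α, ∑ c : Idx α, if c.1 = j then if r.1 = i then
      P.ι (P.ε i) * (const P (a r) * (T r c * const P (b c))) * P.ι (P.ε j) else 0 else 0) =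
      ∑ r : Idx α, ∑ c : Idx α, if c.1 = j then if r.1 = i then
      P.idem r.1 * const P (a r) * T r c * (const P (b c) * P.idem c.1) else 0 else 0 := by
    intro i j
    refine Finset.sum_congr rfl fun r _ => Finset.sum_congr rfl fun c _ => ?_
    split_ifs with h1 h2
    · subst h1 h2
      simp only [Param.idem, mul_assoc]
    all_goals rfl
  trans ∑ i : ZMod m, ∑ j : ZMod m, ∑ r : Idx α, ∑ c : Idx α, if c.1 = j then if r.1 = i then
      P.idem r.1 * const P (a r) * T r c * (const P (b c) * P.idem c.1) else 0 else 0
  · refine Finset.sum_congr rfl fun i _ => Finset.sum_congr rfl fun j _ => ?_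
    rw [← e i j]
  · rw [Finset.sum_comm' (t' := Finset.univ) (s' := fun _ => Finset.univ) (by simp)]
    calc _ = ∑ j : ZMod m, ∑ r : Idx α, ∑ c : Idx α, ∑ i : ZMod m, (if c.1 = j then if r.1 = i then
          P.idem r.1 * const P (a r) * T r c * (const P (b c) * P.idem c.1) else 0 else 0) := by
          refine Finset.sum_congr rfl fun j _ => ?_
          rw [Finset.sum_comm]
          refine Finset.sum_congr rfl fun r _ => ?_
          rw [Finset.sum_comm]
      _ = ∑ j : ZMod m, ∑ r : Idx α, ∑ c : Idx α, (if c.1 = j then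
          P.idem r.1 * const P (a r) * T r c * (const P (b c) * P.idem c.1) else 0) := by
          refine Finset.sum_congr rfl fun j _ => Finset.sum_congr rfl fun r _ =>
            Finset.sum_congr rfl fun c _ => ?_
          split_ifs with h
          · rw [Finset.sum_ite_eq, if_pos (Finset.mem_univ _)]
          · exact Finset.sum_const_zero
      _ = ∑ r : Idx α, ∑ c : Idx α, ∑ j : ZMod m, (if c.1 = j then
          P.idem r.1 * const P (a r) * T r c * (const P (b c) * P.idem c.1) else 0) := by
          rw [Finset.sum_comm]
          refine Finset.sum_congr rfl fun r _ => ?_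
          rw [Finset.sum_comm]
      _ = ∑ c : Idx α, ∑ r : Idx α,
          P.idem r.1 * const P (a r) * T r c * (const P (b c) * P.idem c.1) := by
          rw [Finset.sum_comm]
          simp only [Finset.sum_ite_eq, Finset.mem_univ, if_true]

lemma sandwich_eq (p : Coord α → ℂ) (T : Matrix (Idx α) (Idx α) P.Psd) :
    sandwich P p T = (rowE P (wTot p) * T * colE P (vTot p)) () () :=
  sum_part_sandwich P (wTot p) (vTot p) T

end Quiver

section Quiver
variable {m : ℕ} [NeZero m] {α : ZMod m → ℕ} (P : Param m)

/-! ### The formula for the inverse -/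

lemma sum_vecMulVec_part (p : Coord α → ℂ) (r c : Idx α) :
    (∑ i : ZMod m, Matrix.vecMulVec (vPart p i) (wPart p i)) r c =
      if r.1 = c.1 then p (.v r) * p (.w c) else 0 := by
  simp only [Matrix.sum_apply, Matrix.vecMulVec_apply, vPart, wPart, ite_mul, mul_ite, zero_mul,
    mul_zero, Finset.sum_ite_eq, Finset.mem_univ, if_true]

/-- The moment relation and the relation of the Cherednik algebra combine: the terms with `λ_i`
cancel on the range of the idempotent, and a rank one commutator remains. -/
lemma commutator_mul_idemMat {p : Coord α → ℂ} (hp : Moment P p) :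
    (Ysub P p * Xsub P p - Xsub P p * Ysub P p) * idemMat α P 0 =
      colE P (vTot p) * rowE P (wTot p) := by
  have e1 : Ysub P p * Xsub P p - Xsub P p * Ysub P p =
      cMat P (Ymat p * Xmat p - Xmat p * Ymat p) +
        scal P (Idx α) (-∑ i : ZMod m, const P (P.lam i) * P.idem i) := by
    have h : ∀ u : P.Psd, scal P (Idx α) u = Matrix.scalar (Idx α) u := fun _ => rfl
    rw [← P.y_mul_x_sub, h, map_sub, map_mul, map_mul, cMat_sub, cMat_mul, cMat_mul, Ysub, Xsub,
      Matrix.sub_mul, Matrix.mul_sub, Matrix.sub_mul, Matrix.mul_sub, Matrix.mul_sub,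
      Matrix.mul_sub, cMat_mul_scal, cMat_mul_scal]
    simp only [h]
    abel
  rw [e1]
  ext1 r c
  have hm := congrFun (congrFun hp r) c
  rw [Matrix.sub_apply, sum_vecMulVec_part, sub_eq_iff_eq_add] at hm
  have hprod : (colE P (vTot p) * rowE P (wTot p)) r c =
      P.idem r.1 * constι P (p (.v r)) * (constι P (p (.w c)) * P.idem c.1) := by
    rw [Matrix.mul_apply, Finset.univ_unique, Finset.sum_singleton, colE, rowE, idemMat,
      Matrix.diagonal_mul, Matrix.mul_diagonal, add_zero, add_zero]
    rfl
  rw [hprod, idemMat, Matrix.mul_diagonal, Matrix.add_apply, cMat, Matrix.map_apply, hm, map_add,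
    add_zero]
  have e2 : P.idem r.1 * constι P (p (.v r)) * (constι P (p (.w c)) * P.idem c.1) =
      constι P (if r.1 = c.1 then p (.v r) * p (.w c) else 0) * P.idem c.1 := by
    rw [← constι_comm, mul_assoc, constι_comm P (p (.w c)), ← mul_assoc (P.idem r.1),
      P.idem_mul_idem]
    split_ifs with h
    · rw [← constι_comm, ← mul_assoc, map_mul]
    · rw [zero_mul, mul_zero, map_zero, zero_mul]
  have e3 : (constι P (Matrix.diagonal (fun r : Idx α => P.lam r.1) r c) +
      scal P (Idx α) (-∑ i : ZMod m, const P (P.lam i) * P.idem i) r c) * P.idem c.1 = 0 := by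
    rw [scal, Matrix.diagonal_apply, Matrix.diagonal_apply]
    split_ifs with h
    · subst h
      rw [add_mul, neg_mul, Finset.sum_mul]
      simp only [mul_assoc, P.idem_mul_idem, mul_ite, mul_zero, Finset.sum_ite_eq', Finset.mem_univ,
        if_true, constι_apply]
      exact add_neg_cancel _
    · rw [map_zero, zero_add, zero_mul]
  rw [e2, add_comm (constι P (Matrix.diagonal _ r c)), add_assoc, add_mul, e3, add_zero]

/-- Over a point of the fibre, `X - x` and `Y - y` satisfy the hypotheses of the inversion
formula. -/
lemma dressing {p : Coord α → ℂ} (hp : Moment P p) :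
    Dressing (Xsub P p) (Ysub P p) (Xhat P p) (Yhat P p) (idemMat α P 0) (colE P (vTot p))
      (rowE P (wTot p)) where
  AA' := Xsub_mul_Xhat P p
  A'A := Xhat_mul_Xsub P p
  BB' := Ysub_mul_Yhat P p
  B'B := Yhat_mul_Ysub P p
  comm := commutator_mul_idemMat P hp
  E_A'B' := by
    rw [← Matrix.mul_assoc, idemMat_mul_Xhat, Matrix.mul_assoc, idemMat_mul_Yhat, sub_add_cancel,
      Matrix.mul_assoc]
  E_B'A' := by
    rw [← Matrix.mul_assoc, idemMat_mul_Yhat, Matrix.mul_assoc, idemMat_mul_Xhat,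
      add_sub_cancel_right, Matrix.mul_assoc]
  EV := by rw [colE, ← Matrix.mul_assoc, idemMat_mul_self]

/-- `M` as a matrix of size one. -/
def Mmat (p : Coord α → ℂ) : Matrix Unit Unit P.Psd :=
  1 - rowE P (wTot p) * (Xhat P p * Yhat P p) * colE P (vTot p)

/-- The asserted inverse of `M` as a matrix of size one. -/
def Nmat (p : Coord α → ℂ) : Matrix Unit Unit P.Psd :=
  1 + rowE P (wTot p) * (Yhat P p * Xhat P p) * colE P (vTot p)

lemma Mop_eq (p : Coord α → ℂ) : Mop P p = Mmat P p () () := by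
  rw [Mop, sandwich_eq, Mmat, Matrix.sub_apply, Matrix.one_apply_eq]

lemma MopInv_eq (p : Coord α → ℂ) : MopInv P p = Nmat P p () () := by
  rw [MopInv, sandwich_eq, Nmat, Matrix.add_apply, Matrix.one_apply_eq]

lemma unit_mul_apply {R : Type*} [Ring R] (S T : Matrix Unit Unit R) :
    S () () * T () () = (S * T) () () := by
  rw [Matrix.mul_apply, Fintype.sum_unique]

lemma Mop_mul_MopInv {p : Coord α → ℂ} (hp : Moment P p) : Mop P p * MopInv P p = 1 := by
  rw [Mop_eq, MopInv_eq, unit_mul_apply, Mmat, Nmat, (dressing P hp).mul_inv, Matrix.one_apply_eq]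

lemma MopInv_mul_Mop {p : Coord α → ℂ} (hp : Moment P p) : MopInv P p * Mop P p = 1 := by
  rw [Mop_eq, MopInv_eq, unit_mul_apply, Mmat, Nmat, (dressing P hp).inv_mul, Matrix.one_apply_eq]

/-! ### The equation of Sato–Wilson type for the Hamiltonian vector field -/

/-- The unprojected variation `-∑ Y ^ i v w Y ^ (k-1-i)` of `X`. -/
def Tvar (p : Coord α → ℂ) (k : ℕ) : Matrix (Idx α) (Idx α) ℂ :=
  -∑ i ∈ Finset.range k,
    Ymat p ^ i * Matrix.vecMulVec (vTot p) (wTot p) * Ymat p ^ (k - 1 - i)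

/-- The projection of an endomorphism of `V` to `⨁ Hom(V_i, V_{i+1})`. -/
def raise {R : Type*} [Zero R] (T : Matrix (Idx α) (Idx α) R) : Matrix (Idx α) (Idx α) R :=
  fun r c => if r.1 = c.1 + 1 then T r c else 0

/-- The variation of `M` along given variations of `X`, `v` and `w`. -/
def Mvar (p : Coord α → ℂ) (X' : Matrix (Idx α) (Idx α) ℂ) (v' w' : Idx α → ℂ) :
    Matrix Unit Unit P.Psd :=
  -(rowE P w' * (Xhat P p * Yhat P p) * colE P (vTot p))
    + rowE P (wTot p) * (Xhat P p * cMat P X' * Xhat P p * Yhat P p) * colE P (vTot p)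
    - rowE P (wTot p) * (Xhat P p * Yhat P p) * colE P v'

/-- The variation of `M` along the Hamiltonian vector field of `H_k`. -/
def Mdot (p : Coord α → ℂ) (k : ℕ) : Matrix Unit Unit P.Psd :=
  Mvar P p (raise (Tvar p k)) (-(Ymat p ^ k).mulVec (vTot p)) (Matrix.vecMul (wTot p) (Ymat p ^ k))

/-- All entries are free of negative powers of `y`. -/
def NonnegMat {I J : Type*} (T : Matrix I J P.Psd) : Prop := ∀ r c, (T r c).Nonneg

variable {P}

section
variable {I J K : Type*} [Fintype J]

lemma NonnegMat.mul {S : Matrix I J P.Psd} {T : Matrix J K P.Psd} (h : NonnegMat P S)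
    (h' : NonnegMat P T) : NonnegMat P (S * T) := fun r c => by
  rw [Matrix.mul_apply]; exact PDO.Nonneg.sum fun i _ => (h r i).mul (h' i c)

omit [Fintype J] in
lemma NonnegMat.add {S T : Matrix I J P.Psd} (h : NonnegMat P S) (h' : NonnegMat P T) :
    NonnegMat P (S + T) := fun r c => (h r c).add (h' r c)

omit [Fintype J] in
lemma NonnegMat.neg {T : Matrix I J P.Psd} (h : NonnegMat P T) : NonnegMat P (-T) :=
  fun r c => (h r c).neg

omit [Fintype J] in
lemma NonnegMat.sum {κ : Type*} {s : Finset κ} {T : κ → Matrix I J P.Psd}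
    (h : ∀ i ∈ s, NonnegMat P (T i)) : NonnegMat P (∑ i ∈ s, T i) := fun r c => by
  rw [Matrix.sum_apply]; exact PDO.Nonneg.sum fun i hi => h i hi r c

omit [Fintype J] in
lemma nonnegMat_diagonal [DecidableEq J] {d : J → P.Psd} (h : ∀ j, (d j).Nonneg) :
    NonnegMat P (Matrix.diagonal d) := fun r c => by
  rw [Matrix.diagonal_apply]
  split_ifs
  · exact h r
  · exact fun _ _ => rfl

omit [Fintype J] in
lemma nonnegMat_cMat (T : Matrix I J ℂ) : NonnegMat P (cMat P T) :=
  fun _ _ => PDO.nonneg_monomial le_rfl _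

lemma NonnegMat.pow [DecidableEq J] {T : Matrix J J P.Psd} (h : NonnegMat P T) (k : ℕ) :
    NonnegMat P (T ^ k) := by
  induction k with
  | zero => exact nonnegMat_diagonal fun _ => PDO.nonneg_monomial le_rfl _
  | succ k ih => rw [pow_succ]; exact ih.mul h
end

lemma nonnegMat_scal_y {I : Type*} [DecidableEq I] : NonnegMat P (scal P I P.y) :=
  nonnegMat_diagonal fun _ => PDO.nonneg_monomial zero_le_one _

lemma nonnegMat_idemMat (a : ZMod m) : NonnegMat P (idemMat α P a) :=
  nonnegMat_diagonal fun _ => PDO.nonneg_monomial le_rfl _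

lemma nonnegMat_Xhat (p : Coord α → ℂ) : NonnegMat P (Xhat P p) :=
  fun _ _ => PDO.nonneg_monomial le_rfl _

lemma nonnegMat_rowE (a : Idx α → ℂ) : NonnegMat P (rowE P a) :=
  (nonnegMat_cMat _).mul (nonnegMat_idemMat _)

lemma nonnegMat_colE (b : Idx α → ℂ) : NonnegMat P (colE P b) :=
  (nonnegMat_idemMat _).mul (nonnegMat_cMat _)

variable (P) in
/-- The sum `∑_{i < k} Y ^ i y ^ (k-1-i)`. -/
def geomY (p : Coord α → ℂ) (k : ℕ) : Matrix (Idx α) (Idx α) P.Psd :=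
  ∑ i ∈ Finset.range k, cMat P (Ymat p) ^ i * scal P (Idx α) P.y ^ (k - 1 - i)

lemma Y_commute_y (p : Coord α → ℂ) : Commute (cMat P (Ymat p)) (scal P (Idx α) P.y) :=
  cMat_mul_scal P _ _

lemma Ysub_mul_geomY (p : Coord α → ℂ) (k : ℕ) :
    Ysub P p * geomY P p k = cMat P (Ymat p) ^ k - scal P (Idx α) P.y ^ k :=
  (Y_commute_y p).mul_geom_sum₂ k

lemma geomY_mul_Ysub (p : Coord α → ℂ) (k : ℕ) :
    geomY P p k * Ysub P p = cMat P (Ymat p) ^ k - scal P (Idx α) P.y ^ k :=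
  (Y_commute_y p).geom_sum₂_mul k

lemma nonnegMat_geomY (p : Coord α → ℂ) (k : ℕ) : NonnegMat P (geomY P p k) :=
  NonnegMat.sum fun _ _ => ((nonnegMat_cMat _).pow _).mul (nonnegMat_scal_y.pow _)

lemma Yhat_mul_pow_sub (p : Coord α → ℂ) (k : ℕ) :
    Yhat P p * (cMat P (Ymat p) ^ k - scal P (Idx α) P.y ^ k) = geomY P p k := by
  rw [← Ysub_mul_geomY, ← Matrix.mul_assoc, Yhat_mul_Ysub, Matrix.one_mul]

lemma pow_sub_mul_Yhat (p : Coord α → ℂ) (k : ℕ) :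
    (cMat P (Ymat p) ^ k - scal P (Idx α) P.y ^ k) * Yhat P p = geomY P p k := by
  rw [← geomY_mul_Ysub, Matrix.mul_assoc, Ysub_mul_Yhat, Matrix.mul_one]

lemma Y_pow_mul_idemMat (p : Coord α → ℂ) (a : ZMod m) (k : ℕ) :
    cMat P (Ymat p) ^ k * idemMat α P a = idemMat α P (a + k) * cMat P (Ymat p) ^ k := by
  induction k with
  | zero => simp
  | succ k ih =>
    rw [pow_succ', Matrix.mul_assoc, ih, ← Matrix.mul_assoc, Ymat_mul_idemMat, Matrix.mul_assoc,
      Nat.cast_succ, add_assoc]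

lemma y_pow_mul_idemMat (a : ZMod m) (k : ℕ) :
    scal P (Idx α) P.y ^ k * idemMat α P a = idemMat α P (a + k) * scal P (Idx α) P.y ^ k := by
  induction k with
  | zero => simp
  | succ k ih =>
    rw [pow_succ', Matrix.mul_assoc, ih, ← Matrix.mul_assoc, y_mul_idemMat, Matrix.mul_assoc,
      Nat.cast_succ, add_assoc]

/-- Between idempotents, the projection to `⨁ Hom(V_i, V_{i+1})` is invisible. -/
lemma idemMat_mul_raise (T : Matrix (Idx α) (Idx α) ℂ) :
    idemMat α P (-1) * cMat P (raise T) = idemMat α P (-1) * cMat P T * idemMat α P 0 := by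
  ext1 r c
  rw [idemMat, idemMat, Matrix.mul_diagonal, Matrix.diagonal_mul, Matrix.diagonal_mul, cMat, cMat,
    Matrix.map_apply, Matrix.map_apply, raise, ← constι_comm, ← constι_comm, mul_assoc,
    P.idem_mul_idem, add_zero]
  by_cases h : r.1 = c.1 + 1
  · have h' : r.1 + -1 = c.1 := by rw [h]; ring
    rw [if_pos h, if_pos h', h']
  · have h' : ¬ r.1 + -1 = c.1 := fun h' => h (by rw [← h']; ring)
    rw [if_neg h, if_neg h', map_zero, zero_mul, mul_zero]

lemma cMat_Tvar (p : Coord α → ℂ) (k : ℕ) : cMat P (Tvar p k) =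
    -∑ i ∈ Finset.range k, cMat P (Ymat p) ^ i * (cMat P (Matrix.replicateCol Unit (vTot p)) *
      cMat P (Matrix.replicateRow Unit (wTot p))) * cMat P (Ymat p) ^ (k - 1 - i) := by
  simp only [Tvar, Matrix.vecMulVec_eq Unit, cMat_neg, cMat_sum, cMat_mul, cMat_pow]

/-- The polynomial in `Y` and `y` on the left, in which the variation of `X` enters, is divisible by
`Y - y` on the right, term by term. -/
lemma geomY_add_raise (p : Coord α → ℂ) (k : ℕ) :
    geomY P p k * (idemMat α P (-k) * cMat P (Matrix.replicateCol Unit (vTot p))) *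
        rowE P (wTot p) + idemMat α P (-1) * cMat P (raise (Tvar p k)) =
      -∑ i ∈ Finset.range k, cMat P (Ymat p) ^ i * (idemMat α P (-1 - i) *
        (cMat P (Matrix.replicateCol Unit (vTot p)) * cMat P (Matrix.replicateRow Unit (wTot p))) *
        idemMat α P (k - 1 - i : ℕ)) *
        (cMat P (Ymat p) ^ (k - 1 - i) - scal P (Idx α) P.y ^ (k - 1 - i)) := by
  rw [idemMat_mul_raise, cMat_Tvar, geomY, Matrix.sum_mul, Matrix.sum_mul, Matrix.mul_neg,
    Matrix.mul_sum, Matrix.neg_mul, Matrix.sum_mul, ← sub_eq_add_neg, ← Finset.sum_sub_distrib,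
    ← Finset.sum_neg_distrib]
  refine Finset.sum_congr rfl fun i hi => ?_
  have hi := Finset.mem_range.1 hi
  set C := cMat P (Matrix.replicateCol Unit (vTot p))
  set D := cMat P (Matrix.replicateRow Unit (wTot p))
  set Y := cMat P (Ymat p)
  set y := scal P (Idx α) P.y with hy
  obtain ⟨j, rfl⟩ : ∃ j, k = i + 1 + j := ⟨k - 1 - i, by omega⟩
  rw [show i + 1 + j - 1 - i = j by omega]
  have e1 : idemMat α P (-1) * Y ^ i = Y ^ i * idemMat α P (-1 - i) := by
    rw [Y_pow_mul_idemMat, sub_add_cancel]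
  have e2 : Y ^ j * idemMat α P 0 = idemMat α P (j : ℕ) * Y ^ j := by
    rw [Y_pow_mul_idemMat, zero_add]
  have e3 : y ^ j * idemMat α P (-((i + 1 + j : ℕ) : ZMod m)) = idemMat α P (-1 - i) * y ^ j := by
    rw [y_pow_mul_idemMat]
    congr 2
    push_cast
    ring
  have e4 : y ^ j * (C * D) = C * D * y ^ j := by
    rw [← Matrix.mul_assoc, hy, scal_pow, ← cMat_mul_scal P _ (P.y ^ j), Matrix.mul_assoc,
      ← cMat_mul_scal P _ (P.y ^ j), Matrix.mul_assoc]
  have e5 : y ^ j * idemMat α P 0 = idemMat α P (j : ℕ) * y ^ j := by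
    rw [y_pow_mul_idemMat, zero_add]
  calc Y ^ i * y ^ j * (idemMat α P (-((i + 1 + j : ℕ) : ZMod m)) * C) * (D * idemMat α P 0) -
      idemMat α P (-1) * (Y ^ i * (C * D) * Y ^ j) * idemMat α P 0
      = Y ^ i * ((y ^ j * idemMat α P (-((i + 1 + j : ℕ) : ZMod m))) * (C * D) * idemMat α P 0) -
        (idemMat α P (-1) * Y ^ i) * (C * D) * (Y ^ j * idemMat α P 0) := by
        simp only [Matrix.mul_assoc]
    _ = Y ^ i * (idemMat α P (-1 - i) * (y ^ j * (C * D)) * idemMat α P 0) -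
        (Y ^ i * idemMat α P (-1 - i)) * (C * D) * (idemMat α P (j : ℕ) * Y ^ j) := by
        rw [e1, e2, e3]; simp only [Matrix.mul_assoc]
    _ = Y ^ i * idemMat α P (-1 - i) * (C * D) * (y ^ j * idemMat α P 0) -
        (Y ^ i * idemMat α P (-1 - i)) * (C * D) * (idemMat α P (j : ℕ) * Y ^ j) := by
        rw [e4]; simp only [Matrix.mul_assoc]
    _ = _ := by
        rw [e5]; simp only [Matrix.mul_assoc, Matrix.mul_sub, neg_sub]

/-- The algebra behind `nonnegMat_dressed`: in the dressed variation, every occurrence of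
`Y' = (Y - y)⁻¹` but the one in the last summand can be absorbed into
`S = (Y ^ k - y ^ k) (Y - y)⁻¹`. The letters stand for `A = Y ^ k`, `B = y ^ k`, `X = (X - x)⁻¹`,
while `b` is `y ^ k` in size one. -/
lemma dressed_eq {R I : Type*} [Ring R] [Fintype I] [DecidableEq I]
    {X Y' A B S F e : Matrix I I R} {V V₁ : Matrix I Unit R} {W W₁ : Matrix Unit I R}
    {b N : Matrix Unit Unit R} (hres : X * Y' * V * N = Y' * X * V)
    (hN : N = 1 + W * (Y' * X) * V) (hYS : Y' * (A - B) = S) (hSY : (A - B) * Y' = S)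
    (hbW : b * W = W₁ * B) (hWX : W * X = W * X * e) :
    (-(W₁ * A * (X * Y') * V) + W * (X * F * X * Y') * V + W * (X * Y') * (A * V₁) +
      (b - W * (X * Y') * (B * V₁))) * N =
    b - W₁ * S * (X * V) + W * X * (S * V₁) + W * X * ((S * V₁ * W + e * F) * Y' * (X * V)) := by
  calc (-(W₁ * A * (X * Y') * V) + W * (X * F * X * Y') * V + W * (X * Y') * (A * V₁) +
      (b - W * (X * Y') * (B * V₁))) * N
      = (-(W₁ * A * (X * Y' * V)) + W * X * F * (X * Y' * V) +
          b + W * X * (Y' * (A - B)) * V₁) * N := by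
        congr 1
        simp only [Matrix.mul_sub, Matrix.sub_mul, Matrix.mul_assoc]
        abel
    _ = -(W₁ * A * (X * Y' * V * N)) + W * X * F * (X * Y' * V * N) +
          b * N + W * X * S * V₁ * N := by
        rw [hYS]
        simp only [Matrix.add_mul, Matrix.neg_mul, Matrix.mul_assoc]
    _ = -(W₁ * A * (Y' * X * V)) + W * X * F * (Y' * X * V) +
          (b + (b * W) * (Y' * X * V)) +
            (W * X * S * V₁ + W * X * S * V₁ * (W * (Y' * X * V))) := by
        rw [hres, hN]
        simp only [Matrix.mul_add, Matrix.mul_one, Matrix.mul_assoc]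
    _ = b - W₁ * ((A - B) * Y') * (X * V) + W * X * (S * V₁) +
          ((W * X) * (S * V₁ * W * Y' * (X * V)) + (W * X) * F * (Y' * X * V)) := by
        rw [hbW]
        simp only [Matrix.mul_sub, Matrix.sub_mul, Matrix.mul_assoc]
        abel
    _ = b - W₁ * S * (X * V) + W * X * (S * V₁) +
          ((W * X) * (S * V₁ * W * Y' * (X * V)) + (W * X * e) * F * (Y' * X * V)) := by
        rw [hSY, ← hWX]
    _ = _ := by
        simp only [Matrix.add_mul, Matrix.mul_add, Matrix.mul_assoc]

/-- The key identity: `(M' + M y ^ k) M⁻¹` has no negative powers of `y`. -/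
lemma nonnegMat_dressed {p : Coord α → ℂ} (hp : Moment P p) (k : ℕ) :
    NonnegMat P ((Mdot P p k + Mmat P p * scal P Unit P.y ^ k) * Nmat P p) := by
  have hd := dressing P hp
  set X := Xhat P p with hX
  set Yh := Yhat P p with hYh
  set V := colE P (vTot p) with hV
  set W := rowE P (wTot p) with hW
  set C := cMat P (Matrix.replicateCol Unit (vTot p)) with hC
  set D := cMat P (Matrix.replicateRow Unit (wTot p)) with hD
  set Y := cMat P (Ymat p) with hY
  set y := scal P (Idx α) P.y with hy
  set y₁ := scal P Unit P.y with hy₁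
  set S := geomY P p k with hS
  set Vk := idemMat α P (-k) * C with hVk
  set N := Nmat P p with hN
  have hVy : V * y₁ ^ k = y ^ k * Vk := by
    rw [hV, colE, ← hC, hy₁, scal_pow, Matrix.mul_assoc, hC, cMat_mul_scal P _ (P.y ^ k), ← hC,
      ← Matrix.mul_assoc, ← scal_pow, ← hy, hVk, ← Matrix.mul_assoc, y_pow_mul_idemMat,
      neg_add_cancel]
  have hV' : colE P (-(Ymat p ^ k).mulVec (vTot p)) = -(Y ^ k * Vk) := by
    rw [colE, hVk, ← Matrix.mul_assoc, Y_pow_mul_idemMat, neg_add_cancel, hC, ← cMat_pow,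
      Matrix.mul_assoc, ← cMat_mul, ← Matrix.mul_neg, ← cMat_neg]
    rfl
  have hW' : rowE P (Matrix.vecMul (wTot p) (Ymat p ^ k)) = D * idemMat α P k * Y ^ k := by
    have := Y_pow_mul_idemMat (P := P) p 0 k
    rw [zero_add] at this
    rw [Matrix.mul_assoc, ← this, rowE, hD, ← Matrix.mul_assoc, ← cMat_pow, ← cMat_mul]
    rfl
  have hyW : y₁ ^ k * W = D * idemMat α P k * y ^ k := by
    have := y_pow_mul_idemMat (α := α) (P := P) 0 k
    rw [zero_add] at this
    rw [Matrix.mul_assoc, ← this, hW, rowE, hy₁, scal_pow, ← Matrix.mul_assoc,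
      ← cMat_mul_scal P _ (P.y ^ k), Matrix.mul_assoc, scal_pow]
  have hWX : W * X = W * X * idemMat α P (-1) := by
    have := idemMat_mul_Xhat P p 0
    rw [zero_sub] at this
    rw [Matrix.mul_assoc, ← this, ← Matrix.mul_assoc, hW, rowE,
      Matrix.mul_assoc _ _ (idemMat α P 0), idemMat_mul_self]
  have hMy : Mmat P p * y₁ ^ k = y₁ ^ k - W * (X * Yh) * (y ^ k * Vk) := by
    rw [Mmat, Matrix.sub_mul, Matrix.one_mul, Matrix.mul_assoc _ _ (y₁ ^ k), hVy]
  have hN' : N = 1 + W * (Yh * X) * V := rfl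
  have hres : X * Yh * V * N = Yh * X * V := hd.resolvent_mul
  have hYS : Yh * (Y ^ k - y ^ k) = S := Yhat_mul_pow_sub p k
  have hSY : (Y ^ k - y ^ k) * Yh = S := pow_sub_mul_Yhat p k
  set F := raise (Tvar p k) with hF
  -- all summands but the last are visibly polynomial in `y`; for the last see `geomY_add_raise`
  have key : (Mdot P p k + Mmat P p * y₁ ^ k) * N =
      y₁ ^ k - D * idemMat α P k * S * (X * V) + W * X * (S * Vk) +
      W * X * ((S * Vk * W + idemMat α P (-1) * cMat P F) * Yh * (X * V)) := by
    rw [hMy, Mdot, Mvar, hV', hW', Matrix.mul_neg, sub_neg_eq_add]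
    exact dressed_eq hres hN' hYS hSY hyW hWX
  rw [key]
  have nX : NonnegMat P X := nonnegMat_Xhat p
  have nV : NonnegMat P V := nonnegMat_colE _
  have nW : NonnegMat P W := nonnegMat_rowE _
  have nD : NonnegMat P D := nonnegMat_cMat _
  have nC : NonnegMat P C := nonnegMat_cMat _
  have nS : NonnegMat P S := nonnegMat_geomY p k
  have nY : NonnegMat P Y := nonnegMat_cMat _
  have nVk : NonnegMat P Vk := (nonnegMat_idemMat _).mul nC
  rw [sub_eq_add_neg]
  refine (((nonnegMat_scal_y.pow k).add (((nD.mul (nonnegMat_idemMat _)).mul nS).mul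
    (nX.mul nV)).neg).add ((nW.mul nX).mul (nS.mul nVk))).add ((nW.mul nX).mul
      (NonnegMat.mul ?_ (nX.mul nV)))
  rw [geomY_add_raise, Matrix.neg_mul, Finset.sum_mul]
  refine (NonnegMat.sum fun i _ => ?_).neg
  rw [Matrix.mul_assoc, pow_sub_mul_Yhat]
  exact ((nY.pow i).mul (((nonnegMat_idemMat _).mul (nC.mul nD)).mul (nonnegMat_idemMat _))).mul
    (nonnegMat_geomY _ _)

end Quiver

/-! ### Differentiable curves of polynomials and of rational functions -/

/-- Derivatives, coefficient by coefficient, of curves of polynomials of bounded degree. -/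
structure PolyHasDerivAt (p : ℂ → ℂ[X]) (p' : ℂ[X]) (t : ℂ) : Prop where
  bdd : ∃ d : ℕ, ∀ z, (p z).natDegree ≤ d
  coeff : ∀ n, HasDerivAt (fun z => (p z).coeff n) (p'.coeff n) t

namespace PolyHasDerivAt
variable {p q : ℂ → ℂ[X]} {p' q' : ℂ[X]} {t : ℂ}

lemma const (p : ℂ[X]) (t : ℂ) : PolyHasDerivAt (fun _ => p) 0 t :=
  ⟨⟨_, fun _ => le_rfl⟩, fun n => by simpa using hasDerivAt_const t (p.coeff n)⟩

lemma add (hp : PolyHasDerivAt p p' t) (hq : PolyHasDerivAt q q' t) :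
    PolyHasDerivAt (fun z => p z + q z) (p' + q') t := by
  obtain ⟨a, ha⟩ := hp.bdd
  obtain ⟨b, hb⟩ := hq.bdd
  refine ⟨⟨max a b, fun z => natDegree_add_le_of_le (ha z) (hb z)⟩, fun n => ?_⟩
  simpa only [coeff_add] using (hp.coeff n).fun_add (hq.coeff n)

lemma mul (hp : PolyHasDerivAt p p' t) (hq : PolyHasDerivAt q q' t) :
    PolyHasDerivAt (fun z => p z * q z) (p' * q t + p t * q') t := by
  obtain ⟨a, ha⟩ := hp.bdd
  obtain ⟨b, hb⟩ := hq.bdd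
  refine ⟨⟨a + b, fun z => natDegree_mul_le_of_le (ha z) (hb z)⟩, fun n => ?_⟩
  simp only [coeff_add, coeff_mul, ← Finset.sum_add_distrib]
  exact HasDerivAt.fun_sum fun i _ => (hp.coeff i.1).fun_mul (hq.coeff i.2)

lemma neg (hp : PolyHasDerivAt p p' t) : PolyHasDerivAt (fun z => -p z) (-p') t := by
  obtain ⟨a, ha⟩ := hp.bdd
  refine ⟨⟨a, fun z => by rw [natDegree_neg]; exact ha z⟩, fun n => ?_⟩
  simpa only [coeff_neg] using (hp.coeff n).fun_neg

lemma sub (hp : PolyHasDerivAt p p' t) (hq : PolyHasDerivAt q q' t) :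
    PolyHasDerivAt (fun z => p z - q z) (p' - q') t := by
  simpa only [sub_eq_add_neg] using hp.add hq.neg

lemma derivative (hp : PolyHasDerivAt p p' t) :
    PolyHasDerivAt (fun z => (p z).derivative) p'.derivative t := by
  obtain ⟨a, ha⟩ := hp.bdd
  refine ⟨⟨a, fun z => (natDegree_derivative_le _).trans ((Nat.sub_le _ _).trans (ha z))⟩,
    fun n => ?_⟩
  simpa only [coeff_derivative] using (hp.coeff (n + 1)).mul_const ((n : ℂ) + 1)

lemma dilate (hp : PolyHasDerivAt p p' t) (a : ℂ) :
    PolyHasDerivAt (fun z => (p z).comp (C a * X)) (p'.comp (C a * X)) t := by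
  obtain ⟨d, hd⟩ := hp.bdd
  refine ⟨⟨d, fun z => natDegree_comp_le.trans ?_⟩, fun n => ?_⟩
  · have : (C a * X : ℂ[X]).natDegree ≤ 1 :=
      (natDegree_C_mul_le a X).trans natDegree_X_le
    nlinarith [hd z]
  · simpa only [comp_C_mul_X_coeff] using (hp.coeff n).mul_const (a ^ n)

lemma eventually_ne (hp : PolyHasDerivAt p p' t) (h : p t ≠ 0) : ∀ᶠ z in 𝓝 t, p z ≠ 0 := by
  obtain ⟨n, hn⟩ : ∃ n, (p t).coeff n ≠ 0 := by
    by_contra! hc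
    exact h (Polynomial.ext hc)
  filter_upwards [(hp.coeff n).continuousAt.eventually_ne hn] with z hz hz'
  exact hz (by rw [hz', coeff_zero])

end PolyHasDerivAt

section Rat

local notation "φ" => algebraMap ℂ[X] (RatFunc ℂ)

lemma PolyHasDerivAt.ratHasDerivAt {p q : ℂ → ℂ[X]} {p' q' : ℂ[X]} {t : ℂ} {f : ℂ → RatFunc ℂ}
    {f' : RatFunc ℂ} (hp : PolyHasDerivAt p p' t) (hq : PolyHasDerivAt q q' t) (h0 : q t ≠ 0)
    (hf : ∀ᶠ z in 𝓝 t, f z = φ (p z) / φ (q z))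
    (hf' : f' = φ (p' * q t - p t * q') / φ (q t ^ 2)) : RatHasDerivAt f f' t := by
  obtain ⟨a, ha⟩ := hp.bdd
  obtain ⟨b, hb⟩ := hq.bdd
  exact ⟨max a b, p, q, p', q', fun z => ⟨(ha z).trans (le_max_left _ _),
    (hb z).trans (le_max_right _ _)⟩, hp.coeff, hq.coeff, h0, hf, hf'⟩

namespace RatHasDerivAt
variable {f g : ℂ → RatFunc ℂ} {f' g' : RatFunc ℂ} {t : ℂ}

lemma elim (h : RatHasDerivAt f f' t) : ∃ (p q : ℂ → ℂ[X]) (p' q' : ℂ[X]),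
    PolyHasDerivAt p p' t ∧ PolyHasDerivAt q q' t ∧ q t ≠ 0 ∧
    (∀ᶠ z in 𝓝 t, q z ≠ 0) ∧ (∀ᶠ z in 𝓝 t, f z = φ (p z) / φ (q z)) ∧
    f' = φ (p' * q t - p t * q') / φ (q t ^ 2) := by
  obtain ⟨d, p, q, p', q', hd, hp, hq, h0, hf, hf'⟩ := h
  have hq' : PolyHasDerivAt q q' t := ⟨⟨d, fun z => (hd z).2⟩, hq⟩
  exact ⟨p, q, p', q', ⟨⟨d, fun z => (hd z).1⟩, hp⟩, hq', h0, hq'.eventually_ne h0, hf, hf'⟩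

lemma const (f : RatFunc ℂ) (t : ℂ) : RatHasDerivAt (fun _ => f) 0 t :=
  (PolyHasDerivAt.const f.num t).ratHasDerivAt (PolyHasDerivAt.const f.denom t) f.denom_ne_zero
    (Eventually.of_forall fun _ => (RatFunc.num_div_denom f).symm) (by simp)

lemma add (hf : RatHasDerivAt f f' t) (hg : RatHasDerivAt g g' t) :
    RatHasDerivAt (fun z => f z + g z) (f' + g') t := by
  obtain ⟨p, q, p', q', hp, hq, h0, hne, hf₁, rfl⟩ := hf.elim
  obtain ⟨r, s, r', s', hr, hs, h0', hne', hg₁, rfl⟩ := hg.elim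
  refine ((hp.mul hs).add (hq.mul hr)).ratHasDerivAt (hq.mul hs) (mul_ne_zero h0 h0') ?_ ?_
  · filter_upwards [hne, hne', hf₁, hg₁] with z h1 h2 h3 h4
    rw [h3, h4, div_add_div _ _ (algebraMap_poly_ne_zero h1) (algebraMap_poly_ne_zero h2)]
    simp only [map_add, map_mul]
  · have h1 := algebraMap_poly_ne_zero h0
    have h2 := algebraMap_poly_ne_zero h0'
    simp only [map_add, map_mul, map_sub, map_pow]
    field_simp
    ring

lemma mul (hf : RatHasDerivAt f f' t) (hg : RatHasDerivAt g g' t) :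
    RatHasDerivAt (fun z => f z * g z) (f' * g t + f t * g') t := by
  obtain ⟨p, q, p', q', hp, hq, h0, hne, hf₁, rfl⟩ := hf.elim
  obtain ⟨r, s, r', s', hr, hs, h0', hne', hg₁, rfl⟩ := hg.elim
  refine (hp.mul hr).ratHasDerivAt (hq.mul hs) (mul_ne_zero h0 h0') ?_ ?_
  · filter_upwards [hf₁, hg₁] with z h3 h4
    rw [h3, h4, div_mul_div_comm, map_mul, map_mul]
  · have h1 := algebraMap_poly_ne_zero h0
    have h2 := algebraMap_poly_ne_zero h0'
    rw [hf₁.self_of_nhds, hg₁.self_of_nhds]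
    simp only [map_add, map_mul, map_sub, map_pow]
    field_simp
    ring

lemma sum {ι : Type*} {s : Finset ι} {f : ι → ℂ → RatFunc ℂ} {f' : ι → RatFunc ℂ}
    (h : ∀ i ∈ s, RatHasDerivAt (f i) (f' i) t) :
    RatHasDerivAt (fun z => ∑ i ∈ s, f i z) (∑ i ∈ s, f' i) t := by
  classical
  induction s using Finset.induction_on with
  | empty => simpa using const 0 t
  | insert a s ha ih =>
    simp only [Finset.sum_insert ha]
    exact (h a (Finset.mem_insert_self _ _)).add
      (ih fun i hi => h i (Finset.mem_insert_of_mem hi))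

lemma const_mul (hf : RatHasDerivAt f f' t) (c : RatFunc ℂ) :
    RatHasDerivAt (fun z => c * f z) (c * f') t := by
  simpa using (const c t).mul hf

lemma neg (hf : RatHasDerivAt f f' t) : RatHasDerivAt (fun z => -f z) (-f') t := by
  simpa using hf.const_mul (-1)

lemma dilate (hf : RatHasDerivAt f f' t) (a : ℂˣ) :
    RatHasDerivAt (fun z => dilate a (f z)) (CMKP.dilate a f') t := by
  obtain ⟨p, q, p', q', hp, hq, h0, hne, hf₁, rfl⟩ := hf.elim
  have hc : ∀ {r : ℂ[X]}, r ≠ 0 → r.comp (C (a : ℂ) * X) ≠ 0 := fun hr h =>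
    hr ((comp_C_mul_X_eq_zero_iff (mem_nonZeroDivisors_iff_ne_zero.2 a.ne_zero)).1 h)
  refine (hp.dilate (a : ℂ)).ratHasDerivAt (hq.dilate (a : ℂ)) (hc h0) ?_ ?_
  · filter_upwards [hf₁] with z h3
    rw [h3, dilate_div]
  · rw [dilate_div]
    simp only [sub_comp, mul_comp, pow_comp]

lemma dRat (hf : RatHasDerivAt f f' t) : RatHasDerivAt (fun z => dRat (f z)) (CMKP.dRat f') t := by
  obtain ⟨p, q, p', q', hp, hq, h0, hne, hf₁, rfl⟩ := hf.elim
  refine ((hp.derivative.mul hq).sub (hp.mul hq.derivative)).ratHasDerivAt (hq.mul hq)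
    (mul_ne_zero h0 h0) ?_ ?_
  · filter_upwards [hf₁, hne] with z h3 h4
    rw [h3, dRat_div _ _ h4, pow_two]
  · rw [dRat_div _ _ (pow_ne_zero 2 h0)]
    refine congrArg₂ (fun a b => φ a / φ b) ?_ ?_
    · simp only [pow_two, derivative_mul, derivative_sub]
      ring
    · ring

end RatHasDerivAt

end Rat

/-! ### Differentiable curves in the crossed product -/

section Cross
variable {m : ℕ} [NeZero m]

instance : Fintype (Gam m) :=
  have : Finite (Gam m) := inferInstanceAs (Finite (rootsOfUnity m ℂ))
  Fintype.ofFinite _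

lemma mapCoeff_coeff (ψ : Gam m → RatFunc ℂ →+ RatFunc ℂ) (f : Cross m) (g : Gam m) :
    (mapCoeff ψ f).coeff g = ψ g (f.coeff g) := by
  classical
  induction f using Cross.induction with
  | h0 => simp
  | h2 f₁ f₂ h h' => simp [h, h']
  | h1 g a =>
    rw [mapCoeff_single, SkewMonoidAlgebra.coeff_single_apply, SkewMonoidAlgebra.coeff_single_apply]
    split_ifs with h
    · rw [h]
    · rw [map_zero]

lemma cross_mul_coeff (f f' : Cross m) (g : Gam m) :
    (f * f').coeff g = ∑ h : Gam m, f.coeff h * dilate (h.val)⁻¹ (f'.coeff (h⁻¹ * g)) := by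
  classical
  induction f using Cross.induction with
  | h0 => simp
  | h2 f₁ f₂ h h' =>
    simp [add_mul, h, h', Finset.sum_add_distrib]
  | h1 k a => ?_
  induction f' using Cross.induction with
  | h0 => simp
  | h2 f₁ f₂ h h' => simp [mul_add, h, h', Finset.sum_add_distrib]
  | h1 k' a' => ?_
  rw [SkewMonoidAlgebra.single_mul_single, Finset.sum_eq_single k]
  · simp only [SkewMonoidAlgebra.coeff_single_apply, if_true, Gam.smul_def]
    have : (k * k' = g) ↔ (k' = k⁻¹ * g) := by
      rw [eq_inv_mul_iff_mul_eq]
    simp only [this, apply_ite (dilate _), map_zero, mul_ite, mul_zero]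
  · intro h _ hk
    rw [SkewMonoidAlgebra.coeff_single_apply, if_neg (Ne.symm hk), zero_mul]
  · intro h; exact absurd (Finset.mem_univ _) h

/-- Derivative of a curve in the crossed product, taken componentwise. -/
def CrossHasDerivAt (f : ℂ → Cross m) (f' : Cross m) (t : ℂ) : Prop :=
  ∀ g : Gam m, RatHasDerivAt (fun z => (f z).coeff g) (f'.coeff g) t

namespace CrossHasDerivAt
variable {f h : ℂ → Cross m} {f' h' : Cross m} {t : ℂ}

omit [NeZero m] in
lemma const (f : Cross m) (t : ℂ) : CrossHasDerivAt (fun _ => f) 0 t :=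
  fun g => RatHasDerivAt.const (f.coeff g) t

omit [NeZero m] in
lemma add (hf : CrossHasDerivAt f f' t) (hh : CrossHasDerivAt h h' t) :
    CrossHasDerivAt (fun z => f z + h z) (f' + h') t := fun g => by
  simpa only [SkewMonoidAlgebra.coeff_add, Finsupp.add_apply] using (hf g).add (hh g)

lemma mul (hf : CrossHasDerivAt f f' t) (hh : CrossHasDerivAt h h' t) :
    CrossHasDerivAt (fun z => f z * h z) (f' * h t + f t * h') t := fun g => by
  simp only [SkewMonoidAlgebra.coeff_add, Finsupp.add_apply, cross_mul_coeff,
    ← Finset.sum_add_distrib]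
  exact RatHasDerivAt.sum fun k _ => (hf k).mul ((hh (k⁻¹ * g)).dilate _)

omit [NeZero m] in
lemma sum {ι : Type*} {s : Finset ι} {f : ι → ℂ → Cross m} {f' : ι → Cross m}
    (hf : ∀ i ∈ s, CrossHasDerivAt (f i) (f' i) t) :
    CrossHasDerivAt (fun z => ∑ i ∈ s, f i z) (∑ i ∈ s, f' i) t := by
  classical
  induction s using Finset.induction_on with
  | empty => simpa using const 0 t
  | insert a s ha ih =>
    simp only [Finset.sum_insert ha]
    exact (hf a (Finset.mem_insert_self _ _)).add
      (ih fun i hi => hf i (Finset.mem_insert_of_mem hi))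

lemma const_mul (hf : CrossHasDerivAt f f' t) (c : Cross m) :
    CrossHasDerivAt (fun z => c * f z) (c * f') t := by
  simpa using (const c t).mul hf

lemma mul_const (hf : CrossHasDerivAt f f' t) (c : Cross m) :
    CrossHasDerivAt (fun z => f z * c) (f' * c) t := by
  simpa using hf.mul (const c t)

lemma neg (hf : CrossHasDerivAt f f' t) : CrossHasDerivAt (fun z => -f z) (-f') t :=
  fun g => (hf g).neg

lemma sub (hf : CrossHasDerivAt f f' t) (hh : CrossHasDerivAt h h' t) :
    CrossHasDerivAt (fun z => f z - h z) (f' - h') t := by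
  simpa only [sub_eq_add_neg] using hf.add hh.neg

lemma twistHom (hf : CrossHasDerivAt f f' t) (χ : Gam m →* ℂˣ) :
    CrossHasDerivAt (fun z => twistHom χ (f z)) (CMKP.twistHom χ f') t := fun g => by
  simp only [CMKP.twistHom, mapCoeff_coeff]
  exact (hf g).const_mul _

lemma dCross (hf : CrossHasDerivAt f f' t) :
    CrossHasDerivAt (fun z => dCross m (f z)) (CMKP.dCross m f') t := fun g => by
  simp only [CMKP.dCross, mapCoeff_coeff]
  exact (hf g).dRat

variable {P : Param m}

lemma skew_σ (hf : CrossHasDerivAt f f' t) :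
    CrossHasDerivAt (fun z => P.skew.σ (f z)) (P.skew.σ f') t := hf.twistHom _

lemma skew_σ_symm (hf : CrossHasDerivAt f f' t) :
    CrossHasDerivAt (fun z => P.skew.σ.symm (f z)) (P.skew.σ.symm f') t := hf.twistHom _

lemma skew_δ (hf : CrossHasDerivAt f f' t) :
    CrossHasDerivAt (fun z => P.skew.δ (f z)) (P.skew.δ f') t :=
  (hf.dCross.const_mul _).sub (((hf.const_mul _).sub (hf.mul_const _)).const_mul _)

lemma up (hf : CrossHasDerivAt f f' t) (n p : ℕ) :
    CrossHasDerivAt (fun z => P.skew.up n p (f z)) (P.skew.up n p f') t := by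
  induction n generalizing p with
  | zero =>
    cases p with
    | zero => exact hf
    | succ p => exact const 0 t
  | succ n ih =>
    cases p with
    | zero => exact (ih 0).skew_σ
    | succ p => exact (ih (p + 1)).skew_σ.add (ih p).skew_δ

lemma down (hf : CrossHasDerivAt f f' t) (n p : ℕ) :
    CrossHasDerivAt (fun z => P.skew.down n p (f z)) (P.skew.down n p f') t := by
  induction n generalizing p with
  | zero =>
    cases p with
    | zero => simpa only [SkewDer.down] using hf
    | succ p => simpa only [SkewDer.down] using const 0 t
  | succ n ih =>
    induction p with
    | zero => simpa only [SkewDer.down] using (ih 0).skew_σ_symm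
    | succ p ihp => simpa only [SkewDer.down] using ((ih (p + 1)).sub ihp.skew_δ).skew_σ_symm

lemma comm (hf : CrossHasDerivAt f f' t) (i : ℤ) (p : ℕ) :
    CrossHasDerivAt (fun z => P.skew.comm i p (f z)) (P.skew.comm i p f') t := by
  cases i with
  | ofNat n => exact hf.up n p
  | negSucc n => exact hf.down (n + 1) p

end CrossHasDerivAt

/-! ### Differentiable curves in `𝒫` -/

namespace PsdHasDerivAt
variable {P : Param m} {u v : ℂ → P.Psd} {u' v' : P.Psd} {t : ℂ}

/-- Leibniz rule for one coefficient of a product, needing only the coefficients of the second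
factor that enter. -/
lemma mul_coeff {a b : ℤ} (hu : PsdHasDerivAt u u' t) (hua : ∀ z, (u z).DegLE a)
    (hua' : u'.DegLE a) (hvb : ∀ z, (v z).DegLE b) (hvb' : v'.DegLE b) (n : ℤ)
    (hv : ∀ j, n - a ≤ j → CrossHasDerivAt (fun z => (v z).coeff j) (v'.coeff j) t) :
    CrossHasDerivAt (fun z => (u z * v z).coeff n) ((u' * v t + u t * v').coeff n) t := by
  have hE : ∀ i ∈ Finset.Icc (n - b) (0 + a),
      CrossHasDerivAt (fun z => PDO.E (v z) i n) (PDO.E v' i n) t := fun i hi => by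
    have hi := (Finset.mem_Icc.1 hi).2
    obtain ⟨K, hK⟩ : ∃ K : ℕ, b < n - i + K := ⟨(b - (n - i)).toNat + 1, by omega⟩
    simp only [PDO.E_eq_sum _ (hvb _) i n K hK, PDO.E_eq_sum _ hvb' i n K hK]
    exact CrossHasDerivAt.sum fun p _ => (hv _ (by omega)).comm i p
  have hm : ∀ x y : P.Psd, x.DegLE a → y.DegLE b →
      (x * y).coeff n = ∑ i ∈ Finset.Icc (n - b) (0 + a), x.coeff i * PDO.E y i n :=
    fun x y hx hy => by
      rw [PDO.mul_coeff, PDO.mm_eq_sum hx.E hy.E 0 n _ _ le_rfl le_rfl]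
      simp only [PDO.E_zero]
  rw [PDO.add_coeff, hm _ _ hua' (hvb t), hm _ _ (hua t) hvb', ← Finset.sum_add_distrib]
  simp only [hm _ _ (hua _) (hvb _)]
  exact CrossHasDerivAt.sum fun i hi => CrossHasDerivAt.mul (hu i) (hE i hi)

lemma const (u : P.Psd) (t : ℂ) : PsdHasDerivAt (fun _ => u) 0 t :=
  fun n => CrossHasDerivAt.const (u.coeff n) t

lemma add (hu : PsdHasDerivAt u u' t) (hv : PsdHasDerivAt v v' t) :
    PsdHasDerivAt (fun z => u z + v z) (u' + v') t :=
  fun n => CrossHasDerivAt.add (hu n) (hv n)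

lemma sum {ι : Type*} {s : Finset ι} {f : ι → ℂ → P.Psd} {f' : ι → P.Psd}
    (hf : ∀ i ∈ s, PsdHasDerivAt (f i) (f' i) t) :
    PsdHasDerivAt (fun z => ∑ i ∈ s, f i z) (∑ i ∈ s, f' i) t := fun n => by
  have := CrossHasDerivAt.sum fun i hi => (fun g => hf i hi n g :
    CrossHasDerivAt (fun z => (f i z).coeff n) ((f' i).coeff n) t)
  simp only [PDO.sum_coeff]
  exact this

lemma neg (hu : PsdHasDerivAt u u' t) : PsdHasDerivAt (fun z => -u z) (-u') t :=
  fun n => CrossHasDerivAt.neg (hu n)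

lemma mul {a b : ℤ} (hu : PsdHasDerivAt u u' t) (hv : PsdHasDerivAt v v' t)
    (hua : ∀ z, (u z).DegLE a) (hvb : ∀ z, (v z).DegLE b) :
    PsdHasDerivAt (fun z => u z * v z) (u' * v t + u t * v') t := fun n => by
  -- The derivatives are series as well; a common bound for the degrees is all that is needed.
  obtain ⟨c, hc⟩ := u'.bdd
  obtain ⟨d, hd⟩ := v'.bdd
  exact mul_coeff hu (fun z => (hua z).mono (le_max_left a c))
    (PDO.DegLE.mono hc (le_max_right a c)) (fun z => (hvb z).mono (le_max_left b d))
    (PDO.DegLE.mono hd (le_max_right b d)) n fun j _ => hv j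

/-- The derivative of the inverse of a curve in `1 + 𝒫_-`: the coefficients of the inverse are
determined recursively, from the top, by `N = 1 - (M - 1) N`. -/
lemma inv {M N : ℂ → P.Psd} {M' : P.Psd} (hM : PsdHasDerivAt M M' t)
    (hM1 : ∀ z, (M z - 1).DegLE (-1)) (hM' : M'.DegLE (-1)) (hN : ∀ z, (N z - 1).DegLE (-1))
    (hMN : ∀ z, M z * N z = 1) : PsdHasDerivAt N (-(N t * M' * N t)) t := by
  set N' := -(N t * M' * N t) with hN'
  have one0 : (1 : P.Psd).DegLE 0 := PDO.degLE_monomial 0 1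
  have hN0 : ∀ z, (N z).DegLE 0 := fun z => by
    have := (PDO.DegLE.mono (hN z) (by norm_num : (-1 : ℤ) ≤ 0)).add one0
    rwa [sub_add_cancel] at this
  have hN'1 : N'.DegLE (-1) := (((hN0 t).mul hM').mul (hN0 t)).neg
  have hu : PsdHasDerivAt (fun z => M z - 1) M' t := by
    simpa only [sub_eq_add_neg, add_zero] using hM.add (const (-1) t)
  have hrec : ∀ z, N z = 1 - (M z - 1) * N z := fun z => by
    rw [sub_mul, hMN, one_mul, sub_sub_cancel]
  have hrec' : N' = -(M' * N t + (M t - 1) * N') := by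
    have : M t * N' = -(M' * N t) := by
      rw [hN', mul_neg, ← mul_assoc, ← mul_assoc, hMN, one_mul]
    rw [sub_mul, this, one_mul]
    abel
  -- since `M - 1` has negative degree, `hrec` expresses each coefficient of `N` by higher ones
  have step : ∀ k : ℕ, ∀ n : ℤ, 1 - (k : ℤ) ≤ n →
      CrossHasDerivAt (fun z => (N z).coeff n) (N'.coeff n) t := by
    intro k
    induction k with
    | zero =>
      intro n hn
      have h1 : ∀ z, (N z).coeff n = 0 := fun z => hN0 z n (by push_cast at hn; omega)
      simp only [h1, hN'1 n (by push_cast at hn; omega)]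
      exact CrossHasDerivAt.const 0 t
    | succ k ih =>
      intro n hn
      have h := mul_coeff hu hM1 hM' hN0 (PDO.DegLE.mono hN'1 (by norm_num)) n
        fun j hj => ih j (by push_cast at hn; omega)
      have h2 := (CrossHasDerivAt.const ((1 : P.Psd).coeff n) t).sub h
      rw [zero_sub, ← PDO.neg_coeff, ← hrec'] at h2
      have h3 : (fun z => (N z).coeff n) =
          fun z => (1 : P.Psd).coeff n - ((M z - 1) * N z).coeff n := funext fun z => by
        conv_lhs => rw [hrec z, PDO.sub_coeff]
      rw [h3]
      exact h2
  exact fun n => step (1 - n).toNat n (by omega)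

/-- The curve `M u M⁻¹` moves by the commutator with `M' M⁻¹`. -/
lemma conj {M N : ℂ → P.Psd} {M' : P.Psd} (w : P.Psd) (hM : PsdHasDerivAt M M' t)
    (hM1 : ∀ z, (M z - 1).DegLE (-1)) (hM' : M'.DegLE (-1)) (hN : ∀ z, (N z - 1).DegLE (-1))
    (hMN : ∀ z, M z * N z = 1) (hNM : N t * M t = 1) :
    PsdHasDerivAt (fun z => M z * w * N z)
      (M' * N t * (M t * w * N t) - M t * w * N t * (M' * N t)) t := by
  have one0 : (1 : P.Psd).DegLE 0 := PDO.degLE_monomial 0 1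
  have h0 : ∀ {v : P.Psd}, (v - 1).DegLE (-1) → v.DegLE 0 := fun {v} hv => by
    have := (PDO.DegLE.mono hv (by norm_num : (-1 : ℤ) ≤ 0)).add one0
    rwa [sub_add_cancel] at this
  obtain ⟨d, hd⟩ := w.bdd
  have h1 := hM.mul (const w t) (fun z => h0 (hM1 z)) (fun _ => hd)
  have h2 := h1.mul (hM.inv hM1 hM' hN hMN) (fun z => (h0 (hM1 z)).mul hd) (fun z => h0 (hN z))
  have e : M' * N t * (M t * w * N t) - M t * w * N t * (M' * N t) =
      (M' * w + M t * 0) * N t + M t * w * -(N t * M' * N t) := by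
    have : M' * N t * (M t * w * N t) = M' * (N t * M t) * w * N t := by
      simp only [mul_assoc]
    rw [this, hNM]
    noncomm_ring
  rw [e]
  exact h2

end PsdHasDerivAt
end Cross

/-! ### Derivations and matrices -/

section TwistedDerivation
variable {A B I J K : Type*} [CommRing A] [CommRing B] [Fintype J]

/-- An additive map `δ` with `δ(ab) = δ(a) φ(b) + φ(a) δ(b)` for a ring homomorphism `φ`. -/
structure TwistedDer (φ : A →+* B) where
  toHom : A →+ B
  leibniz : ∀ a b, toHom (a * b) = toHom a * φ b + φ a * toHom b

variable {φ : A →+* B} (δ : TwistedDer φ)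

lemma TwistedDer.map_one : δ.toHom 1 = 0 := by
  simpa using δ.leibniz 1 1

lemma TwistedDer.matrix_mul (S : Matrix I J A) (T : Matrix J K A) :
    (S * T).map δ.toHom = S.map δ.toHom * T.map φ + S.map φ * T.map δ.toHom := by
  ext r c
  simp only [Matrix.map_apply, Matrix.mul_apply, Matrix.add_apply, map_sum, δ.leibniz,
    Finset.sum_add_distrib]

lemma TwistedDer.matrix_one [DecidableEq I] : (1 : Matrix I I A).map δ.toHom = 0 := by
  ext r c
  simp only [Matrix.map_apply, Matrix.one_apply, Matrix.zero_apply]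
  split_ifs
  · exact δ.map_one
  · exact map_zero _

lemma TwistedDer.matrix_pow [DecidableEq J] (S : Matrix J J A) (k : ℕ) :
    (S ^ k).map δ.toHom =
      ∑ i ∈ Finset.range k, S.map φ ^ (k - 1 - i) * S.map δ.toHom * S.map φ ^ i := by
  induction k with
  | zero => simpa using δ.matrix_one
  | succ k ih =>
    have e : ∀ n : ℕ, (S ^ n).map φ = S.map φ ^ n := fun n => map_pow φ.mapMatrix S n
    rw [pow_succ, δ.matrix_mul, ih, e, Finset.sum_range_succ', Finset.sum_mul]
    congr 1
    · refine Finset.sum_congr rfl fun i _ => ?_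
      rw [pow_succ, show k + 1 - 1 - (i + 1) = k - 1 - i by omega]
      simp only [Matrix.mul_assoc]
    · simp

end TwistedDerivation

/-! ### Hamiltonian vector fields -/

section Quiver
variable {m : ℕ} [NeZero m] {α : ZMod m → ℕ}

open MvPolynomial in
/-- The Hamiltonian derivation `F ↦ {F, G}`. -/
def hamDer (G : MvPolynomial (Coord α) ℂ) :
    Derivation ℂ (MvPolynomial (Coord α) ℂ) (MvPolynomial (Coord α) ℂ) :=
  (∑ a : Idx α, ∑ b : Idx α, if h : a.1 = b.1 + 1 then
      pderiv (.Y b a h) G • pderiv (.X a b h) - pderiv (.X a b h) G • pderiv (.Y b a h)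
    else 0) +
  ∑ a : Idx α, (pderiv (.w a) G • pderiv (.v a) - pderiv (.v a) G • pderiv (.w a))

lemma hamDer_apply (F G : MvPolynomial (Coord α) ℂ) : hamDer G F = poisson F G := by
  have hs : ∀ {ι : Type} (s : Finset ι)
      (D : ι → Derivation ℂ (MvPolynomial (Coord α) ℂ) (MvPolynomial (Coord α) ℂ)),
      (∑ i ∈ s, D i) F = ∑ i ∈ s, D i F := fun s D => by
    rw [← Derivation.coeFnAddMonoidHom_apply, map_sum, Finset.sum_apply]; rfl
  rw [hamDer, poisson, Derivation.add_apply, hs, hs]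
  refine congrArg₂ (· + ·) (Finset.sum_congr rfl fun a _ => ?_)
    (Finset.sum_congr rfl fun a _ => ?_)
  · rw [hs]
    refine Finset.sum_congr rfl fun b _ => ?_
    split_ifs with h
    · rw [Derivation.sub_apply, Derivation.smul_apply, Derivation.smul_apply, smul_eq_mul,
        smul_eq_mul, mul_comm, mul_comm (MvPolynomial.pderiv (.X a b h) G)]
    · exact Derivation.zero_apply _
  · rw [Derivation.sub_apply, Derivation.smul_apply, Derivation.smul_apply, smul_eq_mul,
      smul_eq_mul, mul_comm, mul_comm (MvPolynomial.pderiv (.v a) G)]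

section Coordinates
variable (G : MvPolynomial (Coord α) ℂ)

lemma poisson_X (a b : Idx α) (h : a.1 = b.1 + 1) :
    poisson (MvPolynomial.X (.X a b h)) G = MvPolynomial.pderiv (.Y b a h) G := by
  classical
  rw [poisson, Finset.sum_eq_single a, Finset.sum_eq_single b]
  · simp [h, MvPolynomial.pderiv_X]
  · intro b' _ hb
    split_ifs with h'
    · simp [MvPolynomial.pderiv_X, Ne.symm hb]
    · rfl
  · simp
  · intro a' _ ha
    refine Finset.sum_eq_zero fun b' _ => ?_
    split_ifs with h'
    · simp [MvPolynomial.pderiv_X, Ne.symm ha]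
    · rfl
  · simp

lemma poisson_Y (a b : Idx α) (h : a.1 = b.1 + 1) :
    poisson (MvPolynomial.X (.Y b a h)) G = -MvPolynomial.pderiv (.X a b h) G := by
  classical
  rw [poisson, Finset.sum_eq_single a, Finset.sum_eq_single b]
  · simp [h, MvPolynomial.pderiv_X]
  · intro b' _ hb
    split_ifs with h'
    · simp [MvPolynomial.pderiv_X, Ne.symm hb]
    · rfl
  · simp
  · intro a' _ ha
    refine Finset.sum_eq_zero fun b' _ => ?_
    split_ifs with h'
    · simp [MvPolynomial.pderiv_X, Ne.symm ha]
    · rfl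
  · simp

lemma poisson_v (a : Idx α) :
    poisson (MvPolynomial.X (.v a)) G = MvPolynomial.pderiv (.w a) G := by
  classical
  rw [poisson, Finset.sum_eq_zero, Finset.sum_eq_single a]
  · simp [MvPolynomial.pderiv_X]
  · intro a' _ ha; simp [MvPolynomial.pderiv_X, Ne.symm ha]
  · simp
  · intro a _
    refine Finset.sum_eq_zero fun b _ => ?_
    split_ifs
    · simp [MvPolynomial.pderiv_X]
    · rfl

lemma poisson_w (a : Idx α) :
    poisson (MvPolynomial.X (.w a)) G = -MvPolynomial.pderiv (.v a) G := by
  classical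
  rw [poisson, Finset.sum_eq_zero, Finset.sum_eq_single a]
  · simp [MvPolynomial.pderiv_X]
  · intro a' _ ha; simp [MvPolynomial.pderiv_X, Ne.symm ha]
  · simp
  · intro a _
    refine Finset.sum_eq_zero fun b _ => ?_
    split_ifs
    · simp [MvPolynomial.pderiv_X]
    · rfl

end Coordinates

variable (α) in
/-- The coordinate functions. -/
abbrev gen : Coord α → MvPolynomial (Coord α) ℂ := MvPolynomial.X

section Map
variable {R S : Type*} [CommRing R] [CommRing S] {F : Type*} [FunLike F R S]
  [AddMonoidHomClass F R S]

lemma Xmat_map (f : F) (p : Coord α → R) : (Xmat p).map f = Xmat fun c => f (p c) := by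
  ext r c
  simp only [Matrix.map_apply, Xmat]
  split_ifs
  · rfl
  · exact map_zero f

lemma Ymat_map (f : F) (p : Coord α → R) : (Ymat p).map f = Ymat fun c => f (p c) := by
  ext r c
  simp only [Matrix.map_apply, Ymat]
  split_ifs
  · rfl
  · exact map_zero f

end Map

/-- A derivation of the polynomial ring followed by evaluation at a point. -/
def evalDer (D : Derivation ℂ (MvPolynomial (Coord α) ℂ) (MvPolynomial (Coord α) ℂ))
    (p : Coord α → ℂ) : TwistedDer (MvPolynomial.eval p) where
  toHom := (MvPolynomial.eval p : MvPolynomial (Coord α) ℂ →+ ℂ).comp D.toLinearMap.toAddMonoidHom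
  leibniz a b := by
    change MvPolynomial.eval p (D (a * b)) =
      MvPolynomial.eval p (D a) * _ + _ * MvPolynomial.eval p (D b)
    rw [D.leibniz, map_add, smul_eq_mul, smul_eq_mul, map_mul, map_mul]
    ring

lemma evalDer_apply (D : Derivation ℂ (MvPolynomial (Coord α) ℂ) (MvPolynomial (Coord α) ℂ))
    (p : Coord α → ℂ) (F : MvPolynomial (Coord α) ℂ) :
    (evalDer D p).toHom F = MvPolynomial.eval p (D F) := rfl

lemma Ham_eq (k : ℕ) : Ham α k = -(Matrix.replicateRow Unit (wTot (gen α)) * Ymat (gen α) ^ k *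
    Matrix.replicateCol Unit (vTot (gen α))) () () := by
  rw [Ham, Matrix.dotProduct_mulVec]
  rfl

lemma eval_Ymat (p : Coord α → ℂ) : (Ymat (gen α)).map (MvPolynomial.eval p) = Ymat p := by
  rw [Ymat_map]; simp [gen]

lemma eval_Ymat_pow (p : Coord α → ℂ) (k : ℕ) :
    (Ymat (gen α) ^ k).map (MvPolynomial.eval p) = Ymat p ^ k := by
  rw [← eval_Ymat]; exact map_pow (MvPolynomial.eval p).mapMatrix _ k

lemma eval_Ham (p : Coord α → ℂ) (k : ℕ) :
    MvPolynomial.eval p (Ham α k) = -(wTot p ⬝ᵥ (Ymat p ^ k).mulVec (vTot p)) := by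
  rw [Ham, map_neg, ← eval_Ymat_pow]
  simp only [dotProduct, Matrix.mulVec, map_sum, map_mul, Matrix.map_apply, wTot, vTot,
    MvPolynomial.eval_X]

/-- The product rule for `H_k = -w Y ^ k v`, for an arbitrary derivation. -/
lemma eval_der_Ham (D : Derivation ℂ (MvPolynomial (Coord α) ℂ) (MvPolynomial (Coord α) ℂ))
    (p : Coord α → ℂ) (k : ℕ) :
    MvPolynomial.eval p (D (Ham α k)) =
      -((fun r => MvPolynomial.eval p (D (gen α (.w r)))) ⬝ᵥ (Ymat p ^ k).mulVec (vTot p) +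
        wTot p ⬝ᵥ (∑ i ∈ Finset.range k, Ymat p ^ (k - 1 - i) *
          (Ymat (fun c => MvPolynomial.eval p (D (gen α c)))) * Ymat p ^ i).mulVec (vTot p) +
        wTot p ⬝ᵥ (Ymat p ^ k).mulVec fun r => MvPolynomial.eval p (D (gen α (.v r)))) := by
  have h := congrFun (congrFun ((evalDer D p).matrix_mul
    (Matrix.replicateRow Unit (wTot (gen α)) * Ymat (gen α) ^ k)
    (Matrix.replicateCol Unit (vTot (gen α)))) ()) ()
  rw [Matrix.map_apply, evalDer_apply, (evalDer D p).matrix_mul (Matrix.replicateRow Unit _),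
    (evalDer D p).matrix_pow, Matrix.map_mul, eval_Ymat, eval_Ymat_pow, Ymat_map] at h
  rw [Ham_eq, map_neg, map_neg, h]
  have hv : (Matrix.replicateCol Unit (vTot (gen α))).map (MvPolynomial.eval p) =
      Matrix.replicateCol Unit (vTot p) := by ext; simp [vTot]
  have hw : (Matrix.replicateRow Unit (wTot (gen α))).map (MvPolynomial.eval p) =
      Matrix.replicateRow Unit (wTot p) := by ext; simp [wTot]
  rw [hv, hw, Matrix.add_mul]
  simp only [Matrix.dotProduct_mulVec]
  rfl

variable (p : Coord α → ℂ) (k : ℕ)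

lemma eval_pderiv_X_Ham (a b : Idx α) (h : a.1 = b.1 + 1) :
    MvPolynomial.eval p (MvPolynomial.pderiv (.X a b h) (Ham α k)) = 0 := by
  classical
  rw [eval_der_Ham]
  have hY : (Ymat fun c : Coord α =>
      MvPolynomial.eval p (MvPolynomial.pderiv (.X a b h) (gen α c))) = 0 := by
    ext r c; simp [Ymat, gen, MvPolynomial.pderiv_X]
  rw [hY]
  simp [gen, MvPolynomial.pderiv_X, dotProduct, Matrix.mulVec]

lemma eval_pderiv_w_Ham (a : Idx α) :
    MvPolynomial.eval p (MvPolynomial.pderiv (.w a) (Ham α k)) =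
      -(Ymat p ^ k).mulVec (vTot p) a := by
  classical
  rw [eval_der_Ham]
  have hY : (Ymat fun c : Coord α =>
      MvPolynomial.eval p (MvPolynomial.pderiv (.w a) (gen α c))) = 0 := by
    ext r c; simp [Ymat, gen, MvPolynomial.pderiv_X]
  have hv : (fun r : Idx α => MvPolynomial.eval p (MvPolynomial.pderiv (.w a) (gen α (.v r)))) =
      0 := by
    ext r; simp [gen, MvPolynomial.pderiv_X]
  have hw : (fun r : Idx α => MvPolynomial.eval p (MvPolynomial.pderiv (.w a) (gen α (.w r)))) =
      Pi.single a 1 := by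
    ext r; simp [gen, MvPolynomial.pderiv_X, Pi.single_apply, eq_comm]
  rw [hY, hv, hw]
  simp

lemma eval_pderiv_v_Ham (a : Idx α) :
    MvPolynomial.eval p (MvPolynomial.pderiv (.v a) (Ham α k)) =
      -Matrix.vecMul (wTot p) (Ymat p ^ k) a := by
  classical
  rw [eval_der_Ham]
  have hY : (Ymat fun c : Coord α =>
      MvPolynomial.eval p (MvPolynomial.pderiv (.v a) (gen α c))) = 0 := by
    ext r c; simp [Ymat, gen, MvPolynomial.pderiv_X]
  have hw : (fun r : Idx α => MvPolynomial.eval p (MvPolynomial.pderiv (.v a) (gen α (.w r)))) =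
      0 := by
    ext r; simp [gen, MvPolynomial.pderiv_X]
  have hv : (fun r : Idx α => MvPolynomial.eval p (MvPolynomial.pderiv (.v a) (gen α (.v r)))) =
      Pi.single a 1 := by
    ext r; simp [gen, MvPolynomial.pderiv_X, Pi.single_apply, eq_comm]
  rw [hY, hv, hw, Matrix.dotProduct_mulVec _ _ (Pi.single a 1)]
  simp

lemma eval_pderiv_Y_Ham (a b : Idx α) (h : a.1 = b.1 + 1) :
    MvPolynomial.eval p (MvPolynomial.pderiv (.Y b a h) (Ham α k)) = Tvar p k a b := by
  classical
  rw [eval_der_Ham]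
  have hY : (Ymat fun c : Coord α =>
      MvPolynomial.eval p (MvPolynomial.pderiv (.Y b a h) (gen α c))) = Matrix.single b a 1 := by
    ext r c
    rw [Matrix.single_apply, Ymat]
    split_ifs with h1 h2 h2
    · obtain ⟨rfl, rfl⟩ := h2
      simp [gen, MvPolynomial.pderiv_X]
    · have : Coord.Y r c h1 ≠ Coord.Y b a h := fun e => h2 (by cases e; exact ⟨rfl, rfl⟩)
      simp [gen, MvPolynomial.pderiv_X, this]
    · obtain ⟨rfl, rfl⟩ := h2
      exact absurd h h1
    · rfl
  have hw : (fun r : Idx α =>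
      MvPolynomial.eval p (MvPolynomial.pderiv (.Y b a h) (gen α (.w r)))) = 0 := by
    ext r; simp [gen, MvPolynomial.pderiv_X]
  have hv : (fun r : Idx α =>
      MvPolynomial.eval p (MvPolynomial.pderiv (.Y b a h) (gen α (.v r)))) = 0 := by
    ext r; simp [gen, MvPolynomial.pderiv_X]
  rw [hY, hv, hw, Tvar, Matrix.neg_apply, Matrix.sum_apply, Matrix.sum_mulVec, dotProduct_sum]
  simp only [zero_dotProduct, Matrix.mulVec_zero, dotProduct_zero, zero_add, add_zero]
  refine congrArg Neg.neg (Finset.sum_congr rfl fun i _ => ?_)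
  have e : Matrix.single b a (1 : ℂ) = Matrix.vecMulVec (Pi.single b 1) (Pi.single a 1) := by
    rw [Matrix.single_eq_single_vecMulVec_single]
  rw [e, Matrix.mul_vecMulVec, Matrix.vecMulVec_mul, Matrix.mul_vecMulVec, Matrix.vecMulVec_mul,
    Matrix.vecMulVec_apply, Matrix.vecMulVec_mulVec]
  rw [dotProduct_smul, Matrix.dotProduct_mulVec, ← Matrix.dotProduct_mulVec (Pi.single a 1)]
  simp [mul_comm]

/-- The Hamiltonian vector field of `H_k`. -/
lemma eval_hamDer_X (a b : Idx α) (h : a.1 = b.1 + 1) :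
    MvPolynomial.eval p (hamDer (Ham α k) (gen α (.X a b h))) = Tvar p k a b := by
  rw [hamDer_apply, poisson_X, eval_pderiv_Y_Ham]

lemma eval_hamDer_Y (a b : Idx α) (h : a.1 = b.1 + 1) :
    MvPolynomial.eval p (hamDer (Ham α k) (gen α (.Y b a h))) = 0 := by
  rw [hamDer_apply, poisson_Y, map_neg, eval_pderiv_X_Ham, neg_zero]

lemma eval_hamDer_v (a : Idx α) :
    MvPolynomial.eval p (hamDer (Ham α k) (gen α (.v a))) = (-(Ymat p ^ k).mulVec (vTot p)) a := by
  rw [hamDer_apply, poisson_v, eval_pderiv_w_Ham]; rfl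

lemma eval_hamDer_w (a : Idx α) :
    MvPolynomial.eval p (hamDer (Ham α k) (gen α (.w a))) =
      Matrix.vecMul (wTot p) (Ymat p ^ k) a := by
  rw [hamDer_apply, poisson_w, map_neg, eval_pderiv_v_Ham, neg_neg]

/-- The flow of `H_k` fixes `Y` and changes `w` and `v` oppositely in `w Y ^ j v`. -/
lemma poisson_Ham_Ham (j k : ℕ) : poisson (Ham α j) (Ham α k) = 0 := by
  refine MvPolynomial.funext fun p => ?_
  have hY : (Ymat fun c : Coord α => MvPolynomial.eval p (hamDer (Ham α k) (gen α c))) = 0 := by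
    ext r c
    rw [Ymat]
    split_ifs with h
    · exact eval_hamDer_Y p k c r h
    · rfl
  rw [← hamDer_apply, eval_der_Ham, hY]
  simp only [eval_hamDer_v, eval_hamDer_w]
  simp only [Matrix.mul_zero, Matrix.zero_mul, Finset.sum_const_zero, Matrix.zero_mulVec,
    dotProduct_zero, add_zero, map_zero]
  have e : (fun r => (-(Ymat p ^ k).mulVec (vTot p)) r) = -(Ymat p ^ k).mulVec (vTot p) := rfl
  have e' : (fun r => Matrix.vecMul (wTot p) (Ymat p ^ k) r) =
    Matrix.vecMul (wTot p) (Ymat p ^ k) := rfl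
  rw [e, e', Matrix.mulVec_neg, dotProduct_neg, Matrix.mulVec_mulVec, ← Matrix.dotProduct_mulVec,
    Matrix.mulVec_mulVec, ← pow_add, ← pow_add, add_comm k j, add_neg_cancel, neg_zero]

lemma block_inv_mul (g : ∀ i : ZMod m, GL (Fin (α i)) ℂ) : block g⁻¹ * block g = 1 := by
  rw [← block_mul, inv_mul_cancel, block_one]

lemma block_mul_inv (g : ∀ i : ZMod m, GL (Fin (α i)) ℂ) : block g * block g⁻¹ = 1 := by
  rw [← block_mul, mul_inv_cancel, block_one]

lemma conj_pow {I : Type*} [Fintype I] [DecidableEq I] {g h : Matrix I I ℂ} (hg : h * g = 1)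
    (hg' : g * h = 1) (T : Matrix I I ℂ) (k : ℕ) : (g * T * h) ^ k = g * T ^ k * h := by
  induction k with
  | zero => simp [hg']
  | succ k ih =>
    rw [pow_succ, ih, pow_succ]
    calc g * T ^ k * h * (g * T * h) = g * T ^ k * (h * g) * T * h := by
          simp only [Matrix.mul_assoc]
      _ = _ := by rw [hg, Matrix.mul_one]; simp only [Matrix.mul_assoc]

lemma invariant_Ham (k : ℕ) : Invariant (Ham α k) := by
  rintro p q ⟨g, -, hY, hv, hw⟩
  rw [eval_Ham, eval_Ham, hY, conj_pow (block_inv_mul g) (block_mul_inv g), hv, hw,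
    Matrix.mulVec_mulVec, Matrix.mul_assoc (block g * _), block_inv_mul, Matrix.mul_one,
    ← Matrix.dotProduct_mulVec, Matrix.mulVec_mulVec, ← Matrix.mul_assoc, block_inv_mul,
    Matrix.one_mul]

/-- The chain rule: a curve of representations with velocity `D` at `t` differentiates every
polynomial by `D`. -/
lemma hasDerivAt_eval (D : Derivation ℂ (MvPolynomial (Coord α) ℂ) (MvPolynomial (Coord α) ℂ))
    {c : ℂ → Coord α → ℂ} {t : ℂ}
    (hc : ∀ a, HasDerivAt (fun z => c z a) (MvPolynomial.eval (c t) (D (gen α a))) t)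
    (F : MvPolynomial (Coord α) ℂ) :
    HasDerivAt (fun z => MvPolynomial.eval (c z) F) (MvPolynomial.eval (c t) (D F)) t := by
  induction F using MvPolynomial.induction_on with
  | C a => simpa using hasDerivAt_const t a
  | add F G hF hG => simpa using hF.fun_add hG
  | mul_X F a hF =>
    have := hF.fun_mul (hc a)
    simp only [map_mul, MvPolynomial.eval_X, D.leibniz, map_add, smul_eq_mul]
    refine this.congr_deriv ?_
    simp only [gen]
    ring

end Quiver

section Quiver
variable {m : ℕ} [NeZero m] {α : ZMod m → ℕ}

/-! ### The coefficients of `M` as invariant functions -/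

/-- The matrix element `a T b` over the rational functions. -/
def elt (a b : Idx α → ℂ) (T : Matrix (Idx α) (Idx α) (RatFunc ℂ)) : RatFunc ℂ :=
  ((Matrix.replicateRow Unit a).map RatFunc.C * T *
    (Matrix.replicateCol Unit b).map RatFunc.C) () ()

lemma elt_eq_sum (a b : Idx α → ℂ) (T : Matrix (Idx α) (Idx α) (RatFunc ℂ)) :
    elt a b T = ∑ c, ∑ r, RatFunc.C (a r) * T r c * RatFunc.C (b c) := by
  simp [elt, Matrix.mul_apply, Finset.sum_mul]

/-- The function `w_i (X - x)⁻¹ Y ^ n v_j`, out of which the coefficients of `M` are built. -/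
def resMoment (p : Coord α → ℂ) (i j : ZMod m) (n : ℕ) : RatFunc ℂ :=
  elt (wPart p i) (vPart p j) (resolvent (Xmat p) * (Ymat p ^ n).map RatFunc.C)

lemma resolvent_conj {I : Type*} [Fintype I] [DecidableEq I] {g h : Matrix I I ℂ} (hg : h * g = 1)
    (hg' : g * h = 1) (T : Matrix I I ℂ) :
    resolvent (g * T * h) = g.map RatFunc.C * resolvent T * h.map RatFunc.C := by
  have e1 : g.map (RatFunc.C (K := ℂ)) * h.map RatFunc.C = 1 := by
    rw [← Matrix.map_mul, hg', Matrix.map_one _ (map_zero _) (map_one _)]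
  have e2 : h.map (RatFunc.C (K := ℂ)) * g.map RatFunc.C = 1 := by
    rw [← Matrix.map_mul, hg, Matrix.map_one _ (map_zero _) (map_one _)]
  refine Matrix.inv_eq_right_inv ?_
  have e3 : (g * T * h).map RatFunc.C - Matrix.scalar I RatFunc.X = g.map RatFunc.C *
      (T.map RatFunc.C - Matrix.scalar I (RatFunc.X (K := ℂ))) * h.map RatFunc.C := by
    rw [Matrix.mul_sub, Matrix.sub_mul, Matrix.map_mul, Matrix.map_mul,
      ← (Matrix.scalar_commute _ (fun _ => Commute.all _ _) (g.map RatFunc.C)).eq,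
      Matrix.mul_assoc (Matrix.scalar I RatFunc.X), e1, Matrix.mul_one]
  rw [e3]
  have e4 := Matrix.mul_nonsing_inv _ (det_sub_scalar_ne_zero T).isUnit
  calc _ = g.map RatFunc.C * ((T.map RatFunc.C - Matrix.scalar I (RatFunc.X (K := ℂ))) *
        ((h.map RatFunc.C * g.map RatFunc.C) * resolvent T)) * h.map RatFunc.C := by
        simp only [Matrix.mul_assoc]
    _ = 1 := by rw [e2, Matrix.one_mul, resolvent, e4, Matrix.mul_one, e1]

lemma block_apply (g : ∀ i : ZMod m, GL (Fin (α i)) ℂ) (r c : Idx α) (h : r.1 ≠ c.1) :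
    block g r c = 0 :=
  Matrix.blockDiagonal'_apply_ne _ _ _ h

lemma part_block_mulVec (g : ∀ i : ZMod m, GL (Fin (α i)) ℂ) (b : Idx α → ℂ) (i : ZMod m) :
    part ((block g).mulVec b) i = (block g).mulVec (part b i) := by
  ext r
  simp only [part, Matrix.mulVec, dotProduct]
  split_ifs with h
  · refine Finset.sum_congr rfl fun c _ => ?_
    split_ifs with h'
    · rfl
    · rw [block_apply g r c fun e => h' (e ▸ h), zero_mul, zero_mul]
  · refine (Finset.sum_eq_zero fun c _ => ?_).symm
    split_ifs with h'
    · rw [block_apply g r c fun e => h (e.trans h'), zero_mul]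
    · rw [mul_zero]

lemma part_vecMul_block (g : ∀ i : ZMod m, GL (Fin (α i)) ℂ) (b : Idx α → ℂ) (i : ZMod m) :
    part (Matrix.vecMul b (block g)) i = Matrix.vecMul (part b i) (block g) := by
  ext c
  simp only [part, Matrix.vecMul, dotProduct]
  split_ifs with h
  · refine Finset.sum_congr rfl fun r _ => ?_
    split_ifs with h'
    · rfl
    · rw [block_apply g r c fun e => h' (e.trans h), mul_zero, mul_zero]
  · refine (Finset.sum_eq_zero fun r _ => ?_).symm
    split_ifs with h'
    · rw [block_apply g r c fun e => h (e.symm.trans h'), mul_zero]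
    · rw [zero_mul]

lemma elt_conj (a b : Idx α → ℂ) (g h : Matrix (Idx α) (Idx α) ℂ)
    (T : Matrix (Idx α) (Idx α) (RatFunc ℂ)) :
    elt (Matrix.vecMul a h) (g.mulVec b) T = elt a b (h.map RatFunc.C * T * g.map RatFunc.C) := by
  have e1 : Matrix.replicateRow Unit (Matrix.vecMul a h) = Matrix.replicateRow Unit a * h := rfl
  have e2 : Matrix.replicateCol Unit (g.mulVec b) = g * Matrix.replicateCol Unit b := rfl
  rw [elt, elt, e1, e2, Matrix.map_mul, Matrix.map_mul]
  simp only [Matrix.mul_assoc]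

lemma resMoment_invariant {p q : Coord α → ℂ} (h : SameOrbit p q) (i j : ZMod m) (n : ℕ) :
    resMoment p i j n = resMoment q i j n := by
  obtain ⟨g, hX, hY, hv, hw⟩ := h
  have e1 : vPart q j = (block g).mulVec (vPart p j) := by
    change part (vTot q) j = _
    rw [hv, part_block_mulVec]; rfl
  have e2 : wPart q i = Matrix.vecMul (wPart p i) (block g⁻¹) := by
    change part (wTot q) i = _
    rw [hw, part_vecMul_block]; rfl
  have e3 : (block g⁻¹).map (RatFunc.C (K := ℂ)) * (block g).map RatFunc.C = 1 := by
    rw [← Matrix.map_mul, block_inv_mul, Matrix.map_one _ (map_zero _) (map_one _)]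
  rw [resMoment, resMoment, e1, e2, elt_conj, hX, hY,
    resolvent_conj (block_inv_mul g) (block_mul_inv g),
    conj_pow (block_inv_mul g) (block_mul_inv g), Matrix.map_mul, Matrix.map_mul]
  congr 1
  symm
  calc _ = ((block g⁻¹).map (RatFunc.C (K := ℂ)) * (block g).map RatFunc.C) * resolvent (Xmat p) *
        ((block g⁻¹).map RatFunc.C * (block g).map RatFunc.C) * (Ymat p ^ n).map RatFunc.C *
        ((block g⁻¹).map RatFunc.C * (block g).map RatFunc.C) := by
        simp only [Matrix.mul_assoc]
    _ = _ := by rw [e3, Matrix.one_mul, Matrix.mul_one, Matrix.mul_one]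

/-! ### Numerators and denominators with invariant coefficients -/

local notation "𝔸" => MvPolynomial (Coord α) ℂ

/-- Evaluation of the coefficients of a polynomial in `x`, as a map to the rational functions. -/
def evalRat (p : Coord α → ℂ) : (MvPolynomial (Coord α) ℂ)[X] →+* RatFunc ℂ :=
  (algebraMap ℂ[X] (RatFunc ℂ)).comp (Polynomial.mapRingHom (MvPolynomial.eval p))

lemma evalRat_apply (p : Coord α → ℂ) (f : 𝔸[X]) :
    evalRat p f = algebraMap ℂ[X] (RatFunc ℂ) (f.map (MvPolynomial.eval p)) := rfl

lemma evalRat_C (p : Coord α → ℂ) (F : 𝔸) :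
    evalRat p (C F) = RatFunc.C (MvPolynomial.eval p F) := by
  rw [evalRat_apply, map_C, RatFunc.algebraMap_C]

lemma evalRat_X (p : Coord α → ℂ) : evalRat p (X : 𝔸[X]) = RatFunc.X := by
  rw [evalRat_apply, map_X, RatFunc.algebraMap_X]

/-- A twisted derivation applied to the coefficients of polynomials. -/
def TwistedDer.polyHom {A B : Type*} [CommRing A] [CommRing B] {φ : A →+* B} (δ : TwistedDer φ) :
    A[X] →+ B[X] where
  toFun f := ∑ n ∈ Finset.range (f.natDegree + 1), monomial n (δ.toHom (f.coeff n))
  map_zero' := by simp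
  map_add' f g := by
    have h : ∀ (f : A[X]) l, (∑ n ∈ Finset.range (f.natDegree + 1),
        monomial n (δ.toHom (f.coeff n))).coeff l = δ.toHom (f.coeff l) := fun f l => by
      simp only [finsetSum_coeff, coeff_monomial, Finset.sum_ite_eq', Finset.mem_range]
      split_ifs with hl
      · rfl
      · rw [coeff_eq_zero_of_natDegree_lt (by omega), map_zero]
    ext l
    rw [coeff_add, h, h, h, coeff_add, map_add]

lemma TwistedDer.polyHom_coeff {A B : Type*} [CommRing A] [CommRing B] {φ : A →+* B}
    (δ : TwistedDer φ) (f : A[X]) (l : ℕ) : (δ.polyHom f).coeff l = δ.toHom (f.coeff l) := by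
  change (∑ n ∈ Finset.range (f.natDegree + 1), monomial n (δ.toHom (f.coeff n))).coeff l = _
  simp only [finsetSum_coeff, coeff_monomial, Finset.sum_ite_eq', Finset.mem_range]
  split_ifs with hl
  · rfl
  · rw [coeff_eq_zero_of_natDegree_lt (by omega), map_zero]

lemma TwistedDer.polyHom_mul {A B : Type*} [CommRing A] [CommRing B] {φ : A →+* B}
    (δ : TwistedDer φ) (f g : A[X]) :
    δ.polyHom (f * g) = δ.polyHom f * g.map φ + f.map φ * δ.polyHom g := by
  ext l
  simp only [coeff_add, coeff_mul, δ.polyHom_coeff, coeff_map, map_sum, δ.leibniz,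
    Finset.sum_add_distrib]

/-- A derivation of the coefficients, followed by evaluation at a point. -/
def evalRatDer (D : Derivation ℂ (MvPolynomial (Coord α) ℂ) (MvPolynomial (Coord α) ℂ))
    (p : Coord α → ℂ) : TwistedDer (evalRat p) where
  toHom := (algebraMap ℂ[X] (RatFunc ℂ) : ℂ[X] →+ RatFunc ℂ).comp (evalDer D p).polyHom
  leibniz a b := by
    change algebraMap ℂ[X] (RatFunc ℂ) ((evalDer D p).polyHom (a * b)) =
      algebraMap ℂ[X] (RatFunc ℂ) ((evalDer D p).polyHom a) * _ +
        _ * algebraMap ℂ[X] (RatFunc ℂ) ((evalDer D p).polyHom b)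
    rw [TwistedDer.polyHom_mul, map_add, map_mul, map_mul]
    rfl

section
variable (D : Derivation ℂ (MvPolynomial (Coord α) ℂ) (MvPolynomial (Coord α) ℂ)) (p : Coord α → ℂ)

lemma evalRatDer_apply (f : 𝔸[X]) : (evalRatDer D p).toHom f =
    algebraMap ℂ[X] (RatFunc ℂ) ((evalDer D p).polyHom f) := rfl

lemma evalRatDer_C (F : 𝔸) :
    (evalRatDer D p).toHom (C F) = RatFunc.C (MvPolynomial.eval p (D F)) := by
  rw [evalRatDer_apply, ← RatFunc.algebraMap_C]
  congr 1
  ext l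
  rw [TwistedDer.polyHom_coeff, coeff_C, coeff_C]
  split_ifs
  · rfl
  · exact map_zero _

lemma evalRatDer_X : (evalRatDer D p).toHom X = 0 := by
  rw [evalRatDer_apply, ← map_zero (algebraMap ℂ[X] (RatFunc ℂ))]
  congr 1
  ext l
  rw [TwistedDer.polyHom_coeff, coeff_X, coeff_zero]
  split_ifs
  · exact (evalDer D p).map_one
  · exact map_zero _

end

variable (α) in
/-- The matrix `X - x` for the generic representation. -/
def genX : Matrix (Idx α) (Idx α) (MvPolynomial (Coord α) ℂ)[X] :=
  (Xmat (gen α)).map C - Matrix.scalar _ X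

variable (α) in
/-- The denominator `det (X - x)`. -/
def genDen : (MvPolynomial (Coord α) ℂ)[X] := (genX α).det

variable (α) in
/-- The numerator `w_i adj(X - x) Y ^ n v_j`. -/
def genNum (i j : ZMod m) (n : ℕ) : (MvPolynomial (Coord α) ℂ)[X] :=
  ((Matrix.replicateRow Unit (wPart (gen α) i)).map C *
    ((genX α).adjugate * (Ymat (gen α) ^ n).map C) *
      (Matrix.replicateCol Unit (vPart (gen α) j)).map C) () ()

section Evaluate
variable (p : Coord α → ℂ)

lemma map_C_evalRat {I J : Type*} (T : Matrix I J 𝔸) :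
    (T.map C).map (evalRat p) = (T.map (MvPolynomial.eval p)).map RatFunc.C := by
  ext1 r c; exact evalRat_C p _

lemma eval_Xmat : (Xmat (gen α)).map (MvPolynomial.eval p) = Xmat p := by
  rw [Xmat_map]; simp [gen]

lemma genX_evalRat : (genX α).map (evalRat p) =
    (Xmat p).map RatFunc.C - Matrix.scalar _ RatFunc.X := by
  have : (evalRat p).mapMatrix (genX α) = (evalRat p).mapMatrix ((Xmat (gen α)).map C) -
      (evalRat p).mapMatrix (Matrix.scalar _ X) := map_sub _ _ _
  rw [RingHom.mapMatrix_apply, RingHom.mapMatrix_apply, map_C_evalRat, eval_Xmat] at this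
  rw [this]
  congr 1
  ext1 r c
  by_cases h : r = c
  · subst h; simp [evalRat_X]
  · simp [h]

lemma evalRat_genDen : evalRat p (genDen α) =
    ((Xmat p).map RatFunc.C - Matrix.scalar (Idx α) (RatFunc.X (K := ℂ))).det := by
  rw [genDen, RingHom.map_det, RingHom.mapMatrix_apply, genX_evalRat]

lemma evalRat_genDen_ne_zero : evalRat p (genDen α) ≠ 0 := by
  rw [evalRat_genDen]; exact det_sub_scalar_ne_zero _

lemma adjugate_evalRat : (genX α).adjugate.map (evalRat p) =
    evalRat p (genDen α) • resolvent (Xmat p) := by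
  have := RingHom.map_adjugate (evalRat p) (genX α)
  rw [RingHom.mapMatrix_apply, RingHom.mapMatrix_apply, genX_evalRat] at this
  rw [this, resolvent, Matrix.inv_def, smul_smul, evalRat_genDen, Ring.mul_inverse_cancel, one_smul]
  exact (det_sub_scalar_ne_zero _).isUnit

lemma row_evalRat (i : ZMod m) :
    ((Matrix.replicateRow Unit (wPart (gen α) i)).map C).map (evalRat p) =
    (Matrix.replicateRow Unit (wPart p i)).map RatFunc.C := by
  rw [map_C_evalRat]
  congr 1
  ext r c
  simp only [Matrix.map_apply, Matrix.replicateRow_apply, wPart]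
  split_ifs
  · exact MvPolynomial.eval_X _
  · exact map_zero _

lemma col_evalRat (i : ZMod m) :
    ((Matrix.replicateCol Unit (vPart (gen α) i)).map C).map (evalRat p) =
    (Matrix.replicateCol Unit (vPart p i)).map RatFunc.C := by
  rw [map_C_evalRat]
  congr 1
  ext r c
  simp only [Matrix.map_apply, Matrix.replicateCol_apply, vPart]
  split_ifs
  · exact MvPolynomial.eval_X _
  · exact map_zero _

lemma Ypow_evalRat (n : ℕ) : ((Ymat (gen α) ^ n).map C).map (evalRat p) =
    (Ymat p ^ n).map RatFunc.C := by
  rw [map_C_evalRat, eval_Ymat_pow]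

lemma evalRat_genNum (i j : ZMod m) (n : ℕ) :
    evalRat p (genNum α i j n) = evalRat p (genDen α) * resMoment p i j n := by
  have h : evalRat p (genNum α i j n) = ((((Matrix.replicateRow Unit (wPart (gen α) i)).map C *
    ((genX α).adjugate * (Ymat (gen α) ^ n).map C) *
      (Matrix.replicateCol Unit (vPart (gen α) j)).map C)).map (evalRat p)) () () := rfl
  rw [h, Matrix.map_mul, Matrix.map_mul, Matrix.map_mul, row_evalRat, col_evalRat, Ypow_evalRat,
    adjugate_evalRat, Matrix.smul_mul, Matrix.mul_smul, Matrix.smul_mul]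
  rfl

end Evaluate

/-- Coefficients can be compared after passing to rational functions. -/
lemma coeff_eval_eq {p q : Coord α → ℂ} {f : 𝔸[X]} (h : evalRat p f = evalRat q f) (l : ℕ) :
    MvPolynomial.eval p (f.coeff l) = MvPolynomial.eval q (f.coeff l) := by
  have := RatFunc.algebraMap_injective ℂ h
  simpa only [coe_mapRingHom, coeff_map] using congrArg (fun f : ℂ[X] => f.coeff l) this

/-- Invariance is a consequence of that of the value `det (X - x)`, compared coefficient by
coefficient. -/
lemma genDen_invariant (l : ℕ) : Invariant ((genDen α).coeff l) := by
  intro p q h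
  refine coeff_eval_eq ?_ l
  obtain ⟨g, hX, -⟩ := h
  have e1 : (block g).map (RatFunc.C (K := ℂ)) * (block g⁻¹).map RatFunc.C = 1 := by
    rw [← Matrix.map_mul, block_mul_inv, Matrix.map_one _ (map_zero _) (map_one _)]
  have e3 : (Xmat q).map RatFunc.C - Matrix.scalar (Idx α) RatFunc.X = (block g).map RatFunc.C *
      ((Xmat p).map RatFunc.C - Matrix.scalar (Idx α) (RatFunc.X (K := ℂ))) *
        (block g⁻¹).map RatFunc.C := by
    rw [hX, Matrix.mul_sub, Matrix.sub_mul, Matrix.map_mul, Matrix.map_mul,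
      ← (Matrix.scalar_commute _ (fun _ => Commute.all _ _) ((block g).map RatFunc.C)).eq,
      Matrix.mul_assoc (Matrix.scalar _ RatFunc.X), e1, Matrix.mul_one]
  rw [evalRat_genDen, evalRat_genDen, e3, Matrix.det_mul, Matrix.det_mul, mul_right_comm,
    ← Matrix.det_mul, e1, Matrix.det_one, one_mul]

/-- The numerator is the product of the invariants `resMoment` and `det (X - x)`. -/
lemma genNum_invariant (i j : ZMod m) (n l : ℕ) : Invariant ((genNum α i j n).coeff l) := by
  intro p q h
  refine coeff_eval_eq ?_ l
  have hd : evalRat p (genDen α) = evalRat q (genDen α) := by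
    rw [evalRat_apply, evalRat_apply]
    congr 1
    ext l
    rw [coeff_map, coeff_map]
    exact genDen_invariant l p q h
  rw [evalRat_genNum, evalRat_genNum, hd, resMoment_invariant h]

/-- The quotient rule for the resolvent matrix elements: `(X - x)⁻¹` varies by
`-(X - x)⁻¹ X' (X - x)⁻¹`. -/
lemma quotient_rule_resMoment
    (D : Derivation ℂ (MvPolynomial (Coord α) ℂ) (MvPolynomial (Coord α) ℂ))
    (p : Coord α → ℂ) (hY : ∀ r c h, MvPolynomial.eval p (D (gen α (.Y r c h))) = 0)
    (i j : ZMod m) (n : ℕ) :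
    ((evalRatDer D p).toHom (genNum α i j n) * evalRat p (genDen α) -
      evalRat p (genNum α i j n) * (evalRatDer D p).toHom (genDen α)) / evalRat p (genDen α) ^ 2 =
    elt (part (fun r => MvPolynomial.eval p (D (gen α (.w r)))) i) (vPart p j)
        (resolvent (Xmat p) * (Ymat p ^ n).map RatFunc.C) -
      elt (wPart p i) (vPart p j) (resolvent (Xmat p) *
        (Xmat fun c => MvPolynomial.eval p (D (gen α c))).map RatFunc.C * resolvent (Xmat p) *
        (Ymat p ^ n).map RatFunc.C) +
      elt (wPart p i) (part (fun r => MvPolynomial.eval p (D (gen α (.v r)))) j)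
        (resolvent (Xmat p) * (Ymat p ^ n).map RatFunc.C) := by
  set δ := evalRatDer D p with hδ
  set q := evalRat p (genDen α) with hq
  have hq0 : q ≠ 0 := evalRat_genDen_ne_zero p
  set G := resolvent (Xmat p) with hG
  set X' := (Xmat fun c => MvPolynomial.eval p (D (gen α c))).map RatFunc.C with hX'
  have mapC : ∀ {I J : Type} (T : Matrix I J 𝔸), (T.map C).map δ.toHom =
      (T.map (evalDer D p).toHom).map RatFunc.C := fun T => by
    ext1 r c; exact evalRatDer_C D p _
  have hYn : ((Ymat (gen α) ^ n).map C).map δ.toHom = 0 := by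
    have : Ymat (fun c => (evalDer D p).toHom (gen α c)) = 0 := by
      ext r c
      rw [Ymat]
      split_ifs with h
      · exact hY r c h
      · rfl
    rw [mapC, (evalDer D p).matrix_pow, Ymat_map (evalDer D p).toHom, this]
    ext r c
    simp
  have hgX : (genX α).map δ.toHom = X' := by
    ext1 r c
    rw [hX', Matrix.map_apply, genX, Matrix.sub_apply, map_sub]
    have h1 : δ.toHom ((Matrix.scalar (Idx α) (X : 𝔸[X])) r c) = 0 := by
      rw [Matrix.scalar_apply, Matrix.diagonal_apply]
      split_ifs
      · exact evalRatDer_X D p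
      · exact map_zero _
    rw [h1, sub_zero, Matrix.map_apply, Matrix.map_apply, hδ, evalRatDer_C, Xmat, Xmat]
    split_ifs
    · rfl
    · rw [map_zero, map_zero]
  -- differentiate `(X - x) adj(X - x) = det (X - x)`
  have hadj : (genX α).adjugate.map δ.toHom = δ.toHom (genDen α) • G - q • (G * X' * G) := by
    have h := congrArg (fun T => T.map δ.toHom) (Matrix.mul_adjugate (genX α))
    have h1 : ((genX α).det • (1 : Matrix (Idx α) (Idx α) 𝔸[X])).map δ.toHom =
        δ.toHom (genDen α) • (1 : Matrix (Idx α) (Idx α) (RatFunc ℂ)) := by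
      ext1 r c
      rw [Matrix.map_apply, Matrix.smul_apply, Matrix.smul_apply, smul_eq_mul, smul_eq_mul,
        Matrix.one_apply, Matrix.one_apply]
      split_ifs
      · rw [mul_one, mul_one]; rfl
      · rw [mul_zero, mul_zero, map_zero]
    beta_reduce at h
    rw [h1, δ.matrix_mul, hgX, adjugate_evalRat, ← hG, ← hq, genX_evalRat] at h
    have h2 : G * ((Xmat p).map RatFunc.C - Matrix.scalar _ RatFunc.X) = 1 :=
      Matrix.nonsing_inv_mul _ (det_sub_scalar_ne_zero _).isUnit
    have h3 := congrArg (G * ·) h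
    beta_reduce at h3
    rw [Matrix.mul_add, ← Matrix.mul_assoc, ← Matrix.mul_assoc, h2, Matrix.one_mul,
      Matrix.mul_smul, Matrix.mul_smul, Matrix.mul_one] at h3
    rw [← h3, add_sub_cancel_left]
  have hw' : ((Matrix.replicateRow Unit (wPart (gen α) i)).map C).map δ.toHom =
      (Matrix.replicateRow Unit
        (part (fun r => MvPolynomial.eval p (D (gen α (.w r)))) i)).map RatFunc.C := by
    rw [mapC]
    congr 1
    ext r c
    simp only [Matrix.map_apply, Matrix.replicateRow_apply, wPart, part]
    split_ifs
    · rfl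
    · exact map_zero _
  have hv' : ((Matrix.replicateCol Unit (vPart (gen α) j)).map C).map δ.toHom =
      (Matrix.replicateCol Unit
        (part (fun r => MvPolynomial.eval p (D (gen α (.v r)))) j)).map RatFunc.C := by
    rw [mapC]
    congr 1
    ext r c
    simp only [Matrix.map_apply, Matrix.replicateCol_apply, vPart, part]
    split_ifs
    · rfl
    · exact map_zero _
  set a := (Matrix.replicateRow Unit (wPart p i)).map (RatFunc.C (K := ℂ)) with ha
  set b := (Matrix.replicateCol Unit (vPart p j)).map (RatFunc.C (K := ℂ)) with hb
  set Yn := (Ymat p ^ n).map (RatFunc.C (K := ℂ)) with hYn'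
  have hnum : δ.toHom (genNum α i j n) =
      q * elt (part (fun r => MvPolynomial.eval p (D (gen α (.w r)))) i) (vPart p j) (G * Yn) +
      (δ.toHom (genDen α) * elt (wPart p i) (vPart p j) (G * Yn) -
        q * elt (wPart p i) (vPart p j) (G * X' * G * Yn)) +
      q * elt (wPart p i) (part (fun r => MvPolynomial.eval p (D (gen α (.v r)))) j) (G * Yn) := by
    have h : δ.toHom (genNum α i j n) = ((((Matrix.replicateRow Unit (wPart (gen α) i)).map C *
      ((genX α).adjugate * (Ymat (gen α) ^ n).map C) *
        (Matrix.replicateCol Unit (vPart (gen α) j)).map C)).map δ.toHom) () () := rfl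
    rw [h, δ.matrix_mul (Matrix.map _ _ * _), δ.matrix_mul (Matrix.map _ _),
      δ.matrix_mul (genX α).adjugate, Matrix.map_mul, Matrix.map_mul, Matrix.map_mul,
      row_evalRat, col_evalRat, Ypow_evalRat, adjugate_evalRat, hYn, hadj, hw', hv', ← ha, ← hb,
      ← hYn', ← hG, ← hq, Matrix.mul_zero, add_zero]
    simp only [elt, ← ha, ← hb, Matrix.smul_mul, Matrix.mul_smul, Matrix.add_mul, Matrix.mul_sub,
      Matrix.sub_mul, Matrix.add_apply, Matrix.sub_apply, Matrix.smul_apply, smul_eq_mul,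
      Matrix.mul_assoc]
  rw [hnum, evalRat_genNum, ← hq, resMoment, ← hG, ← hYn']
  field_simp
  ring

end Quiver

section Quiver
variable {m : ℕ} [NeZero m] {α : ZMod m → ℕ} (P : Param m)

/-! ### Degrees of `M`, of its inverse and of `L` -/

/-- No entry involves powers of `y` above `y ^ N`. -/
def DegMat {I J : Type*} (N : ℤ) (T : Matrix I J P.Psd) : Prop := ∀ r c, (T r c).DegLE N

variable {P}

section
variable {I J K : Type*} [Fintype J] {a b : ℤ}

lemma DegMat.mul {S : Matrix I J P.Psd} {T : Matrix J K P.Psd} (h : DegMat P a S)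
    (h' : DegMat P b T) : DegMat P (a + b) (S * T) := fun r c => by
  rw [Matrix.mul_apply]; exact PDO.DegLE.sum fun i _ => (h r i).mul (h' i c)

omit [Fintype J] in
lemma degMat_cMat (T : Matrix I J ℂ) : DegMat P 0 (cMat P T) :=
  fun _ _ => PDO.degLE_monomial 0 _

end

lemma degMat_idemMat (a : ZMod m) : DegMat P 0 (idemMat α P a) := fun r c => by
  rw [idemMat, Matrix.diagonal_apply]
  split_ifs
  · exact PDO.degLE_monomial 0 _
  · exact fun _ _ => rfl

lemma degMat_Xhat (p : Coord α → ℂ) : DegMat P 0 (Xhat P p) := fun _ _ => PDO.degLE_monomial 0 _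

lemma degMat_Yhat (p : Coord α → ℂ) : DegMat P (-1) (Yhat P p) :=
  fun _ _ _ hn => if_neg (by omega)

lemma degMat_rowE (a : Idx α → ℂ) : DegMat P 0 (rowE P a) :=
  (degMat_cMat _).mul (degMat_idemMat _)

lemma degMat_colE (b : Idx α → ℂ) : DegMat P 0 (colE P b) :=
  (degMat_idemMat _).mul (degMat_cMat _)

lemma degLE_Mop_sub_one (p : Coord α → ℂ) : (Mop P p - 1).DegLE (-1) := by
  rw [Mop_eq, Mmat, Matrix.sub_apply, Matrix.one_apply_eq, sub_sub_cancel_left]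
  exact ((((degMat_rowE _).mul ((degMat_Xhat _).mul (degMat_Yhat _))).mul (degMat_colE _)) _ _).neg

lemma degLE_MopInv_sub_one (p : Coord α → ℂ) : (MopInv P p - 1).DegLE (-1) := by
  rw [MopInv_eq, Nmat, Matrix.add_apply, Matrix.one_apply_eq, add_sub_cancel_left]
  exact (((degMat_rowE _).mul ((degMat_Yhat _).mul (degMat_Xhat _))).mul (degMat_colE _)) _ _

lemma degLE_Mvar (p : Coord α → ℂ) (X' : Matrix (Idx α) (Idx α) ℂ) (v' w' : Idx α → ℂ) :
    (Mvar P p X' v' w' () ()).DegLE (-1) := by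
  rw [Mvar, Matrix.sub_apply, Matrix.add_apply, Matrix.neg_apply]
  have h1 := ((degMat_rowE (P := P) w').mul ((degMat_Xhat p).mul (degMat_Yhat p))).mul
    (degMat_colE (vTot p))
  have h2 := ((degMat_rowE (P := P) (wTot p)).mul ((((degMat_Xhat p).mul (degMat_cMat X')).mul
    (degMat_Xhat p)).mul (degMat_Yhat p))).mul (degMat_colE (vTot p))
  have h3 := ((degMat_rowE (P := P) (wTot p)).mul ((degMat_Xhat p).mul (degMat_Yhat p))).mul
    (degMat_colE v')
  exact (((h1 _ _).neg).add (h2 _ _)).sub (h3 _ _)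

lemma degLE_of_sub_one {u : P.Psd} (h : (u - 1).DegLE (-1)) : u.DegLE 0 := by
  have := (PDO.DegLE.mono h (by norm_num : (-1 : ℤ) ≤ 0)).add (PDO.degLE_monomial (S := P.skew) 0 1)
  have e : u - 1 + PDO.monomial P.skew 0 1 = u := sub_add_cancel u 1
  rwa [e] at this

lemma Lop_sub_y {p : Coord α → ℂ} : Lop P p - P.yPow 1 =
    (Mop P p - 1) * P.yPow 1 + (Mop P p - 1) * P.yPow 1 * (MopInv P p - 1) +
      P.yPow 1 * (MopInv P p - 1) := by
  rw [Lop]; noncomm_ring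

lemma degLE_Lop_sub_y (p : Coord α → ℂ) : (Lop P p - P.yPow 1).DegLE 0 := by
  have hy : (P.yPow 1).DegLE 1 := PDO.degLE_monomial 1 1
  have ha := degLE_Mop_sub_one (P := P) p
  have hb := degLE_MopInv_sub_one (P := P) p
  rw [Lop_sub_y]
  exact ((ha.mul hy).add (PDO.DegLE.mono ((ha.mul hy).mul hb) (by norm_num))).add (hy.mul hb)

/-- The coefficient of `L` at `y ^ 0` is `u - θ⁻¹(u)`, where `u` is the coefficient of `M` at
`y⁻¹`, and `θ` fixes the component at the identity of `Γ`. -/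
lemma Lop_coeff_zero_coeff_one {p : Coord α → ℂ} (hp : Moment P p) :
    ((Lop P p).coeff 0).coeff 1 = 0 := by
  have hy : (P.yPow 1).DegLE 1 := PDO.degLE_monomial 1 1
  have ha := degLE_Mop_sub_one (P := P) p
  have hb := degLE_MopInv_sub_one (P := P) p
  have hab : MopInv P p - 1 = -(Mop P p - 1) - (Mop P p - 1) * (MopInv P p - 1) := by
    have h := Mop_mul_MopInv P hp
    have : (Mop P p - 1) * (MopInv P p - 1) = Mop P p * MopInv P p - Mop P p - MopInv P p + 1 := by
      noncomm_ring
    rw [this, h]; abel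
  have hb1 : (MopInv P p - 1).coeff (-1) = -(Mop P p - 1).coeff (-1) := by
    rw [hab, PDO.sub_coeff, PDO.neg_coeff, (ha.mul hb) (-1) (by norm_num), sub_zero]
  have e1 : (Lop P p).coeff 0 = (Lop P p - P.yPow 1).coeff 0 := by
    rw [PDO.sub_coeff, Param.yPow, PDO.monomial_coeff, if_neg (by norm_num), sub_zero]
  have e2 : ((Mop P p - 1) * P.yPow 1).coeff 0 = (Mop P p - 1).coeff (-1) := by
    rw [Param.yPow, PDO.mul_yPow_coeff]; rfl
  have e3 : (P.yPow 1 * (MopInv P p - 1)).coeff 0 = P.skew.σ (-(Mop P p - 1).coeff (-1)) := by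
    rw [Param.yPow, PDO.y_mul_coeff, hb 0 (by norm_num), map_zero, add_zero, zero_sub, hb1]
  have e4 : ∀ f : Cross m, (P.skew.σ f).coeff 1 = f.coeff 1 := fun f => by
    change (twistHom _ f).coeff 1 = _
    rw [twistHom, mapCoeff_coeff]
    simp
  rw [e1, Lop_sub_y, PDO.add_coeff, PDO.add_coeff, e2, ((ha.mul hy).mul hb) 0 (by norm_num),
    add_zero, e3, map_neg, ← sub_eq_add_neg, SkewMonoidAlgebra.coeff_sub, Finsupp.sub_apply, e4,
    sub_self]

/-! ### Invariance and derivatives of `M` and `L` -/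

variable (P) in
/-- The series `a G (Y - y)⁻¹ b`. -/
def comp (p : Coord α → ℂ) (a b : Idx α → ℂ) (G : Matrix (Idx α) (Idx α) (RatFunc ℂ)) : P.Psd :=
  (fun r => const P (a r)) ⬝ᵥ (P.ratι.mapMatrix G * Yhat P p).mulVec fun c => const P (b c)

lemma comp_coeff (p : Coord α → ℂ) (a b : Idx α → ℂ) (G : Matrix (Idx α) (Idx α) (RatFunc ℂ))
    (n : ℤ) : (comp P p a b G).coeff n = if n < 0 then
      ofRat m (-elt a b (G * (Ymat p ^ (-n - 1).toNat).map RatFunc.C)) else 0 := by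
  have e : ∀ r s c, (const P (a r) * (P.ratι (G r s) * Yhat P p s c * const P (b c))).coeff n =
      if n < 0 then ofRat m (-(RatFunc.C (a r) * (G r s *
        RatFunc.C ((Ymat p ^ (-n - 1).toNat) s c)) * RatFunc.C (b c))) else 0 := fun r s c => by
    have h1 : P.ratι (G r s) * Yhat P p s c * const P (b c) =
        const P (b c) * (P.ratι (G r s) * Yhat P p s c) := (P.const_commute _ _).symm
    have h2 : ∀ (f : RatFunc ℂ) (u : P.Psd), (P.ratι f * u).coeff n = ofRat m f * u.coeff n :=
      fun f u => PDO.monomial_zero_mul_coeff n _ u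
    rw [h1, ← P.ratι_C, ← P.ratι_C, h2, h2, h2, Yhat_coeff]
    split_ifs
    · rw [crossC_apply, ← ratHom_apply, ← ratHom_apply, ← ratHom_apply, ← ratHom_apply, ← map_mul,
        ← map_mul, ← map_mul, map_neg, ← ratHom_apply]
      congr 1
      ring
    · simp only [mul_zero]
  simp only [comp, dotProduct, Matrix.mulVec, Matrix.mul_apply, RingHom.mapMatrix_apply,
    Matrix.map_apply, Finset.mul_sum, Finset.sum_mul, PDO.sum_coeff, e]
  split_ifs
  · simp only [← ratHom_apply, ← map_sum]
    refine congrArg (ratHom m) ?_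
    simp only [Finset.sum_neg_distrib, elt_eq_sum, Matrix.mul_apply, Matrix.map_apply,
      Finset.mul_sum, Finset.sum_mul]
    rw [Finset.sum_comm]
  · simp only [Finset.sum_const_zero]

lemma degLE_comp (p : Coord α → ℂ) (a b : Idx α → ℂ) (G : Matrix (Idx α) (Idx α) (RatFunc ℂ)) :
    (comp P p a b G).DegLE (-1) := fun n hn => by
  rw [comp_coeff, if_neg (by omega)]

lemma Mop_eq_sum (p : Coord α → ℂ) : Mop P p = 1 - ∑ i : ZMod m, ∑ j : ZMod m,
    P.idem i * comp P p (wPart p i) (vPart p j) (resolvent (Xmat p)) * P.idem j := rfl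

lemma Mop_invariant {p q : Coord α → ℂ} (h : SameOrbit p q) : Mop P p = Mop P q := by
  rw [Mop_eq_sum, Mop_eq_sum]
  refine congrArg (1 - ·) (Finset.sum_congr rfl fun i _ => Finset.sum_congr rfl fun j _ => ?_)
  refine congrArg (fun u => P.idem i * u * P.idem j) (PDO.ext (funext fun n => ?_))
  rw [comp_coeff, comp_coeff]
  have := resMoment_invariant h i j (-n - 1).toNat
  rw [resMoment, resMoment] at this
  rw [this]

lemma MopInv_invariant {p q : Coord α → ℂ} (hp : Moment P p) (hq : Moment P q)
    (h : SameOrbit p q) : MopInv P p = MopInv P q := by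
  have h1 := MopInv_mul_Mop P hp
  rw [Mop_invariant h] at h1
  exact left_inv_eq_right_inv h1 (Mop_mul_MopInv P hq)

lemma Lop_invariant {p q : Coord α → ℂ} (hp : Moment P p) (hq : Moment P q)
    (h : SameOrbit p q) : Lop P p = Lop P q := by
  rw [Lop, Lop, Mop_invariant h, MopInv_invariant hp hq h]

section Flow
variable {γ : ℂ → CMSpace α P} {t : ℂ} {k : ℕ} {ρ : ℂ → Fibre α P}

/-- Only invariant functions are known to be differentiable along a curve in the quotient, since the
representatives `ρ z` may depend on `z` wildly. -/
lemma polyHasDerivAt_of_isFlowAt (hγ : CMSpace.IsFlowAt (Ham α k) γ t)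
    (hρ : ∀ z, (ρ z).toCM = γ z) {f : (MvPolynomial (Coord α) ℂ)[X]}
    (hf : ∀ l, Invariant (f.coeff l)) :
    PolyHasDerivAt (fun z => f.map (MvPolynomial.eval (ρ z).1))
      ((evalDer (hamDer (Ham α k)) (ρ t).1).polyHom f) t := by
  refine ⟨⟨f.natDegree, fun z => natDegree_map_le⟩, fun l => ?_⟩
  rw [TwistedDer.polyHom_coeff, evalDer_apply, hamDer_apply]
  have h := hγ (f.coeff l) (hf l) (ρ t) (hρ t)
  have e : (fun z => (f.map (MvPolynomial.eval (ρ z).1)).coeff l) =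
      fun z => CMSpace.value (f.coeff l) (hf l) (γ z) := funext fun z => by
    rw [coeff_map, ← hρ z]; rfl
  rw [e]
  exact h

lemma resMoment_hasDerivAt (hγ : CMSpace.IsFlowAt (Ham α k) γ t)
    (hρ : ∀ z, (ρ z).toCM = γ z) (i j : ZMod m) (n : ℕ) :
    RatHasDerivAt (fun z => resMoment (ρ z).1 i j n)
      (elt (part (Matrix.vecMul (wTot (ρ t).1) (Ymat (ρ t).1 ^ k)) i) (vPart (ρ t).1 j)
        (resolvent (Xmat (ρ t).1) * (Ymat (ρ t).1 ^ n).map RatFunc.C) -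
      elt (wPart (ρ t).1 i) (vPart (ρ t).1 j) (resolvent (Xmat (ρ t).1) *
        (raise (Tvar (ρ t).1 k)).map RatFunc.C * resolvent (Xmat (ρ t).1) *
        (Ymat (ρ t).1 ^ n).map RatFunc.C) +
      elt (wPart (ρ t).1 i) (part (-(Ymat (ρ t).1 ^ k).mulVec (vTot (ρ t).1)) j)
        (resolvent (Xmat (ρ t).1) * (Ymat (ρ t).1 ^ n).map RatFunc.C)) t := by
  set p := (ρ t).1 with hp
  have hN := polyHasDerivAt_of_isFlowAt hγ hρ (genNum_invariant (α := α) i j n)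
  have hD := polyHasDerivAt_of_isFlowAt hγ hρ (genDen_invariant (α := α))
  have hq := quotient_rule_resMoment (hamDer (Ham α k)) p
    (fun r c h => eval_hamDer_Y p k c r h) i j n
  simp only [eval_hamDer_w, eval_hamDer_v] at hq
  have hX : (Xmat fun c => MvPolynomial.eval p (hamDer (Ham α k) (gen α c))) =
      raise (Tvar p k) := by
    ext r c
    rw [Xmat, raise]
    split_ifs with h
    · exact eval_hamDer_X p k r c h
    · rfl
  rw [hX] at hq
  have hne : ∀ z, (genDen α).map (MvPolynomial.eval (ρ z).1) ≠ 0 := fun z h =>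
    evalRat_genDen_ne_zero (ρ z).1 (by rw [evalRat_apply, h, map_zero])
  refine hN.ratHasDerivAt hD (hne t) (Filter.Eventually.of_forall fun z => ?_) ?_
  · rw [← evalRat_apply, ← evalRat_apply, evalRat_genNum,
      mul_div_cancel_left₀ _ (evalRat_genDen_ne_zero _)]
  · refine Eq.trans hq.symm ?_
    rw [map_sub, map_mul, map_mul, map_pow]
    rfl

lemma comp_hasDerivAt (hγ : CMSpace.IsFlowAt (Ham α k) γ t)
    (hρ : ∀ z, (ρ z).toCM = γ z) (i j : ZMod m) :
    PsdHasDerivAt (fun z => comp P (ρ z).1 (wPart (ρ z).1 i) (vPart (ρ z).1 j)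
        (resolvent (Xmat (ρ z).1)))
      (comp P (ρ t).1 (part (Matrix.vecMul (wTot (ρ t).1) (Ymat (ρ t).1 ^ k)) i) (vPart (ρ t).1 j)
        (resolvent (Xmat (ρ t).1)) -
      comp P (ρ t).1 (wPart (ρ t).1 i) (vPart (ρ t).1 j) (resolvent (Xmat (ρ t).1) *
        (raise (Tvar (ρ t).1 k)).map RatFunc.C * resolvent (Xmat (ρ t).1)) +
      comp P (ρ t).1 (wPart (ρ t).1 i) (part (-(Ymat (ρ t).1 ^ k).mulVec (vTot (ρ t).1)) j)
        (resolvent (Xmat (ρ t).1))) t := by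
  intro n
  simp only [PDO.add_coeff, PDO.sub_coeff, comp_coeff]
  change CrossHasDerivAt _ _ t
  by_cases hn : n < 0
  · simp only [if_pos hn]
    have h := (resMoment_hasDerivAt hγ hρ i j (-n - 1).toNat).neg
    have e : ∀ f g h : RatFunc ℂ, ofRat m (-f) - ofRat m (-g) + ofRat m (-h) =
        ofRat m (-(f - g + h)) := fun f g h => by
      simp only [← ratHom_apply, ← map_sub, ← map_add]
      congr 1
      ring
    rw [e]
    classical
    intro g
    simp only [ofRat, SkewMonoidAlgebra.coeff_single_apply]
    split_ifs
    · exact h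
    · exact RatHasDerivAt.const 0 t
  · simp only [if_neg hn, sub_zero, add_zero]
    exact CrossHasDerivAt.const 0 t

lemma degLE_idem (i : ZMod m) : (P.idem i).DegLE 0 := PDO.degLE_monomial 0 _

lemma Mdot_eq_sum (p : Coord α → ℂ) (k : ℕ) : Mdot P p k () () = -∑ i : ZMod m, ∑ j : ZMod m,
    P.idem i * (comp P p (part (Matrix.vecMul (wTot p) (Ymat p ^ k)) i) (vPart p j)
        (resolvent (Xmat p)) -
      comp P p (wPart p i) (vPart p j) (resolvent (Xmat p) *
        (raise (Tvar p k)).map RatFunc.C * resolvent (Xmat p)) +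
      comp P p (wPart p i) (part (-(Ymat p ^ k).mulVec (vTot p)) j) (resolvent (Xmat p))) *
    P.idem j := by
  have h1 := sum_part_sandwich P (Matrix.vecMul (wTot p) (Ymat p ^ k)) (vTot p)
    (Xhat P p * Yhat P p)
  have h2 := sum_part_sandwich P (wTot p) (vTot p)
    (Xhat P p * cMat P (raise (Tvar p k)) * Xhat P p * Yhat P p)
  have h3 := sum_part_sandwich P (wTot p) (-(Ymat p ^ k).mulVec (vTot p)) (Xhat P p * Yhat P p)
  have hX : Xhat P p * cMat P (raise (Tvar p k)) * Xhat P p = P.ratι.mapMatrix (resolvent (Xmat p) *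
      (raise (Tvar p k)).map RatFunc.C * resolvent (Xmat p)) := by
    rw [map_mul, map_mul]; rfl
  rw [hX] at h2
  rw [Mdot, Mvar, hX, Matrix.sub_apply, Matrix.add_apply, Matrix.neg_apply, ← h1, ← h2, ← h3,
    ← Finset.sum_neg_distrib, ← Finset.sum_neg_distrib, ← Finset.sum_add_distrib,
    ← Finset.sum_sub_distrib]
  refine Finset.sum_congr rfl fun i _ => ?_
  rw [← Finset.sum_neg_distrib, ← Finset.sum_neg_distrib, ← Finset.sum_add_distrib,
    ← Finset.sum_sub_distrib]
  refine Finset.sum_congr rfl fun j _ => ?_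
  rw [mul_add, mul_sub, add_mul, sub_mul, neg_add, neg_sub]
  change -(P.idem i * comp P p _ (vPart p j) (resolvent (Xmat p)) * P.idem j) +
    P.idem i * comp P p (wPart p i) (vPart p j) _ * P.idem j -
    P.idem i * comp P p (wPart p i) _ (resolvent (Xmat p)) * P.idem j = _
  abel

lemma Mop_hasDerivAt (hγ : CMSpace.IsFlowAt (Ham α k) γ t) (hρ : ∀ z, (ρ z).toCM = γ z) :
    PsdHasDerivAt (fun z => Mop P (ρ z).1) (Mdot P (ρ t).1 k () ()) t := by
  have hs := PsdHasDerivAt.sum (s := Finset.univ) fun (i : ZMod m) _ =>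
    PsdHasDerivAt.sum (s := Finset.univ) fun (j : ZMod m) _ =>
      ((PsdHasDerivAt.const (P.idem i) t).mul (comp_hasDerivAt hγ hρ i j) (fun _ => degLE_idem i)
        fun _ => degLE_comp _ _ _ _).mul (PsdHasDerivAt.const (P.idem j) t)
          (fun z => (degLE_idem i).mul (degLE_comp _ _ _ _)) fun _ => degLE_idem j
  have h := (PsdHasDerivAt.const (1 : P.Psd) t).add hs.neg
  rw [Mdot_eq_sum]
  simp only [Mop_eq_sum, sub_eq_add_neg]
  refine cast ?_ h
  congr 1
  simp only [zero_mul, zero_add, mul_zero, add_zero, sub_eq_add_neg]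

/-- The Sato–Wilson equation `M' M⁻¹ = (L ^ k)_+ - L ^ k`. -/
lemma Mdot_mul_MopInv {p : Coord α → ℂ} (hp : Moment P p) (k : ℕ) :
    Mdot P p k () () * MopInv P p = (Lop P p ^ k).pos - Lop P p ^ k := by
  have hL : Lop P p ^ k = Mop P p * P.y ^ k * MopInv P p := by
    induction k with
    | zero => rw [pow_zero, pow_zero, mul_one, Mop_mul_MopInv P hp]
    | succ k ih =>
      rw [pow_succ, ih, Lop, pow_succ]
      calc _ = Mop P p * P.y ^ k * (MopInv P p * Mop P p) * P.yPow 1 * MopInv P p := by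
            simp only [mul_assoc]
        _ = _ := by rw [MopInv_mul_Mop P hp, mul_one, mul_assoc (Mop P p)]; rfl
  have hn := nonnegMat_dressed hp k () ()
  have e : ((Mdot P p k + Mmat P p * scal P Unit P.y ^ k) * Nmat P p) () () =
      Mdot P p k () () * MopInv P p + Lop P p ^ k := by
    rw [hL, MopInv_eq, Mop_eq, ← unit_mul_apply, Matrix.add_apply, ← unit_mul_apply, add_mul,
      scal_pow, scal, Matrix.diagonal_apply_eq]
  rw [e] at hn
  have hd : (Mdot P p k () () * MopInv P p + Lop P p ^ k - Lop P p ^ k).DegLE (-1) := by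
    rw [add_sub_cancel_right]
    exact (degLE_Mvar p _ _ _).mul (degLE_of_sub_one (degLE_MopInv_sub_one p))
  rw [PDO.pos_eq_of_nonneg hn hd, add_sub_cancel_right]

/-- The `k`-th equation of the hierarchy: `L' = [M' M⁻¹, L]`, and `L ^ k` commutes with `L`. -/
lemma Lop_hasDerivAt (hγ : CMSpace.IsFlowAt (Ham α k) γ t) (hρ : ∀ z, (ρ z).toCM = γ z) :
    PsdHasDerivAt (fun z => Lop P (ρ z).1) (kpField k (Lop P (ρ t).1)) t := by
  have h := (Mop_hasDerivAt hγ hρ).conj (N := fun z => MopInv P (ρ z).1) (P.yPow 1)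
    (fun z => degLE_Mop_sub_one _) (degLE_Mvar _ _ _ _) (fun z => degLE_MopInv_sub_one _)
    (fun z => Mop_mul_MopInv P (ρ z).2) (MopInv_mul_Mop P (ρ t).2)
  rw [Mdot_mul_MopInv (ρ t).2] at h
  have e : kpField k (Lop P (ρ t).1) = ((Lop P (ρ t).1 ^ k).pos - Lop P (ρ t).1 ^ k) *
      Lop P (ρ t).1 - Lop P (ρ t).1 * ((Lop P (ρ t).1 ^ k).pos - Lop P (ρ t).1 ^ k) := by
    have hc : Lop P (ρ t).1 ^ k * Lop P (ρ t).1 = Lop P (ρ t).1 * Lop P (ρ t).1 ^ k :=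
      (pow_succ _ _).symm.trans (pow_succ' _ _)
    rw [kpField, sub_mul, mul_sub, hc]
    abel
  rw [e]
  exact h

end Flow
end Quiver

/-! ### Exponentials of polynomials in a matrix -/

section MatrixFlow
variable {I : Type*} [Fintype I] [DecidableEq I]

/-- The exponential of `∑ t_k T ^ k`. -/
def matExp (t : ℕ+ →₀ ℂ) (T : Matrix I I ℂ) : Matrix I I ℂ :=
  NormedSpace.exp (t.sum fun k z => z • T ^ (k : ℕ))

lemma matExp_zero (T : Matrix I I ℂ) : matExp 0 T = 1 := by
  rw [matExp, Finsupp.sum_zero_index, NormedSpace.exp_zero]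

lemma matExp_single (k : ℕ+) (z : ℂ) (T : Matrix I I ℂ) :
    matExp (Finsupp.single k z) T = NormedSpace.exp (z • T ^ (k : ℕ)) := by
  have e : (Finsupp.single k z).sum (fun k z => z • T ^ (k : ℕ)) = z • T ^ (k : ℕ) :=
    Finsupp.sum_single_index (zero_smul _ _)
  rw [matExp, e]

lemma commute_sum_smul_pow {S T : Matrix I I ℂ} (h : Commute S T) (t : ℕ+ →₀ ℂ) :
    Commute (t.sum fun k z => z • S ^ (k : ℕ)) T :=
  Finset.sum_induction _ (fun U => Commute U T) (fun _ _ => Commute.add_left) (Commute.zero_left T)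
    fun _ _ => (h.pow_left _).smul_left _

lemma matExp_add (s t : ℕ+ →₀ ℂ) (T : Matrix I I ℂ) :
    matExp (s + t) T = matExp s T * matExp t T := by
  have e : (s + t).sum (fun k z => z • T ^ (k : ℕ)) =
      (s.sum fun k z => z • T ^ (k : ℕ)) + t.sum fun k z => z • T ^ (k : ℕ) :=
    Finsupp.sum_add_index' (fun _ => zero_smul _ _) fun _ _ _ => add_smul _ _ _
  rw [matExp, e]
  exact Matrix.exp_add_of_commute _ _
    (commute_sum_smul_pow (commute_sum_smul_pow (Commute.refl T) t).symm s)

lemma commute_matExp {S T : Matrix I I ℂ} (h : Commute S T) (t : ℕ+ →₀ ℂ) :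
    Commute (matExp t S) T :=
  (commute_sum_smul_pow h t).exp_left

lemma matExp_conj {U V : Matrix I I ℂ} (hVU : V * U = 1) (t : ℕ+ →₀ ℂ) (T : Matrix I I ℂ) :
    matExp t (U * T * V) = U * matExp t T * V := by
  have h := Matrix.exp_units_conj ⟨U, V, mul_eq_one_comm.1 hVU, hVU⟩
    (t.sum fun k z => z • T ^ (k : ℕ))
  rw [matExp, matExp]
  refine Eq.trans (congrArg _ ?_) h
  simp only [Finsupp.sum, Units.val_mk, Units.inv_mk, Finset.mul_sum, Finset.sum_mul,
    Matrix.mul_smul, Matrix.smul_mul]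
  exact Finset.sum_congr rfl fun k _ => congrArg _ ((conj_pow hVU (mul_eq_one_comm.1 hVU) T k))

section
attribute [local instance] Matrix.linftyOpNormedRing Matrix.linftyOpNormedAlgebra

lemma hasDerivAt_matExp_single (k : ℕ+) (T : Matrix I I ℂ) (r c : I) :
    HasDerivAt (fun z => matExp (Finsupp.single k z) T r c) ((T ^ (k : ℕ)) r c) 0 := by
  have h := hasDerivAt_exp_smul_const (T ^ (k : ℕ)) (0 : ℂ)
  rw [zero_smul, NormedSpace.exp_zero, one_mul] at h
  have e : (fun z => matExp (Finsupp.single k z) T r c) =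
      fun z : ℂ => Matrix.entryLinearMap ℂ ℂ r c (NormedSpace.exp (z • T ^ (k : ℕ))) :=
    funext fun z => by rw [matExp_single]; rfl
  rw [e]
  exact ((Matrix.entryLinearMap ℂ ℂ r c).toContinuousLinearMap.hasFDerivAt.comp_hasDerivAt 0 h)

end

end MatrixFlow

/-! ### The Hamiltonian flows -/

section Quiver
variable {m : ℕ} [NeZero m] {α : ZMod m → ℕ} {P : Param m}

/-- The endomorphism of `V ⊕ V` with diagonal blocks `Y` and upper right block `v w`. -/
def Ydouble (p : Coord α → ℂ) : Matrix (Idx α ⊕ Idx α) (Idx α ⊕ Idx α) ℂ :=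
  Matrix.fromBlocks (Ymat p) (Matrix.vecMulVec (vTot p) (wTot p)) 0 (Ymat p)

/-- The diagonal block of `exp (∑ t_k 𝒴 ^ k)` for `𝒴 = Ydouble p`; it is `exp (∑ t_k Y ^ k)`. -/
def flowA (t : ℕ+ →₀ ℂ) (p : Coord α → ℂ) : Matrix (Idx α) (Idx α) ℂ :=
  (matExp t (Ydouble p)).toBlocks₁₁

/-- The upper right block of `exp (∑ t_k 𝒴 ^ k)` for `𝒴 = Ydouble p`. -/
def flowB (t : ℕ+ →₀ ℂ) (p : Coord α → ℂ) : Matrix (Idx α) (Idx α) ℂ :=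
  (matExp t (Ydouble p)).toBlocks₁₂

/-- The exponential inherits the shape of `𝒴`, since that shape is commutation with
`fromBlocks 0 1 0 0`. -/
lemma matExp_Ydouble (t : ℕ+ →₀ ℂ) (p : Coord α → ℂ) : matExp t (Ydouble p) =
    Matrix.fromBlocks (flowA t p) (flowB t p) 0 (flowA t p) := by
  have hc : Commute (Ydouble p) (Matrix.fromBlocks 0 1 0 0) := by
    simp [Commute, SemiconjBy, Ydouble, Matrix.fromBlocks_multiply]
  have h := (commute_matExp hc t).eq
  rw [← Matrix.fromBlocks_toBlocks (matExp t (Ydouble p)), Matrix.fromBlocks_multiply,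
    Matrix.fromBlocks_multiply, Matrix.fromBlocks_inj] at h
  simp only [Matrix.mul_zero, Matrix.zero_mul, Matrix.mul_one, Matrix.one_mul, add_zero,
    zero_add] at h
  obtain ⟨h1, h2, -, -⟩ := h
  conv_lhs => rw [← Matrix.fromBlocks_toBlocks (matExp t (Ydouble p)), ← h1, ← h2]
  rfl

lemma flowA_zero (p : Coord α → ℂ) : flowA 0 p = 1 := by
  rw [flowA, matExp_zero, ← Matrix.fromBlocks_one, Matrix.toBlocks_fromBlocks₁₁]

lemma flowB_zero (p : Coord α → ℂ) : flowB 0 p = 0 := by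
  rw [flowB, matExp_zero, ← Matrix.fromBlocks_one, Matrix.toBlocks_fromBlocks₁₂]

lemma flowA_add (s t : ℕ+ →₀ ℂ) (p : Coord α → ℂ) : flowA (s + t) p = flowA s p * flowA t p := by
  rw [flowA, matExp_add, matExp_Ydouble, matExp_Ydouble, Matrix.fromBlocks_multiply,
    Matrix.toBlocks_fromBlocks₁₁, Matrix.mul_zero, add_zero]

lemma flowB_add (s t : ℕ+ →₀ ℂ) (p : Coord α → ℂ) :
    flowB (s + t) p = flowA s p * flowB t p + flowB s p * flowA t p := by
  rw [flowB, matExp_add, matExp_Ydouble, matExp_Ydouble, Matrix.fromBlocks_multiply,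
    Matrix.toBlocks_fromBlocks₁₂]

lemma flowA_mul_neg (t : ℕ+ →₀ ℂ) (p : Coord α → ℂ) : flowA t p * flowA (-t) p = 1 := by
  rw [← flowA_add, add_neg_cancel, flowA_zero]

lemma flowA_neg_mul (t : ℕ+ →₀ ℂ) (p : Coord α → ℂ) : flowA (-t) p * flowA t p = 1 := by
  rw [← flowA_add, neg_add_cancel, flowA_zero]

/-- The blocks of the identity stating that `𝒴` commutes with its exponential. -/
lemma flow_commute (t : ℕ+ →₀ ℂ) (p : Coord α → ℂ) :
    flowA t p * Ymat p = Ymat p * flowA t p ∧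
      flowA t p * Matrix.vecMulVec (vTot p) (wTot p) + flowB t p * Ymat p =
        Ymat p * flowB t p + Matrix.vecMulVec (vTot p) (wTot p) * flowA t p := by
  have h := (commute_matExp (Commute.refl (Ydouble p)) t).eq
  rw [matExp_Ydouble, Ydouble, Matrix.fromBlocks_multiply, Matrix.fromBlocks_multiply,
    Matrix.fromBlocks_inj] at h
  simp only [Matrix.mul_zero, Matrix.zero_mul, add_zero, zero_add] at h
  exact ⟨h.1, h.2.1⟩

/-- `flowA` and `flowB` are compatible with conjugating `Y` and `v w` simultaneously. -/
lemma flow_conj {p q : Coord α → ℂ} {g h : Matrix (Idx α) (Idx α) ℂ} (hg : h * g = 1)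
    (hY : Ymat q = g * Ymat p * h) (hv : vTot q = g.mulVec (vTot p))
    (hw : wTot q = Matrix.vecMul (wTot p) h) (t : ℕ+ →₀ ℂ) :
    flowA t q = g * flowA t p * h ∧ flowB t q = g * flowB t p * h := by
  have e : Ydouble q = Matrix.fromBlocks g 0 0 g * Ydouble p * Matrix.fromBlocks h 0 0 h := by
    rw [Ydouble, Ydouble, hY, hv, hw, Matrix.fromBlocks_multiply, Matrix.fromBlocks_multiply]
    simp [Matrix.mul_vecMulVec, Matrix.vecMulVec_mul]
  have e1 : Matrix.fromBlocks h 0 0 h * Matrix.fromBlocks g 0 0 g = 1 := by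
    rw [Matrix.fromBlocks_multiply]
    simp [hg]
  have e2 := matExp_conj e1 t (Ydouble p)
  rw [← e, matExp_Ydouble, matExp_Ydouble, Matrix.fromBlocks_multiply, Matrix.fromBlocks_multiply,
    Matrix.fromBlocks_inj] at e2
  simp only [Matrix.mul_zero, Matrix.zero_mul, add_zero, zero_add] at e2
  exact ⟨e2.1, e2.2.1⟩

/-- The flow at time `t` on representations: with `A = exp (∑ t_k Y ^ k)` it maps `v` to `A⁻¹ v`,
`w` to `w A`, fixes `Y` and subtracts from `X` the components of `A⁻¹ B` in `⨁ Hom(V_i, V_{i+1})`,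
where `B = flowB t p`. -/
def flowRep (t : ℕ+ →₀ ℂ) (p : Coord α → ℂ) : Coord α → ℂ
  | .X r c h => p (.X r c h) - (flowA (-t) p * flowB t p) r c
  | .Y r c h => p (.Y r c h)
  | .v r => (flowA (-t) p).mulVec (vTot p) r
  | .w r => Matrix.vecMul (wTot p) (flowA t p) r

lemma Ymat_flowRep (t : ℕ+ →₀ ℂ) (p : Coord α → ℂ) : Ymat (flowRep t p) = Ymat p := rfl

lemma vTot_flowRep (t : ℕ+ →₀ ℂ) (p : Coord α → ℂ) :
    vTot (flowRep t p) = (flowA (-t) p).mulVec (vTot p) := rfl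

lemma wTot_flowRep (t : ℕ+ →₀ ℂ) (p : Coord α → ℂ) :
    wTot (flowRep t p) = Matrix.vecMul (wTot p) (flowA t p) := rfl

lemma Xmat_flowRep (t : ℕ+ →₀ ℂ) (p : Coord α → ℂ) :
    Xmat (flowRep t p) = Xmat p - raise (flowA (-t) p * flowB t p) := by
  ext r c
  rw [Matrix.sub_apply, Xmat, Xmat, raise]
  split_ifs
  · rfl
  · rw [sub_zero]

lemma raise_add (S T : Matrix (Idx α) (Idx α) ℂ) : raise (S + T) = raise S + raise T := by
  ext r c
  rw [Matrix.add_apply, raise, raise, raise]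
  split_ifs
  · rfl
  · rw [add_zero]

lemma coord_ext {p q : Coord α → ℂ} (hX : Xmat p = Xmat q) (hY : Ymat p = Ymat q)
    (hv : vTot p = vTot q) (hw : wTot p = wTot q) : p = q := by
  funext a
  match a with
  | .X r c h => simpa only [Xmat, dif_pos h] using congrFun (congrFun hX r) c
  | .Y r c h => simpa only [Ymat, dif_pos h] using congrFun (congrFun hY r) c
  | .v r => exact congrFun hv r
  | .w r => exact congrFun hw r

lemma flowRep_zero (p : Coord α → ℂ) : flowRep 0 p = p := by
  refine coord_ext ?_ rfl ?_ ?_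
  · rw [Xmat_flowRep, flowB_zero, Matrix.mul_zero]
    ext r c
    rw [Matrix.sub_apply, raise, Matrix.zero_apply, ite_self, sub_zero]
  · rw [vTot_flowRep, neg_zero, flowA_zero, Matrix.one_mulVec]
  · rw [wTot_flowRep, flowA_zero, Matrix.vecMul_one]

/-- The group law. The flow for time `t` conjugates `Y` and `v w` by `flowA t p`, hence also the
blocks for time `s`. -/
lemma flowRep_add (s t : ℕ+ →₀ ℂ) (p : Coord α → ℂ) :
    flowRep (s + t) p = flowRep s (flowRep t p) := by
  have hY : Ymat (flowRep t p) = flowA (-t) p * Ymat p * flowA t p := by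
    rw [Matrix.mul_assoc, ← (flow_commute t p).1, ← Matrix.mul_assoc, flowA_neg_mul, Matrix.one_mul,
      Ymat_flowRep]
  have hc := flow_conj (flowA_mul_neg t p) hY (vTot_flowRep t p) (wTot_flowRep t p)
  refine coord_ext ?_ rfl ?_ ?_
  · rw [Xmat_flowRep, Xmat_flowRep, Xmat_flowRep, (hc _).1, (hc _).2, sub_sub, ← raise_add,
      neg_add_rev, flowA_add, flowB_add]
    refine congrArg (fun T => Xmat p - raise T) ?_
    have h1 := flowA_mul_neg t p
    have h2 := flowA_neg_mul s p
    simp only [Matrix.mul_add, Matrix.mul_assoc]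
    rw [← Matrix.mul_assoc (flowA (-s) p) (flowA s p), h2, Matrix.one_mul,
      ← Matrix.mul_assoc (flowA t p) (flowA (-t) p), h1, Matrix.one_mul]
  · rw [vTot_flowRep, vTot_flowRep, vTot_flowRep, (hc _).1, neg_add_rev, flowA_add,
      Matrix.mulVec_mulVec, Matrix.mul_assoc (flowA (-t) p * _), flowA_mul_neg, Matrix.mul_one]
  · rw [wTot_flowRep, wTot_flowRep, wTot_flowRep, (hc _).1, flowA_add, Matrix.vecMul_vecMul,
      ← Matrix.mul_assoc, ← Matrix.mul_assoc, flowA_mul_neg, Matrix.one_mul]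

lemma Ymat_mul_raise_sub (p : Coord α → ℂ) (K : Matrix (Idx α) (Idx α) ℂ) (r c : Idx α) :
    (Ymat p * raise K - raise K * Ymat p) r c =
      if r.1 = c.1 then (Ymat p * K - K * Ymat p) r c else 0 := by
  have h1 : (Ymat p * raise K) r c = if r.1 = c.1 then (Ymat p * K) r c else 0 := by
    rw [Matrix.mul_apply, Matrix.mul_apply]
    split_ifs with h
    · refine Finset.sum_congr rfl fun s _ => ?_
      rw [Ymat, raise]
      split_ifs with h1 h2
      · rfl
      · exact absurd (h1.trans (by rw [h])) h2
      all_goals simp only [zero_mul]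
    · refine Finset.sum_eq_zero fun s _ => ?_
      rw [Ymat, raise]
      split_ifs with h1 h2
      · exact absurd (add_right_cancel (h1.symm.trans h2)) h
      all_goals simp only [mul_zero, zero_mul]
  have h2 : (raise K * Ymat p) r c = if r.1 = c.1 then (K * Ymat p) r c else 0 := by
    rw [Matrix.mul_apply, Matrix.mul_apply]
    split_ifs with h
    · refine Finset.sum_congr rfl fun s _ => ?_
      rw [Ymat, raise]
      split_ifs with h1 h2 h2
      · rfl
      · exact absurd (h.symm.trans h1) h2
      · exact absurd (h.trans h2) h1
      · simp only [mul_zero]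
    · refine Finset.sum_eq_zero fun s _ => ?_
      rw [Ymat, raise]
      split_ifs with h1 h2 h2
      · exact absurd (h1.trans h2.symm) h
      all_goals simp only [mul_zero, zero_mul]
  rw [Matrix.sub_apply, h1, h2, Matrix.sub_apply]
  split_ifs
  · rfl
  · rw [sub_zero]

/-- The change `[Y, A⁻¹ B]` of the commutator of `Y` and `X` cancels the change of `v w`. -/
lemma moment_flowRep {p : Coord α → ℂ} (hp : Moment P p) (t : ℕ+ →₀ ℂ) :
    Moment P (flowRep t p) := by
  rw [Moment] at hp ⊢
  rw [← hp, Ymat_flowRep, Xmat_flowRep]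
  set K := flowA (-t) p * flowB t p with hK
  set B := Matrix.vecMulVec (vTot p) (wTot p) with hB
  have hB' : Matrix.vecMulVec (vTot (flowRep t p)) (wTot (flowRep t p)) =
      flowA (-t) p * B * flowA t p := by
    rw [vTot_flowRep, wTot_flowRep, hB, Matrix.mul_vecMulVec, Matrix.vecMulVec_mul]
  have hcomm : Ymat p * K - K * Ymat p = B - flowA (-t) p * B * flowA t p := by
    have h1 := (flow_commute t p).2
    have h2 := (flow_commute (-t) p).1
    have h3 : Ymat p * flowB t p - flowB t p * Ymat p = flowA t p * B - B * flowA t p := by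
      rw [sub_eq_sub_iff_add_eq_add, ← h1, add_comm]
    rw [hK, ← Matrix.mul_assoc, ← h2, Matrix.mul_assoc, Matrix.mul_assoc, ← Matrix.mul_sub, h3,
      Matrix.mul_sub, ← Matrix.mul_assoc, flowA_neg_mul, Matrix.one_mul, Matrix.mul_assoc]
  ext r c
  have h4 := Ymat_mul_raise_sub p K r c
  rw [hcomm, Matrix.sub_apply, Matrix.sub_apply, ← hB'] at h4
  simp only [Matrix.mul_sub, Matrix.sub_mul, Matrix.sub_apply, sum_vecMulVec_part]
  rw [hB, Matrix.vecMulVec_apply, Matrix.vecMulVec_apply] at h4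
  simp only [vTot, wTot] at h4
  split_ifs at h4 ⊢
  · linear_combination -h4
  · linear_combination -h4

lemma raise_block_conj (g : ∀ i : ZMod m, GL (Fin (α i)) ℂ) (T : Matrix (Idx α) (Idx α) ℂ) :
    raise (block g * T * block g⁻¹) = block g * raise T * block g⁻¹ := by
  ext r c
  simp only [raise, Matrix.mul_apply, Finset.sum_mul]
  split_ifs with h
  · refine Finset.sum_congr rfl fun s _ => Finset.sum_congr rfl fun u _ => ?_
    by_cases h1 : r.1 = u.1
    · by_cases h2 : s.1 = c.1
      · rw [if_pos (by rw [← h1, h, h2])]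
      · rw [block_apply _ _ _ h2, mul_zero, mul_zero]
    · simp only [block_apply _ _ _ h1, zero_mul]
  · refine (Finset.sum_eq_zero fun s _ => Finset.sum_eq_zero fun u _ => ?_).symm
    by_cases h1 : r.1 = u.1
    · by_cases h2 : s.1 = c.1
      · rw [if_neg (by rw [← h1, h2]; exact h), mul_zero, zero_mul]
      · rw [block_apply _ _ _ h2, mul_zero]
    · rw [block_apply _ _ _ h1, zero_mul, zero_mul]

lemma SameOrbit.flowRep {p q : Coord α → ℂ} (h : SameOrbit p q) (t : ℕ+ →₀ ℂ) :
    SameOrbit (flowRep t p) (flowRep t q) := by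
  obtain ⟨g, hX, hY, hv, hw⟩ := h
  have e := block_inv_mul g
  have hc := flow_conj e hY hv hw
  refine ⟨g, ?_, hY, ?_, ?_⟩
  · rw [Xmat_flowRep, Xmat_flowRep, hX, (hc _).1, (hc _).2, Matrix.mul_sub, Matrix.sub_mul,
      ← raise_block_conj]
    refine congrArg (fun T : Matrix (Idx α) (Idx α) ℂ => block g * Xmat p * block g⁻¹ - raise T) ?_
    calc block g * flowA (-t) p * block g⁻¹ * (block g * flowB t p * block g⁻¹)
        = block g * flowA (-t) p * (block g⁻¹ * block g) * flowB t p * block g⁻¹ := by noncomm_ring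
      _ = _ := by rw [e]; noncomm_ring
  · rw [vTot_flowRep, vTot_flowRep, hv, (hc _).1, Matrix.mulVec_mulVec, Matrix.mulVec_mulVec,
      Matrix.mul_assoc, e, Matrix.mul_one]
  · rw [wTot_flowRep, wTot_flowRep, hw, (hc _).1, Matrix.vecMul_vecMul, Matrix.vecMul_vecMul,
      ← Matrix.mul_assoc, ← Matrix.mul_assoc, e, Matrix.one_mul]

/-- The flow on the Calogero–Moser space. -/
def flow (t : ℕ+ →₀ ℂ) : CMSpace α P → CMSpace α P :=
  Quotient.map (fun p : Fibre α P => (⟨flowRep t p.1, moment_flowRep p.2 t⟩ : Fibre α P))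
    fun _ _ h => SameOrbit.flowRep h t

lemma flow_toCM (t : ℕ+ →₀ ℂ) (p : Fibre α P) :
    flow t p.toCM = Fibre.toCM ⟨flowRep t p.1, moment_flowRep p.2 t⟩ := rfl

lemma flow_zero (x : CMSpace α P) : flow 0 x = x := by
  obtain ⟨p, rfl⟩ := Quotient.exists_rep x
  exact congrArg Fibre.toCM (Subtype.ext (flowRep_zero p.1))

lemma flow_add (s t : ℕ+ →₀ ℂ) (x : CMSpace α P) : flow (s + t) x = flow s (flow t x) := by
  obtain ⟨p, rfl⟩ := Quotient.exists_rep x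
  exact congrArg Fibre.toCM (Subtype.ext (flowRep_add s t p.1))

/-- The upper right block of `𝒴 ^ k` is the velocity of `X` under the flow of `H_k`, up to sign. -/
lemma Ydouble_pow (p : Coord α → ℂ) (k : ℕ) : Ydouble p ^ k =
    Matrix.fromBlocks (Ymat p ^ k) (-Tvar p k) 0 (Ymat p ^ k) := by
  induction k with
  | zero => simp [Tvar, Matrix.fromBlocks_one]
  | succ k ih =>
    rw [pow_succ', ih, Ydouble, Matrix.fromBlocks_multiply]
    simp only [Matrix.mul_zero, Matrix.zero_mul, add_zero, zero_add, ← pow_succ']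
    refine congrArg (fun T => Matrix.fromBlocks _ T _ _) ?_
    rw [Tvar, Tvar, neg_neg, neg_neg, Finset.sum_range_succ', Matrix.mul_sum]
    refine congrArg₂ _ (Finset.sum_congr rfl fun i _ => ?_) ?_
    · rw [pow_succ', show k + 1 - 1 - (i + 1) = k - 1 - i by omega]
      simp only [Matrix.mul_assoc]
    · rw [pow_zero, Matrix.one_mul, show k + 1 - 1 - 0 = k by omega]

lemma hasDerivAt_flowA (k : ℕ+) (p : Coord α → ℂ) (r c : Idx α) :
    HasDerivAt (fun z => flowA (Finsupp.single k z) p r c) ((Ymat p ^ (k : ℕ)) r c) 0 := by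
  have h := hasDerivAt_matExp_single k (Ydouble p) (Sum.inl r) (Sum.inl c)
  rw [Ydouble_pow] at h
  exact h

lemma hasDerivAt_flowB (k : ℕ+) (p : Coord α → ℂ) (r c : Idx α) :
    HasDerivAt (fun z => flowB (Finsupp.single k z) p r c) (-Tvar p k r c) 0 := by
  have h := hasDerivAt_matExp_single k (Ydouble p) (Sum.inl r) (Sum.inr c)
  rw [Ydouble_pow] at h
  exact h

lemma hasDerivAt_flowA_neg (k : ℕ+) (p : Coord α → ℂ) (r c : Idx α) :
    HasDerivAt (fun z => flowA (-Finsupp.single k z) p r c) (-(Ymat p ^ (k : ℕ)) r c) 0 := by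
  have h := hasDerivAt_flowA k p r c
  rw [← neg_zero] at h
  simpa only [Function.comp_def, Finsupp.single_neg, mul_neg, mul_one, neg_zero] using
    h.comp (0 : ℂ) (hasDerivAt_neg (0 : ℂ))

lemma hasDerivAt_flowRep (k : ℕ+) (p : Coord α → ℂ) (a : Coord α) :
    HasDerivAt (fun z => flowRep (Finsupp.single k z) p a)
      (MvPolynomial.eval p (hamDer (Ham α k) (gen α a))) 0 := by
  match a with
  | .X r c h =>
    rw [eval_hamDer_X]
    have hd : HasDerivAt (fun z => ∑ s, flowA (-Finsupp.single k z) p r s *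
        flowB (Finsupp.single k z) p s c) (-Tvar p k r c) 0 := by
      refine (HasDerivAt.fun_sum fun s _ =>
        (hasDerivAt_flowA_neg k p r s).fun_mul (hasDerivAt_flowB k p s c)).congr_deriv ?_
      simp only [Finsupp.single_zero, neg_zero, flowA_zero, flowB_zero, Matrix.zero_apply, mul_zero,
        zero_add, Matrix.one_apply, ite_mul, one_mul, zero_mul, Finset.sum_ite_eq, Finset.mem_univ,
        if_true]
    exact ((hasDerivAt_const _ (p (.X r c h))).fun_sub hd).congr_deriv (by ring)
  | .Y r c h =>
    rw [eval_hamDer_Y]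
    exact hasDerivAt_const _ _
  | .v r =>
    rw [eval_hamDer_v]
    refine (HasDerivAt.fun_sum fun s _ =>
        (hasDerivAt_flowA_neg k p r s).mul_const (vTot p s)).congr_deriv ?_
    simp only [neg_mul, Finset.sum_neg_distrib]
    rfl
  | .w r =>
    rw [eval_hamDer_w]
    exact HasDerivAt.fun_sum fun s _ => (hasDerivAt_flowA k p s r).const_mul (wTot p s)

/-- By the group law it suffices to differentiate at time zero, along an arbitrary representative of
the point that has been reached. -/
lemma isFlowAt_flow (k : ℕ+) (t : ℕ+ →₀ ℂ) (x : CMSpace α P) :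
    CMSpace.IsFlowAt (Ham α k) (fun z => flow (t + Finsupp.single k z) x) 0 := by
  intro F hF p hp
  have e : ∀ z, flow (t + Finsupp.single k z) x =
      Fibre.toCM ⟨flowRep (Finsupp.single k z) p.1, moment_flowRep p.2 _⟩ := fun z => by
    rw [add_comm, flow_add, ← flow_toCM, hp]
    beta_reduce
    rw [Finsupp.single_zero, add_zero]
  simp only [e]
  have h0 : flowRep (Finsupp.single k 0) p.1 = p.1 := by rw [Finsupp.single_zero, flowRep_zero]
  have h := hasDerivAt_eval (hamDer (Ham α k)) (c := fun z => flowRep (Finsupp.single k z) p.1)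
    (t := 0)
    (fun a => by rw [h0]; exact hasDerivAt_flowRep k p.1 a) F
  rw [h0, hamDer_apply] at h
  exact h

end Quiver

end CMKP
end

theorem mainTheorem1 {m : ℕ} [NeZero m] (P : CMKP.Param m) (hP : P.Regular) (α : ZMod m → ℕ) :
    -- the formula for the inverse of `M`
    (∀ p : CMKP.Fibre α P, CMKP.Mop P p.1 * CMKP.MopInv P p.1 = 1 ∧
      CMKP.MopInv P p.1 * CMKP.Mop P p.1 = 1) ∧
    -- the Hamiltonians are functions on the Calogero–Moser space and Poisson commute
    (∀ k : ℕ, CMKP.Invariant (CMKP.Ham α k)) ∧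
    (∀ j k : ℕ, CMKP.poisson (CMKP.Ham α j) (CMKP.Ham α k) = 0) ∧
    -- `M` and `L` are well defined on the Calogero–Moser space, with `M ∈ 1 + 𝒫_-`,
    -- `L ∈ y + 𝒫_0`, and vanishing identity component of the `y ^ 0` coefficient of `L`
    ∃ M L : CMKP.CMSpace α P → P.Psd,
      (∀ p : CMKP.Fibre α P, M p.toCM = CMKP.Mop P p.1 ∧ L p.toCM = CMKP.Lop P p.1) ∧
      (∀ x, ∀ n : ℤ, 0 ≤ n → (M x - 1).coeff n = 0) ∧
      (∀ x, ∀ n : ℤ, 1 ≤ n → (L x - P.yPow 1).coeff n = 0) ∧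
      (∀ x, ((L x).coeff 0).coeff 1 = 0) ∧
      -- integral curves of `H_k` go to integral curves of the `k`-th flow of the hierarchy
      (∀ k : ℕ, 1 ≤ k → ∀ (γ : ℂ → CMKP.CMSpace α P) (t : ℂ),
        CMKP.CMSpace.IsFlowAt (CMKP.Ham α k) γ t →
          CMKP.PsdHasDerivAt (fun z => L (γ z)) (CMKP.kpField k (L (γ t))) t) ∧
      -- the Hamiltonian flows are complete and commute; running all of them yields solutions
      -- of the whole hierarchy
      ∃ Φ : (ℕ+ →₀ ℂ) → CMKP.CMSpace α P → CMKP.CMSpace α P,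
        (∀ x, Φ 0 x = x) ∧ (∀ s t x, Φ (s + t) x = Φ s (Φ t x)) ∧
        (∀ (k : ℕ+) (t : ℕ+ →₀ ℂ) (x : CMKP.CMSpace α P),
          CMKP.CMSpace.IsFlowAt (CMKP.Ham α k) (fun z => Φ (t + Finsupp.single k z) x) 0) ∧
        (∀ (k : ℕ+) (t : ℕ+ →₀ ℂ) (x : CMKP.CMSpace α P),
          CMKP.PsdHasDerivAt (fun z => L (Φ (t + Finsupp.single k z) x))
            (CMKP.kpField k (L (Φ t x))) 0) := by
  set M : CMKP.CMSpace α P → P.Psd := Quotient.lift (fun p : CMKP.Fibre α P => CMKP.Mop P p.1)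
    fun _ _ h => CMKP.Mop_invariant h with hM
  set L : CMKP.CMSpace α P → P.Psd := Quotient.lift (fun p : CMKP.Fibre α P => CMKP.Lop P p.1)
    fun p q h => CMKP.Lop_invariant p.2 q.2 h with hL
  have key : ∀ k : ℕ, ∀ (γ : ℂ → CMKP.CMSpace α P) (t : ℂ),
      CMKP.CMSpace.IsFlowAt (CMKP.Ham α k) γ t →
        CMKP.PsdHasDerivAt (fun z => L (γ z)) (CMKP.kpField k (L (γ t))) t := by
    intro k γ t hγ
    -- representatives are chosen pointwise, with no regularity in the parameter
    choose ρ hρ using fun z => Quotient.exists_rep (γ z)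
    have e : ∀ z, L (γ z) = CMKP.Lop P (ρ z).1 := fun z => by rw [← hρ z]; rfl
    simp only [e]
    exact CMKP.Lop_hasDerivAt hγ hρ
  refine ⟨fun p => ⟨CMKP.Mop_mul_MopInv P p.2, CMKP.MopInv_mul_Mop P p.2⟩, CMKP.invariant_Ham,
    CMKP.poisson_Ham_Ham, M, L, fun p => ⟨rfl, rfl⟩, fun x n hn => ?_, fun x n hn => ?_, fun x => ?_,
    fun k _ => key k, CMKP.flow, CMKP.flow_zero, CMKP.flow_add, CMKP.isFlowAt_flow,
    fun k t x => ?_⟩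
  · obtain ⟨p, rfl⟩ := Quotient.exists_rep x
    exact CMKP.degLE_Mop_sub_one p.1 n (by omega)
  · obtain ⟨p, rfl⟩ := Quotient.exists_rep x
    exact CMKP.degLE_Lop_sub_y p.1 n (by omega)
  · obtain ⟨p, rfl⟩ := Quotient.exists_rep x
    exact CMKP.Lop_coeff_zero_coeff_one p.2
  · have h := key k _ 0 (CMKP.isFlowAt_flow k t x)
    rwa [Finsupp.single_zero, add_zero] at h
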